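/- **Corollary (Tarasov–Varchenko, Stokman).** Let $0<q<1$ and let $n$ be a non-negative integer. Write $(a)_\infty=\prod_{k\ge 0}(1-q^ka)$ and $\theta(a)=(a)_\infty(q/a)_\infty$. Let $\tau\in\mathbb C$ be arbitrary, put $t=q^\tau$, and let $a_1,a_2,b_1,b_2\in\mathbb C$ satisfy $$|qt^{2i-2}|<1\quad\text{and}\quad q<|a_1a_2b_1b_2t^{2i-2}|\qquad(i=1,\dots,n).$$ Assume that no denominator below vanishes, that is: $t^k\notin\{q^{-N}:N\ge 0\}$ and $a_ib_jt^{k-1}\notin\{q^{-N}:N\ge0\}$ for $1\le k\le n$ and $i,j\in\{1,2\}$, and $a_1a_2^{-1}t^m\notin q^{\mathbb Z}$ for all integers $m$ with $|m|<n$. For $z\in(\mathbb C^*)^n$ let $$\Phi(z)=\prod_{i=1}^n z_i\frac{(qa_1^{-1}z_i)_\infty}{(b_1z_i)_\infty}\frac{(qa_2^{-1}z_i)_\infty}{(b_2z_i)_\infty}\prod_{1\le i<j\le n}z_i^{2\tau-1}\frac{(qt^{-1}z_j/z_i)_\infty}{(tz_j/z_i)_\infty},\qquad \Delta(z)=\prod_{1\le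 i<j\le n}(z_i-z_j),$$ where complex powers are principal values. For $0\le i\le n$ let $$\zeta_i=\zeta_i(a_1,a_2)=(a_1,a_1t,\dots,a_1t^{i-1},a_2,a_2t,\dots,a_2t^{n-i-1}),$$ $$\Lambda_i=\{\nu\in\mathbb Z^n:\ 0\le\nu_1\le\cdots\le\nu_i\ \text{and}\ 0\le\nu_{i+1}\le\cdots\le\nu_n\},$$ and let $J(\zeta_i(a_1,a_2))$ be the truncated Jackson integral $$J(\zeta_i(a_1,a_2))=(1-q)^n\sum_{\nu\in\Lambda_i}\Phi(\zeta_iq^\nu)\,\Delta(\zeta_iq^\nu),\qquad \zeta_iq^\nu=\bigl((\zeta_i)_1q^{\nu_1},\dots,(\zeta_i)_nq^{\nu_n}\bigr).$$ Then each of these series converges absolutely, and $$\sum_{i=0}^{n}J(\zeta_i(a_1,a_2))\prod_{j=1}^{i}\frac{(a_1t^{j-1})^{-1-2(n-j)\tau}}{\theta(a_2a_1^{-1}t^{-j+1})}\prod_{k=1}^{n-i}\frac{(a_2t^{k-1})^{-1-2(n-i-k)\tau}}{\theta(a_1a_2^{-1}t^{i-k+1})} =(1-q)^n\prod_{k=1}^n\frac{(q)_\infty(t)_\infty(a_1a_2b_1b_2t^{n+k-2})_\infty}{(t^k)_\infty\prod_{i=1}^2\prod_{j=1}^2(a_ib_jt^{k-1})_\infty}.$$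 -/

import Mathlib

namespace QSelberg

noncomputable section

/-- The infinite `q`-shifted factorial `(a)_∞ = ∏_{k ≥ 0} (1 - q^k a)`. -/
def qPoch (q : ℝ) (a : ℂ) : ℂ := ∏' k : ℕ, (1 - (q : ℂ) ^ k * a)

/-- The theta function `θ(a) = (a)_∞ (q/a)_∞`. -/
def theta (q : ℝ) (a : ℂ) : ℂ := qPoch q a * qPoch q ((q : ℂ) / a)

/-- The function `Φ(z)` of Selberg type. The parameter `t` is meant to be `q ^ τ`; the complex
power is the principal branch, which satisfies `(x q^ν)^c = x^c q^(ν c)` for real `0 < q`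
and integral `ν`. -/
def Phi (q : ℝ) (τ t a₁ a₂ b₁ b₂ : ℂ) {n : ℕ} (z : Fin n → ℂ) : ℂ :=
  (∏ i : Fin n, z i * (qPoch q (q * a₁⁻¹ * z i) / qPoch q (b₁ * z i)) *
      (qPoch q (q * a₂⁻¹ * z i) / qPoch q (b₂ * z i))) *
    ∏ i : Fin n, ∏ j ∈ Finset.Ioi i, z i ^ (2 * τ - 1) *
      (qPoch q (q * t⁻¹ * (z j / z i)) / qPoch q (t * (z j / z i)))

/-- The difference product `Δ(z) = ∏_{i < j} (z_i - z_j)`. -/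
def Delta {n : ℕ} (z : Fin n → ℂ) : ℂ :=
  ∏ i : Fin n, ∏ j ∈ Finset.Ioi i, (z i - z j)

/-- The point `x q^ν = (x_1 q^{ν_1}, …, x_n q^{ν_n})`. -/
def qShift (q : ℝ) {n : ℕ} (x : Fin n → ℂ) (ν : Fin n → ℤ) : Fin n → ℂ :=
  fun m => x m * (q : ℂ) ^ (ν m)

/-- The Jackson integral over the full lattice,
`(1 - q)^n ∑_{ν ∈ ℤ^n} f(x_1 q^{ν_1}, …, x_n q^{ν_n})`. -/
def jackson (q : ℝ) {n : ℕ} (f : (Fin n → ℂ) → ℂ) (x : Fin n → ℂ) : ℂ :=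
  (1 - (q : ℂ)) ^ n * ∑' ν : Fin n → ℤ, f (qShift q x ν)

/-- The integrand `Φ(z) Δ(z)`. -/
def integrand (q : ℝ) (τ t a₁ a₂ b₁ b₂ : ℂ) {n : ℕ} (z : Fin n → ℂ) : ℂ :=
  Phi q τ t a₁ a₂ b₁ b₂ z * Delta z

/-- The Jackson integral of Selberg type, `J(x)`. -/
def J (q : ℝ) (τ t a₁ a₂ b₁ b₂ : ℂ) {n : ℕ} (x : Fin n → ℂ) : ℂ :=
  jackson q (integrand q τ t a₁ a₂ b₁ b₂) x

/-- The point `ζ_i(x₁, x₂) = (x₁, x₁ t, …, x₁ t^{i-1}, x₂, x₂ t, …, x₂ t^{n-i-1})`. -/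
def zeta (t x₁ x₂ : ℂ) (n i : ℕ) : Fin n → ℂ :=
  fun m => if (m : ℕ) < i then x₁ * t ^ (m : ℕ) else x₂ * t ^ ((m : ℕ) - i)

/-- The fan region `Λ_i ⊆ ℤ^n`: `0 ≤ ν_1 ≤ ⋯ ≤ ν_i` and `0 ≤ ν_{i+1} ≤ ⋯ ≤ ν_n`.
Coordinates are indexed from `0`, so the second block starts at index `i`. -/
def fan (n i : ℕ) : Set (Fin n → ℤ) :=
  {ν | (∀ m, 0 ≤ ν m) ∧
    ∀ m m' : Fin n, (m : ℕ) + 1 = (m' : ℕ) → (m' : ℕ) ≠ i → ν m ≤ ν m'}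

/-- The truncated Jackson integral of Selberg type `J(ζ_i(a₁, a₂))`: the sum defining `J`,
taken over the fan region `Λ_i`. -/
def truncJ (q : ℝ) (τ t a₁ a₂ b₁ b₂ : ℂ) (n i : ℕ) : ℂ :=
  (1 - (q : ℂ)) ^ n *
    ∑' ν : fan n i, integrand q τ t a₁ a₂ b₁ b₂ (qShift q (zeta t a₁ a₂ n i) ν.1)

theorem qPoch_eq_zero {q : ℝ} (a : ℂ) (k : ℕ) (h : (q : ℂ) ^ k * a = 1) : qPoch q a = 0 :=
  tprod_of_exists_eq_zero ⟨k, by simp [h]⟩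

theorem qPoch_zpow {q : ℝ} (hq : 0 < q) (d : ℤ) (hd : d < 0) :
    qPoch q ((q : ℂ) * (q : ℂ) ^ d) = 0 := by
  have hq' : (q : ℂ) ≠ 0 := by exact_mod_cast hq.ne'
  refine qPoch_eq_zero _ (-d - 1).toNat ?_
  rw [← zpow_natCast, Int.toNat_of_nonneg (by omega), ← zpow_one_add₀ hq', ← zpow_add₀ hq']
  have : -d - 1 + (1 + d) = 0 := by ring
  rw [this, zpow_zero]

/-- Off the fan region `Λ_i` the function `Φ` vanishes at `ζ_i(a₁, a₂) q^ν`. -/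
theorem integrand_eq_zero {q : ℝ} (hq : 0 < q) {τ t a₁ a₂ : ℂ} (b₁ b₂ : ℂ) (ht : t ≠ 0)
    (ha₁ : a₁ ≠ 0) (ha₂ : a₂ ≠ 0) {n i : ℕ} {ν : Fin n → ℤ} (hν : ν ∉ fan n i) :
    integrand q τ t a₁ a₂ b₁ b₂ (qShift q (zeta t a₁ a₂ n i) ν) = 0 := by
  have hq' : (q : ℂ) ≠ 0 := by exact_mod_cast hq.ne'
  by_contra hne
  unfold integrand Phi at hne
  have hΦ := left_ne_zero_of_mul hne
  have h1 := Finset.prod_ne_zero_iff.1 (left_ne_zero_of_mul hΦ)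
  have h2 := Finset.prod_ne_zero_iff.1 (right_ne_zero_of_mul hΦ)
  have hstep : ∀ m m' : Fin n, (m : ℕ) + 1 = (m' : ℕ) → (m' : ℕ) ≠ i → ν m ≤ ν m' := by
    intro m m' hm hi
    by_contra hlt
    have h3 := Finset.prod_ne_zero_iff.1 (h2 m (Finset.mem_univ _)) m'
      (Finset.mem_Ioi.2 (Fin.lt_def.2 (by omega)))
    have h4 := (div_ne_zero_iff.1 (right_ne_zero_of_mul h3)).1
    apply h4
    have key : (q : ℂ) * t⁻¹ * (qShift q (zeta t a₁ a₂ n i) ν m' /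
        qShift q (zeta t a₁ a₂ n i) ν m) = (q : ℂ) * (q : ℂ) ^ (ν m' - ν m) := by
      rw [zpow_sub₀ hq']
      have hz := zpow_ne_zero (ν m) hq'
      unfold qShift zeta
      by_cases hc : (m' : ℕ) < i
      · rw [if_pos hc, if_pos (by omega), ← hm, pow_succ]
        field_simp
      · rw [if_neg hc, if_neg (by omega), ← hm, Nat.sub_add_comm (by omega), pow_succ]
        field_simp
    rw [key]
    exact qPoch_zpow hq _ (by omega)
  have hhead : ∀ m : Fin n, ((m : ℕ) = 0 ∨ (m : ℕ) = i) → 0 ≤ ν m := by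
    intro m hm
    by_contra hlt
    have h3 := h1 m (Finset.mem_univ _)
    by_cases hc : (m : ℕ) < i
    · have h4 := (div_ne_zero_iff.1 (right_ne_zero_of_mul (left_ne_zero_of_mul h3))).1
      apply h4
      have hm0 : (m : ℕ) = 0 := by omega
      have key : (q : ℂ) * a₁⁻¹ * qShift q (zeta t a₁ a₂ n i) ν m =
          (q : ℂ) * (q : ℂ) ^ (ν m) := by
        unfold qShift zeta
        rw [if_pos hc, hm0]
        field_simp
      rw [key]
      exact qPoch_zpow hq _ (by omega)
    · have h4 := (div_ne_zero_iff.1 (right_ne_zero_of_mul h3)).1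
      apply h4
      have hm0 : (m : ℕ) - i = 0 := by omega
      have key : (q : ℂ) * a₂⁻¹ * qShift q (zeta t a₁ a₂ n i) ν m =
          (q : ℂ) * (q : ℂ) ^ (ν m) := by
        unfold qShift zeta
        rw [if_neg hc, hm0]
        field_simp
      rw [key]
      exact qPoch_zpow hq _ (by omega)
  apply hν
  refine ⟨?_, hstep⟩
  rintro ⟨m, hm⟩
  induction m with
  | zero => exact hhead _ (Or.inl rfl)
  | succ m ih =>
    by_cases hi : m + 1 = i
    · exact hhead _ (Or.inr hi)
    · exact (ih (by omega)).trans (hstep ⟨m, by omega⟩ ⟨m + 1, hm⟩ rfl hi)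

/-- The truncated Jackson integral is the value of `J` at the point `ζ_i(a₁, a₂)`. -/
theorem J_zeta_eq_truncJ {q : ℝ} (hq : 0 < q) {τ t a₁ a₂ : ℂ} (b₁ b₂ : ℂ) (ht : t ≠ 0)
    (ha₁ : a₁ ≠ 0) (ha₂ : a₂ ≠ 0) (n i : ℕ) :
    J q τ t a₁ a₂ b₁ b₂ (zeta t a₁ a₂ n i) = truncJ q τ t a₁ a₂ b₁ b₂ n i := by
  unfold J jackson truncJ
  congr 1
  symm
  refine tsum_subtype_eq_of_support_subset
    (f := fun ν => integrand q τ t a₁ a₂ b₁ b₂ (qShift q (zeta t a₁ a₂ n i) ν)) ?_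
  intro ν hν
  by_contra hn
  exact hν (integrand_eq_zero hq b₁ b₂ ht ha₁ ha₂ hn)

end

end QSelberg

/-!
The coefficient of the `i`-th truncated Jackson integral absorbs all complex powers. With
`z = ζ_i q^ν`, the quantity `coefficient * Φ(z)` is the weight `wt i ν`, which depends on `t` but
not on `τ`, and the left side is `(1 - q)^n ⟨1⟩`, where
`⟨g⟩ = ∑_i ∑_ν wt i ν * Δ(z) * g(z)` is the functional `total`. The sum over `i` matters because the
lattices fit together at infinity, and `⟨1⟩` is computed from its dependence on `a₁`.

*Difference relations.* For each variable `z_r` the shift `z_r ↦ q z_r` multiplies the weight by a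
rational function (`bdry_succ`), so that sums over cubes telescope. What remains is a boundary term
at infinity, which lives on the last variable of each of the two blocks. The theta factors are such
that the end of the second block of the lattice `i` cancels the end of the first block of the
lattice `i + 1` (`thetaCoef_succ`, `tendsto_bdry_last`, `tendsto_bdry_mid`, `sum_boundary_limits`).
The relations of the single variables are combined with the help of an expansion of a Vandermonde
determinant (`sum_Delta_mul_eval`): with `A(y) = (1 - y/a₁)(1 - y/a₂)`,
`B(y) = (1 - b₁ y)(1 - b₂ y)` and a polynomial `c` of degree two, the function
`p(y) = ⟨∏_j (z_j - y)⟩` satisfies the second-order equation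
`t^n A(y) p(y/t) + t^(n-1) B(y) p(t y) = c(y) p(y)` (`total_diffOp`). It is a polynomial of degree at
most `n` with leading coefficient `(-1)^n ⟨1⟩`. On the Newton basis with nodes `a₁ t^k` the equation
is a two-term recursion, and this gives `p(a₁) = ⟨∏_j (z_j - a₁)⟩` as an explicit multiple of `⟨1⟩`
(`total_prod_sub`).

*Shift.* Replacing `a₁` by `q a₁` moves the lattices into themselves. The points that are lost have a
coordinate equal to `a₁`, and the weights change by a constant times `∏_j (z_j - a₁)`, with the same
constant for all lattices (`shift_constant`). So `p(a₁)` is a multiple of `⟨1⟩` at `q a₁`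
(`total_shift`), and `⟨1⟩` satisfies a first-order recursion in `a₁` (`total_one_recursion`).

*Limit.* Along `a₁ q^N` every lattice with `i > 0` carries a factor `1 / θ(u q^(-N))`, which decays
faster than any geometric progression, and on the lattice `i = 0` only the origin survives
(`tendsto_total_one`). The iterated recursion then yields the infinite products.

Convergence rests on the bound `wt_bound`: the weight times `∏_{k<l} (|z_k| + |z_l|)` is at most a
constant times `∏_k q^(ν_k) ∏_{k<l} R^(min (ν_k, ν_l))` with `R = max 1 |t|²`, and this is summable
because `q R^(n-1) < 1`.
-/

open Filter Topology

namespace QSelberg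

/-! ### Infinite products and theta functions -/

theorem summable_norm_qPoch_factor {q : ℝ} (hq0 : 0 < q) (hq1 : q < 1) (a : ℂ) :
    Summable fun k : ℕ => ‖-((q : ℂ) ^ k * a)‖ := by
  simp only [norm_neg, norm_mul, norm_pow, Complex.norm_real, Real.norm_of_nonneg hq0.le]
  exact (summable_geometric_of_lt_one hq0.le hq1).mul_right _

theorem multipliable_qPoch {q : ℝ} (hq0 : 0 < q) (hq1 : q < 1) (a : ℂ) :
    Multipliable fun k : ℕ => 1 - (q : ℂ) ^ k * a := by
  simpa only [sub_eq_add_neg] using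
    multipliable_one_add_of_summable (summable_norm_qPoch_factor hq0 hq1 a)

theorem tendsto_prod_qPoch {q : ℝ} (hq0 : 0 < q) (hq1 : q < 1) (a : ℂ) :
    Tendsto (fun N => ∏ k ∈ Finset.range N, (1 - (q : ℂ) ^ k * a)) atTop (𝓝 (qPoch q a)) :=
  (multipliable_qPoch hq0 hq1 a).hasProd.tendsto_prod_nat

theorem qPoch_step {q : ℝ} (hq0 : 0 < q) (hq1 : q < 1) (a : ℂ) :
    qPoch q a = (1 - a) * qPoch q (q * a) := by
  have h : ∀ N : ℕ, ∏ k ∈ Finset.range (N + 1), (1 - (q : ℂ) ^ k * a) =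
      (1 - a) * ∏ k ∈ Finset.range N, (1 - (q : ℂ) ^ k * (q * a)) := fun N => by
    rw [Finset.prod_range_succ', mul_comm, pow_zero, one_mul]
    simp only [pow_succ, mul_assoc]
  have h1 := (tendsto_prod_qPoch hq0 hq1 a).comp (tendsto_add_atTop_nat 1)
  refine tendsto_nhds_unique h1 ?_
  simpa only [Function.comp_def, h] using (tendsto_prod_qPoch hq0 hq1 (q * a)).const_mul (1 - a)

theorem qPoch_ne_zero {q : ℝ} (hq0 : 0 < q) (hq1 : q < 1) {a : ℂ}
    (h : ∀ N : ℕ, a * (q : ℂ) ^ N ≠ 1) : qPoch q a ≠ 0 := by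
  have := tprod_one_add_ne_zero_of_summable (f := fun k : ℕ => -((q : ℂ) ^ k * a))
    (fun k hk => h k (by linear_combination -hk)) (summable_norm_qPoch_factor hq0 hq1 a)
  simpa only [qPoch, sub_eq_add_neg] using this

theorem qPoch_zero (q : ℝ) : qPoch q 0 = 1 := by simp [qPoch]

theorem continuous_qPoch {q : ℝ} (hq0 : 0 < q) (hq1 : q < 1) : Continuous (qPoch q) := by
  rw [continuous_iff_continuousAt]
  intro a
  have := tendsto_tprod_one_add_of_dominated_convergence (𝓕 := 𝓝 a)
    (f := fun (x : ℂ) (k : ℕ) => -((q : ℂ) ^ k * x)) (g := fun k => -((q : ℂ) ^ k * a))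
    (bound := fun k => q ^ k * (‖a‖ + 1))
    ((summable_geometric_of_lt_one hq0.le hq1).mul_right _)
    (fun k => Continuous.tendsto (by fun_prop) a) (by
      filter_upwards [Metric.ball_mem_nhds a one_pos] with x hx k
      rw [norm_neg, norm_mul, norm_pow, Complex.norm_real, Real.norm_of_nonneg hq0.le]
      gcongr
      rw [Metric.mem_ball, dist_eq_norm] at hx
      calc ‖x‖ = ‖a + (x - a)‖ := by ring_nf
        _ ≤ ‖a‖ + 1 := (norm_add_le _ _).trans (by gcongr))
  have e : qPoch q = fun x => ∏' k : ℕ, (1 - (q : ℂ) ^ k * x) := rfl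
  simpa only [ContinuousAt, e, sub_eq_add_neg] using this

theorem tendsto_ofReal_pow {q : ℝ} (hq0 : 0 < q) (hq1 : q < 1) :
    Tendsto (fun m : ℕ => (q : ℂ) ^ m) atTop (𝓝 0) :=
  tendsto_pow_atTop_nhds_zero_of_norm_lt_one
    (by rwa [Complex.norm_real, Real.norm_of_nonneg hq0.le])

theorem tendsto_qPoch_one {q : ℝ} (hq0 : 0 < q) (hq1 : q < 1) {α : Type*} {l : Filter α}
    {f : α → ℂ} (hf : Tendsto f l (𝓝 0)) : Tendsto (fun m => qPoch q (f m)) l (𝓝 1) := by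
  have := ((continuous_qPoch hq0 hq1).tendsto 0).comp hf
  rwa [qPoch_zero] at this

theorem exists_qPoch_bound {q : ℝ} (hq0 : 0 < q) (hq1 : q < 1) (u : ℂ) :
    ∃ C : ℝ, 0 < C ∧ ∀ m : ℕ, ‖qPoch q (u * (q : ℂ) ^ m)‖ ≤ C := by
  have h : Tendsto (fun m : ℕ => u * (q : ℂ) ^ m) atTop (𝓝 0) := by
    simpa using (tendsto_ofReal_pow hq0 hq1).const_mul u
  obtain ⟨C, hC⟩ := (Metric.isBounded_range_of_tendsto _
    (tendsto_qPoch_one hq0 hq1 h)).exists_norm_le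
  exact ⟨max C 1, by positivity, fun m => (hC _ ⟨m, rfl⟩).trans (le_max_left _ _)⟩

/-- No hypothesis on zeros is needed: the sequence tends to `1`, and `0⁻¹ = 0`. -/
theorem exists_qPoch_inv_bound {q : ℝ} (hq0 : 0 < q) (hq1 : q < 1) (u : ℂ) :
    ∃ C : ℝ, 0 < C ∧ ∀ m : ℕ, ‖(qPoch q (u * (q : ℂ) ^ m))⁻¹‖ ≤ C := by
  have h : Tendsto (fun m : ℕ => u * (q : ℂ) ^ m) atTop (𝓝 0) := by
    simpa using (tendsto_ofReal_pow hq0 hq1).const_mul u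
  obtain ⟨C, hC⟩ := (Metric.isBounded_range_of_tendsto _
    ((tendsto_qPoch_one hq0 hq1 h).inv₀ one_ne_zero)).exists_norm_le
  exact ⟨max C 1, by positivity, fun m => (hC _ ⟨m, rfl⟩).trans (le_max_left _ _)⟩

theorem theta_mul_q {q : ℝ} (hq0 : 0 < q) (hq1 : q < 1) {x : ℂ} (hx : x ≠ 0) :
    theta q (q * x) = -x⁻¹ * theta q x := by
  have hq : (q : ℂ) ≠ 0 := by exact_mod_cast hq0.ne'
  unfold theta
  rw [qPoch_step hq0 hq1 x, qPoch_step hq0 hq1 ((q : ℂ) / (q * x))]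
  have : (q : ℂ) * (q / (q * x)) = q / x := by field_simp
  rw [this]
  have : (q : ℂ) / (q * x) = x⁻¹ := by field_simp
  rw [this]
  field_simp
  ring

theorem theta_inv {q : ℝ} (hq0 : 0 < q) (hq1 : q < 1) {x : ℂ} (hx : x ≠ 0) :
    theta q x⁻¹ = -x⁻¹ * theta q x := by
  unfold theta
  rw [qPoch_step hq0 hq1 x, qPoch_step hq0 hq1 x⁻¹, div_inv_eq_mul, ← div_eq_mul_inv]
  field_simp
  ring

theorem qPoch_ne_zero_of_zpow {q : ℝ} (hq0 : 0 < q) (hq1 : q < 1) {x : ℂ}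
    (h : ∀ l : ℤ, x ≠ (q : ℂ) ^ l) : qPoch q x ≠ 0 := by
  have hq : (q : ℂ) ≠ 0 := by exact_mod_cast hq0.ne'
  refine qPoch_ne_zero hq0 hq1 fun N hN => h (-N) ?_
  rw [zpow_neg, zpow_natCast]
  exact eq_inv_of_mul_eq_one_left hN

theorem theta_ne_zero {q : ℝ} (hq0 : 0 < q) (hq1 : q < 1) {x : ℂ} (hx : x ≠ 0)
    (h : ∀ l : ℤ, x ≠ (q : ℂ) ^ l) : theta q x ≠ 0 := by
  have hq : (q : ℂ) ≠ 0 := by exact_mod_cast hq0.ne'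
  refine mul_ne_zero (qPoch_ne_zero_of_zpow hq0 hq1 h) (qPoch_ne_zero hq0 hq1 fun N hN => ?_)
  refine h (N + 1) ?_
  rw [zpow_add_one₀ hq, zpow_natCast]
  field_simp at hN
  rw [← hN, mul_comm]

/-- The quasi-periodicity of `θ`, with the power of `x` on the side that avoids inverses. -/
theorem theta_mul_pow {q : ℝ} (hq0 : 0 < q) (hq1 : q < 1) {x : ℂ} (hx : x ≠ 0) (N : ℕ) :
    theta q (x * (q : ℂ) ^ N) * ((-x) ^ N * (q : ℂ) ^ N.choose 2) = theta q x := by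
  have hq : (q : ℂ) ≠ 0 := by exact_mod_cast hq0.ne'
  induction N with
  | zero => simp
  | succ N ih =>
    have h1 : x * (q : ℂ) ^ (N + 1) = q * (x * (q : ℂ) ^ N) := by ring
    have h2 : (N + 1).choose 2 = N + N.choose 2 := by
      rw [Nat.choose_succ_succ' N 1, Nat.choose_one_right]
    rw [h1, theta_mul_q hq0 hq1 (by positivity), ← ih, h2]
    field_simp
    rw [pow_add]
    ring

theorem theta_mul_zpow_neg {q : ℝ} (hq0 : 0 < q) (hq1 : q < 1) {x : ℂ} (hx : x ≠ 0) (N : ℕ) :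
    theta q (x * (q : ℂ) ^ (-N : ℤ)) * (q : ℂ) ^ (N + 1).choose 2 = (-x) ^ N * theta q x := by
  have hq : (q : ℂ) ≠ 0 := by exact_mod_cast hq0.ne'
  have h := theta_mul_pow hq0 hq1 (x := x * (q : ℂ) ^ (-N : ℤ)) (by positivity) N
  have h1 : x * (q : ℂ) ^ (-N : ℤ) * (q : ℂ) ^ N = x := by
    rw [zpow_neg, zpow_natCast]; field_simp
  have h2 : (q : ℂ) ^ (N + 1).choose 2 * (q : ℂ) ^ N.choose 2 = ((q : ℂ) ^ N) ^ N := by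
    rw [← pow_add, ← pow_mul]
    congr 1
    rw [Nat.choose_succ_succ' N 1, Nat.choose_one_right]
    have := Nat.choose_two_right N
    have h3 := Nat.div_mul_cancel (Nat.even_mul_pred_self N).two_dvd
    cases N with
    | zero => simp
    | succ k => simp only [Nat.add_sub_cancel] at this h3; nlinarith
  rw [h1] at h
  rw [← h, zpow_neg, zpow_natCast, neg_mul_eq_neg_mul, mul_pow, inv_pow, ← h2]
  field_simp

/-! ### Products over pairs and an expansion of the Vandermonde determinant -/

theorem prod_Ioi_eq_ite {M : Type*} [CommMonoid M] {n : ℕ} (h : Fin n → Fin n → M) :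
    ∏ i, ∏ j ∈ Finset.Ioi i, h i j = ∏ i, ∏ j, if i < j then h i j else 1 := by
  refine Finset.prod_congr rfl fun i _ => ?_
  rw [← Finset.prod_filter]
  congr 1
  ext j
  simp

/-- Splitting off from a product over pairs the pairs that contain the index `r`. -/
theorem prod_Ioi_succAbove {M : Type*} [CommMonoid M] {m : ℕ} (h : Fin (m + 1) → Fin (m + 1) → M)
    (r : Fin (m + 1)) :
    ∏ i, ∏ j ∈ Finset.Ioi i, h i j =
      (∏ j : Fin m, if r.succAbove j < r then h (r.succAbove j) r else h r (r.succAbove j)) *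
        ∏ i : Fin m, ∏ j ∈ Finset.Ioi i, h (r.succAbove i) (r.succAbove j) := by
  rw [prod_Ioi_eq_ite, prod_Ioi_eq_ite, Fin.prod_univ_succAbove _ r]
  rw [Fin.prod_univ_succAbove _ r, if_neg (lt_irrefl _), one_mul]
  simp_rw [fun i : Fin m => Fin.prod_univ_succAbove
    (fun j => if r.succAbove i < j then h (r.succAbove i) j else 1) r]
  rw [Finset.prod_mul_distrib, ← mul_assoc, ← Finset.prod_mul_distrib]
  congr 1
  · refine Finset.prod_congr rfl fun j _ => ?_
    rcases lt_or_gt_of_ne (Fin.succAbove_ne r j) with hlt | hlt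
    · rw [if_neg hlt.not_gt, if_pos hlt, if_pos hlt, one_mul]
    · rw [if_pos hlt, if_neg hlt.not_gt, if_neg hlt.not_gt, mul_one]
  · simp only [(Fin.strictMono_succAbove r).lt_iff_lt]

theorem prod_Ioi_succAbove_symm {M : Type*} [CommMonoid M] {m : ℕ}
    (h : Fin (m + 1) → Fin (m + 1) → M) (hs : ∀ i j, h i j = h j i) (r : Fin (m + 1)) :
    ∏ i, ∏ j ∈ Finset.Ioi i, h i j = (∏ j : Fin m, h r (r.succAbove j)) *
        ∏ i : Fin m, ∏ j ∈ Finset.Ioi i, h (r.succAbove i) (r.succAbove j) := by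
  rw [prod_Ioi_succAbove h r]
  congr 1
  refine Finset.prod_congr rfl fun j _ => ?_
  rw [hs (r.succAbove j) r, ite_self]

theorem det_vandermonde_neg {n : ℕ} (z : Fin n → ℂ) :
    (Matrix.of fun i k : Fin n => (-z i) ^ (k : ℕ)).det = Delta z := by
  have := Matrix.det_vandermonde (fun i => -z i)
  rw [Matrix.vandermonde] at this
  rw [this]
  unfold Delta
  refine Finset.prod_congr rfl fun i _ => Finset.prod_congr rfl fun j _ => by ring

theorem Delta_cons {m : ℕ} (y : ℂ) (z : Fin m → ℂ) :
    Delta (Fin.cons y z : Fin (m + 1) → ℂ) = (∏ j, (y - z j)) * Delta z := by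
  unfold Delta
  rw [prod_Ioi_succAbove _ 0]
  simp

/-- Lagrange interpolation with the denominators cleared by the difference product: a polynomial
of degree less than `n` is recovered from its values at `z_1, …, z_n`. This is the Laplace
expansion of a Vandermonde-like determinant with linearly dependent columns, and it holds without
any distinctness of the nodes. -/
theorem sum_Delta_mul_eval {m : ℕ} (z : Fin (m + 1) → ℂ) (y : ℂ) (Q : Polynomial ℂ)
    (hQ : Q.natDegree < m + 1) :
    ∑ r : Fin (m + 1), (-1) ^ (r : ℕ) * Delta (fun j => z (r.succAbove j)) *
        (∏ j, (y - z (r.succAbove j))) * Q.eval (z r) = Delta z * Q.eval y := by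
  -- The rows are indexed by `y, z_0, …, z_m`; the last column is a combination of the others.
  set v : Fin (m + 2) → ℂ := Fin.cons y z with hv
  set M : Matrix (Fin (m + 2)) (Fin (m + 2)) ℂ := Matrix.of fun i k =>
    Fin.lastCases (motive := fun _ => ℂ) (Q.eval (v i)) (fun k : Fin (m + 1) => (-v i) ^ (k : ℕ)) k
    with hM
  have hdet : M.det = 0 := by
    refine Matrix.exists_mulVec_eq_zero_iff.1
      ⟨Fin.lastCases (motive := fun _ => ℂ) (-1)
        (fun k : Fin (m + 1) => Q.coeff k * (-1) ^ (k : ℕ)), ?_, ?_⟩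
    · intro h
      have := congrFun h (Fin.last _)
      simp at this
    · ext i
      rw [Matrix.mulVec, dotProduct, Fin.sum_univ_castSucc]
      simp only [hM, Matrix.of_apply, Fin.lastCases_castSucc, Fin.lastCases_last, Pi.zero_apply]
      rw [Polynomial.eval_eq_sum_range' hQ, Finset.sum_range, mul_neg_one, add_neg_eq_zero]
      refine Finset.sum_congr rfl fun k _ => ?_
      rw [neg_pow (v i)]
      have : ((-1 : ℂ) ^ (k : ℕ)) * (-1) ^ (k : ℕ) = 1 := by rw [← mul_pow]; simp
      linear_combination (Q.coeff k * v i ^ (k : ℕ)) * this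
  have hsub : ∀ i : Fin (m + 2), (M.submatrix i.succAbove (Fin.last (m + 1)).succAbove).det =
      Delta (fun j => v (i.succAbove j)) := by
    intro i
    rw [← det_vandermonde_neg]
    congr 1
    ext j k
    simp [hM, Matrix.submatrix]
  rw [Matrix.det_succ_column M (Fin.last _), Fin.sum_univ_succ] at hdet
  simp only [hsub] at hdet
  have hz : ∀ r : Fin (m + 1), (fun j => v (r.succ.succAbove j)) =
      (Fin.cons y (fun j => z (r.succAbove j)) : Fin (m + 1) → ℂ) := by
    intro r
    ext j
    refine Fin.cases ?_ (fun j => ?_) j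
    · simp [hv]
    · simp [hv]
  have h0 : (fun j => v ((0 : Fin (m + 2)).succAbove j)) = z := by
    ext j; simp [hv]
  simp only [hz, Delta_cons, h0] at hdet
  simp only [hM, Matrix.of_apply, Fin.lastCases_last, hv, Fin.cons_zero,
    Fin.cons_succ, Fin.val_zero, Fin.val_last, Fin.val_succ, zero_add] at hdet
  have hs : ((-1 : ℂ) ^ (m + 1)) * (-1) ^ (m + 1) = 1 := by rw [← mul_pow]; simp
  have h2 : (-1 : ℂ) ^ (m + 1) * (∑ r : Fin (m + 1), (-1) ^ ((r : ℕ) + 1 + (m + 1)) *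
      Q.eval (z r) * ((∏ j, (y - z (r.succAbove j))) * Delta (fun j => z (r.succAbove j)))) =
      - ∑ r : Fin (m + 1), (-1) ^ (r : ℕ) * Delta (fun j => z (r.succAbove j)) *
        (∏ j, (y - z (r.succAbove j))) * Q.eval (z r) := by
    rw [Finset.mul_sum, ← Finset.sum_neg_distrib]
    refine Finset.sum_congr rfl fun r _ => ?_
    rw [pow_add (-1 : ℂ) ((r : ℕ) + 1) (m + 1), pow_succ (-1 : ℂ) (r : ℕ)]
    linear_combination (-(-1) ^ (r : ℕ) * Q.eval (z r) * (∏ j, (y - z (r.succAbove j))) *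
      Delta (fun j => z (r.succAbove j))) * hs
  linear_combination (-(-1 : ℂ) ^ (m + 1)) * hdet + h2 + (Q.eval y * Delta z) * hs

/-! ### The second-order `t`-difference operator -/

open Polynomial in
/-- The `t`-difference operator applied to `∏ (z_j - w)` is divisible by `w ^ 2`, and the quotient
has degree less than the number of variables: the coefficients of the last term are chosen so as to
remove the two lowest powers of `w` and the highest one. -/
theorem exists_quotient {m : ℕ} {t : ℂ} (ht : t ≠ 0) (A₁ A₂ B₁ B₂ : ℂ) (z : Fin (m + 1) → ℂ) :
    ∃ Q : Polynomial ℂ, Q.natDegree < m + 1 ∧ ∀ w : ℂ, w ^ 2 * Q.eval w =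
      t ^ (m + 1) * (1 + A₁ * w + A₂ * w ^ 2) * ∏ j, (z j - w / t) +
      t ^ m * (1 + B₁ * w + B₂ * w ^ 2) * ∏ j, (z j - t * w) -
      (t ^ m * (1 + t) + (t ^ (m + 1) * A₁ + t ^ m * B₁) * w +
        (A₂ + t ^ (2 * m + 1) * B₂) * w ^ 2) * ∏ j, (z j - w) := by
  set f : Polynomial ℂ := ∏ j, (C (z j) - X) with hf
  have hfd : f.natDegree ≤ m + 1 := by
    refine (natDegree_prod_le _ _).trans ?_
    refine (Finset.sum_le_sum (g := fun _ => 1) fun j _ => ?_).trans (by simp)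
    rw [natDegree_sub]
    exact natDegree_X_sub_C_le _
  have hfe : ∀ w, f.eval w = ∏ j, (z j - w) := fun w => by simp [hf, eval_prod]
  set f₁ := f.comp (C t⁻¹ * X) with hf₁
  set f₂ := f.comp (C t * X) with hf₂
  have c1 : ∀ k, f₁.coeff k = f.coeff k * t⁻¹ ^ k := fun k => comp_C_mul_X_coeff
  have c2 : ∀ k, f₂.coeff k = f.coeff k * t ^ k := fun k => comp_C_mul_X_coeff
  set P : Polynomial ℂ :=
    C (t ^ (m + 1)) * (f₁ + C A₁ * (X * f₁) + C A₂ * (X ^ 2 * f₁)) +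
    C (t ^ m) * (f₂ + C B₁ * (X * f₂) + C B₂ * (X ^ 2 * f₂)) -
    (C (t ^ m * (1 + t)) * f + C (t ^ (m + 1) * A₁ + t ^ m * B₁) * (X * f) +
      C (A₂ + t ^ (2 * m + 1) * B₂) * (X ^ 2 * f)) with hP
  have hP0 : P.coeff 0 = 0 := by
    simp only [hP, coeff_add, coeff_sub, coeff_C_mul, c1, c2, coeff_X_mul_zero,
      coeff_X_pow_mul', mul_zero]
    norm_num
    ring
  have hP1 : P.coeff 1 = 0 := by
    have hX : ∀ g : Polynomial ℂ, (X * g).coeff 1 = g.coeff 0 := fun g => coeff_X_mul g 0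
    simp only [hP, coeff_add, coeff_sub, coeff_C_mul, c1, c2, hX, coeff_X_pow_mul']
    norm_num
    field_simp
    ring
  have hPk : ∀ k, m + 1 ≤ k → P.coeff (k + 2) = 0 := by
    intro k hk
    have e1 : P.coeff (k + 2) =
        t ^ (m + 1) * (f.coeff (k + 2) * t⁻¹ ^ (k + 2) + A₁ * (f.coeff (k + 1) * t⁻¹ ^ (k + 1)) +
          A₂ * (f.coeff k * t⁻¹ ^ k)) +
        t ^ m * (f.coeff (k + 2) * t ^ (k + 2) + B₁ * (f.coeff (k + 1) * t ^ (k + 1)) +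
          B₂ * (f.coeff k * t ^ k)) -
        (t ^ m * (1 + t) * f.coeff (k + 2) + (t ^ (m + 1) * A₁ + t ^ m * B₁) * f.coeff (k + 1) +
          (A₂ + t ^ (2 * m + 1) * B₂) * f.coeff k) := by
      simp only [hP, coeff_add, coeff_sub, coeff_C_mul, coeff_X_pow_mul, c1, c2, coeff_X_mul,
        show k + 2 = (k + 1) + 1 from rfl]
    have e2 : f.coeff (k + 2) = 0 := coeff_eq_zero_of_natDegree_lt (by omega)
    have e3 : f.coeff (k + 1) = 0 := coeff_eq_zero_of_natDegree_lt (by omega)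
    rw [e1, e2, e3]
    rcases hk.eq_or_lt with rfl | hlt
    · have h1 : t ^ (m + 1) * t⁻¹ ^ (m + 1) = 1 := by
        rw [← mul_pow, mul_inv_cancel₀ ht, one_pow]
      linear_combination (A₂ * f.coeff (m + 1)) * h1
    · rw [coeff_eq_zero_of_natDegree_lt (p := f) (n := k) (by omega)]
      ring
  refine ⟨P.divX.divX, ?_, fun w => ?_⟩
  · have : P.natDegree ≤ m + 2 := by
      refine natDegree_le_iff_coeff_eq_zero.2 fun N hN => ?_
      obtain ⟨k, rfl⟩ : ∃ k, N = k + 2 := ⟨N - 2, by omega⟩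
      exact hPk k (by omega)
    rw [natDegree_divX_eq_natDegree_tsub_one, natDegree_divX_eq_natDegree_tsub_one]
    omega
  · have h1 := congrArg (eval w) (divX_mul_X_add P)
    have h2 := congrArg (eval w) (divX_mul_X_add P.divX)
    simp only [eval_add, eval_mul, eval_X, eval_C, hP0, coeff_divX, zero_add, hP1] at h1 h2
    have h3 : P.eval w = w ^ 2 * P.divX.divX.eval w := by rw [← h1, ← h2]; ring
    rw [← h3]
    simp only [hP, hf₁, hf₂, eval_add, eval_sub, eval_mul, eval_X, eval_C, eval_comp, eval_pow, hfe]
    have : ∀ j, z j - t⁻¹ * w = z j - w / t := fun j => by rw [div_eq_inv_mul]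
    simp only [this]
    ring

/-- The values of the quotient of `exists_quotient` at the nodes. The factor `z_j - w` of the last
term vanishes there, and the first two terms lose the factors with `j = r`. -/
theorem quotient_eval_node {m : ℕ} {t : ℂ} (ht : t ≠ 0) (A₁ A₂ B₁ B₂ : ℂ) (z : Fin (m + 1) → ℂ)
    (Q : Polynomial ℂ) (hQ : ∀ w : ℂ, w ^ 2 * Q.eval w =
      t ^ (m + 1) * (1 + A₁ * w + A₂ * w ^ 2) * ∏ j, (z j - w / t) +
      t ^ m * (1 + B₁ * w + B₂ * w ^ 2) * ∏ j, (z j - t * w) -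
      (t ^ m * (1 + t) + (t ^ (m + 1) * A₁ + t ^ m * B₁) * w +
        (A₂ + t ^ (2 * m + 1) * B₂) * w ^ 2) * ∏ j, (z j - w))
    (r : Fin (m + 1)) (hr : z r ≠ 0) :
    Q.eval (z r) = (1 - t) * (-1) ^ (m + 1) * ((z r)⁻¹ *
      ((1 + A₁ * z r + A₂ * z r ^ 2) * ∏ j, (z r - t * z (r.succAbove j)) -
        t ^ m * (1 + B₁ * z r + B₂ * z r ^ 2) * ∏ j, (t * z r - z (r.succAbove j)))) := by
  have h := hQ (z r)
  have e1 : ∏ j, (z j - z r / t) = (1 - t⁻¹) * z r * (t⁻¹ ^ m * ((-1) ^ m *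
      ∏ j, (z r - t * z (r.succAbove j)))) := by
    rw [Fin.prod_univ_succAbove _ r]
    have : ∀ j, z (r.succAbove j) - z r / t = t⁻¹ * (-1) * (z r - t * z (r.succAbove j)) :=
      fun j => by field_simp; ring
    simp only [this, Finset.prod_mul_distrib, Finset.prod_const, Finset.card_univ,
      Fintype.card_fin]
    ring
  have e2 : ∏ j, (z j - t * z r) = (1 - t) * z r * ((-1) ^ m *
      ∏ j, (t * z r - z (r.succAbove j))) := by
    rw [Fin.prod_univ_succAbove _ r]
    have : ∀ j, z (r.succAbove j) - t * z r = (-1) * (t * z r - z (r.succAbove j)) :=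
      fun j => by ring
    simp only [this, Finset.prod_mul_distrib, Finset.prod_const, Finset.card_univ,
      Fintype.card_fin]
    ring
  have e3 : ∏ j, (z j - z r) = 0 := Finset.prod_eq_zero (Finset.mem_univ r) (sub_self _)
  rw [e1, e2, e3] at h
  have hr2 : z r ^ 2 ≠ 0 := pow_ne_zero 2 hr
  apply mul_left_cancel₀ hr2
  rw [h, inv_pow]
  field_simp
  ring

/-- The antisymmetrized form of the difference relations, one for each variable. -/
theorem sum_relations {m : ℕ} {t : ℂ} (ht : t ≠ 0) (A₁ A₂ B₁ B₂ y : ℂ) (z : Fin (m + 1) → ℂ)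
    (hz : ∀ r, z r ≠ 0) :
    y ^ 2 * ((1 - t) * (-1) ^ (m + 1) * ∑ r : Fin (m + 1), (-1) ^ (r : ℕ) *
      Delta (fun j => z (r.succAbove j)) * (∏ j, (y - z (r.succAbove j))) * ((z r)⁻¹ *
      ((1 + A₁ * z r + A₂ * z r ^ 2) * ∏ j, (z r - t * z (r.succAbove j)) -
        t ^ m * (1 + B₁ * z r + B₂ * z r ^ 2) * ∏ j, (t * z r - z (r.succAbove j))))) =
    Delta z * (t ^ (m + 1) * (1 + A₁ * y + A₂ * y ^ 2) * ∏ j, (z j - y / t) +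
      t ^ m * (1 + B₁ * y + B₂ * y ^ 2) * ∏ j, (z j - t * y) -
      (t ^ m * (1 + t) + (t ^ (m + 1) * A₁ + t ^ m * B₁) * y +
        (A₂ + t ^ (2 * m + 1) * B₂) * y ^ 2) * ∏ j, (z j - y)) := by
  obtain ⟨Q, hdeg, hQ⟩ := exists_quotient ht A₁ A₂ B₁ B₂ z
  rw [← hQ y, mul_left_comm (Delta z), ← sum_Delta_mul_eval z y Q hdeg, Finset.mul_sum]
  congr 1
  refine Finset.sum_congr rfl fun r _ => ?_
  rw [quotient_eval_node ht A₁ A₂ B₁ B₂ z Q hQ r (hz r)]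
  ring

/-! ### Polynomial solutions of the `t`-difference equation -/

open Polynomial in
/-- The Newton basis `∏_{j < k} (X - c t^j)`. -/
noncomputable def newton (c t : ℂ) (k : ℕ) : Polynomial ℂ :=
  ∏ j ∈ Finset.range k, (X - C (c * t ^ j))

open Polynomial in
theorem newton_succ (c t : ℂ) (k : ℕ) :
    newton c t (k + 1) = newton c t k * (X - C (c * t ^ k)) := Finset.prod_range_succ _ _

open Polynomial in
theorem newton_monic (c t : ℂ) (k : ℕ) : (newton c t k).Monic :=
  monic_prod_of_monic _ _ fun _ _ => monic_X_sub_C _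

open Polynomial in
theorem newton_natDegree (c t : ℂ) (k : ℕ) : (newton c t k).natDegree = k := by
  rw [newton, natDegree_prod_of_monic _ _ fun _ _ => monic_X_sub_C _]
  simp only [natDegree_X_sub_C, Finset.sum_const, Finset.card_range, smul_eq_mul, mul_one]

open Polynomial in
theorem exists_newton_expansion (c t : ℂ) (n : ℕ) (p : Polynomial ℂ) (hp : p.natDegree ≤ n) :
    ∃ d : ℕ → ℂ, d n = p.coeff n ∧ p = ∑ k ∈ Finset.range (n + 1), C (d k) * newton c t k := by
  induction n generalizing p with
  | zero =>
    refine ⟨fun _ => p.coeff 0, rfl, ?_⟩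
    simpa [newton] using eq_C_of_natDegree_le_zero hp
  | succ n ih =>
    obtain ⟨d, -, hd⟩ := ih (p - C (p.coeff (n + 1)) * newton c t (n + 1)) (by
      refine natDegree_le_iff_coeff_eq_zero.2 fun N hN => ?_
      rw [coeff_sub, coeff_C_mul]
      rcases (Nat.succ_le_of_lt hN).eq_or_lt with rfl | hlt
      · have := (newton_monic c t (n + 1)).coeff_natDegree
        rw [newton_natDegree] at this
        rw [this, mul_one, sub_self]
      · rw [coeff_eq_zero_of_natDegree_lt (p := p) (by omega),
          coeff_eq_zero_of_natDegree_lt (p := newton c t (n + 1)) (by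
            rw [newton_natDegree]; exact hlt)]
        simp)
    refine ⟨fun k => if k = n + 1 then p.coeff (n + 1) else d k, by simp, ?_⟩
    simp only [Finset.sum_range_succ _ (n + 1), if_true]
    rw [Finset.sum_congr rfl fun k hk => by
      rw [if_neg (by have := Finset.mem_range.1 hk; omega)], ← hd]
    ring

open Polynomial in
theorem newton_coeff_eq_zero (c t : ℂ) (n : ℕ) (d : ℕ → ℂ)
    (h : ∑ k ∈ Finset.range n, C (d k) * newton c t k = 0) : ∀ k < n, d k = 0 := by
  induction n with
  | zero => intro k hk; omega
  | succ n ih =>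
    have hn : d n = 0 := by
      have h1 := congrArg (fun p => coeff p n) h
      simp only [Finset.sum_range_succ, coeff_add, finsetSum_coeff, coeff_C_mul, coeff_zero] at h1
      have h2 := (newton_monic c t n).coeff_natDegree
      rw [newton_natDegree] at h2
      rw [h2, Finset.sum_eq_zero, zero_add, mul_one] at h1
      · exact h1
      · intro k hk
        rw [coeff_eq_zero_of_natDegree_lt (p := newton c t k) (by
            rw [newton_natDegree]; exact Finset.mem_range.1 hk), mul_zero]
    rw [Finset.sum_range_succ, hn, C_0, zero_mul, add_zero] at h
    intro k hk
    rcases (Nat.lt_succ_iff.1 hk).eq_or_lt with rfl | hlt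
    · exact hn
    · exact ih h k hlt

theorem newton_eval (c t y : ℂ) (k : ℕ) :
    (newton c t k).eval y = ∏ j ∈ Finset.range k, (y - c * t ^ j) := by
  simp [newton, Polynomial.eval_prod]

theorem newton_eval_mul (c t y : ℂ) (k : ℕ) :
    (newton c t (k + 1)).eval (t * y) = t ^ k * (t * y - c) * (newton c t k).eval y := by
  rw [newton_eval, newton_eval, Finset.prod_range_succ', pow_zero, mul_one]
  have : ∀ j, t * y - c * t ^ (j + 1) = t * (y - c * t ^ j) := fun j => by ring
  simp only [this, Finset.prod_mul_distrib, Finset.prod_const, Finset.card_range]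
  ring

theorem newton_eval_div (c : ℂ) {t : ℂ} (ht : t ≠ 0) (y : ℂ) (k : ℕ) :
    t ^ k * ((y - c) * (newton c t k).eval (y / t)) = (newton c t (k + 1)).eval y := by
  rw [newton_eval, newton_eval, Finset.prod_range_succ', pow_zero, mul_one]
  have : ∀ j, y - c * t ^ (j + 1) = t * (y / t - c * t ^ j) := fun j => by field_simp; ring
  simp only [this, Finset.prod_mul_distrib, Finset.prod_const, Finset.card_range]
  ring

/-- The operator of the `t`-difference equation satisfied by the mean of `∏ (z_j - y)`, with
`A(y) = (1 - y / a₁)(1 - y / a₂)` and `B(y) = (1 - b₁ y)(1 - b₂ y)` in expanded form. The number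
of variables is `m + 1`. -/
noncomputable def diffOp (m : ℕ) (t a₁ a₂ b₁ b₂ : ℂ) (f : ℂ → ℂ) (y : ℂ) : ℂ :=
  t ^ (m + 1) * (1 + -(a₁⁻¹ + a₂⁻¹) * y + a₁⁻¹ * a₂⁻¹ * y ^ 2) * f (y / t) +
      t ^ m * (1 + -(b₁ + b₂) * y + b₁ * b₂ * y ^ 2) * f (t * y) -
      (t ^ m * (1 + t) + (t ^ (m + 1) * (-(a₁⁻¹ + a₂⁻¹)) + t ^ m * (-(b₁ + b₂))) * y +
        (a₁⁻¹ * a₂⁻¹ + t ^ (2 * m + 1) * (b₁ * b₂)) * y ^ 2) * f y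

/-- On the Newton basis with nodes `a₁ t^j` the operator is two-term, because `A` vanishes at `a₁`.
Here `k + e` is one less than the number of variables. -/
theorem diffOp_newton_succ {t a₁ a₂ : ℂ} (b₁ b₂ : ℂ) (ht : t ≠ 0) (h₁ : a₁ ≠ 0) (h₂ : a₂ ≠ 0)
    (k e : ℕ) (y : ℂ) :
    diffOp (k + e) t a₁ a₂ b₁ b₂ (fun w => (newton a₁ t (k + 1)).eval w) y =
      -y ^ 2 * ((1 - t ^ e) * (a₁⁻¹ * a₂⁻¹ - b₁ * b₂ * t ^ (2 * k + e + 1)) *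
          (newton a₁ t (k + 1)).eval y +
        t ^ e * (1 - t ^ (k + 1)) * a₁⁻¹ * (1 - b₁ * (a₁ * t ^ k)) * (1 - b₂ * (a₁ * t ^ k)) *
          (newton a₁ t k).eval y) := by
  have e1 : (newton a₁ t (k + 1)).eval y = (newton a₁ t k).eval y * (y - a₁ * t ^ k) := by
    rw [newton_succ]; simp
  have e2 : (newton a₁ t (k + 2)).eval y =
      (newton a₁ t k).eval y * (y - a₁ * t ^ k) * (y - a₁ * t ^ (k + 1)) := by
    rw [newton_succ, newton_succ]; simp
  have h := newton_eval_div a₁ ht y (k + 1)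
  rw [e2] at h
  unfold diffOp
  beta_reduce
  rw [newton_eval_mul, e1]
  set F := (newton a₁ t k).eval y
  set G := (newton a₁ t (k + 1)).eval (y / t)
  have hA : t ^ (k + e + 1) * (1 + -(a₁⁻¹ + a₂⁻¹) * y + a₁⁻¹ * a₂⁻¹ * y ^ 2) * G =
      t ^ e * (a₁⁻¹ * a₂⁻¹) * (y - a₂) * (F * (y - a₁ * t ^ k) * (y - a₁ * t ^ (k + 1))) := by
    rw [← h]
    field_simp
    ring
  rw [hA]
  field_simp
  ring

theorem diffOp_newton_zero {t a₁ a₂ : ℂ} (b₁ b₂ : ℂ) (m : ℕ) (y : ℂ) :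
    diffOp m t a₁ a₂ b₁ b₂ (fun w => (newton a₁ t 0).eval w) y =
      -y ^ 2 * ((1 - t ^ (m + 1)) * (a₁⁻¹ * a₂⁻¹ - b₁ * b₂ * t ^ m)) := by
  simp only [diffOp, newton, Finset.range_zero, Finset.prod_empty, Polynomial.eval_one]
  ring

open Polynomial in
/-- A polynomial solution of degree at most `m + 1` of the difference equation: its value at `a₁`
in terms of its leading coefficient. -/
theorem eval_of_diffOp_eq_zero {t a₁ a₂ b₁ b₂ : ℂ} {m : ℕ} (ht : t ≠ 0) (h₁ : a₁ ≠ 0)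
    (h₂ : a₂ ≠ 0) (hroot : ∀ k ∈ Finset.Icc 1 (m + 1), t ^ k ≠ 1) (p : ℂ[X])
    (hdeg : p.natDegree ≤ m + 1) (hp : ∀ y, diffOp m t a₁ a₂ b₁ b₂ (fun w => p.eval w) y = 0) :
    (∏ k ∈ Finset.range (m + 1), (1 - a₁ * a₂ * b₁ * b₂ * t ^ (m + k))) * p.eval a₁ =
      (-a₂) ^ (m + 1) * t ^ (m + 1).choose 2 * (∏ k ∈ Finset.range (m + 1),
        (1 - a₁ * b₁ * t ^ k) * (1 - a₁ * b₂ * t ^ k)) * p.coeff (m + 1) := by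
  obtain ⟨d, hdn, hd⟩ := exists_newton_expansion a₁ t (m + 1) p hdeg
  have heval : p.eval a₁ = d 0 := by
    rw [hd, eval_finsetSum, Finset.sum_range_succ', Finset.sum_eq_zero]
    · simp [newton]
    · intro k _
      rw [eval_mul, newton_eval, Finset.prod_eq_zero (Finset.mem_range.2 k.succ_pos) (by simp),
        mul_zero]
  -- The operator sends the `k`-th basis element to `-y²` times `α k` times itself plus `β (k - 1)`
  -- times its predecessor.
  set α : ℕ → ℂ := fun k => (1 - t ^ (m + 1 - k)) * (a₁⁻¹ * a₂⁻¹ - b₁ * b₂ * t ^ (m + k)) with hα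
  set β : ℕ → ℂ := fun k => t ^ (m - k) * (1 - t ^ (k + 1)) * a₁⁻¹ * (1 - b₁ * (a₁ * t ^ k)) *
    (1 - b₂ * (a₁ * t ^ k)) with hβ
  have hlin : ∀ y, diffOp m t a₁ a₂ b₁ b₂ (fun w => p.eval w) y =
      ∑ k ∈ Finset.range (m + 2), d k *
        diffOp m t a₁ a₂ b₁ b₂ (fun w => (newton a₁ t k).eval w) y := by
    intro y
    have : ∀ w, p.eval w = ∑ k ∈ Finset.range (m + 2), d k * (newton a₁ t k).eval w := by
      intro w; conv_lhs => rw [hd]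
      simp [eval_finsetSum]
    simp only [diffOp, this, Finset.mul_sum, ← Finset.sum_add_distrib, ← Finset.sum_sub_distrib]
    refine Finset.sum_congr rfl fun k _ => by ring
  have hsucc : ∀ k ∈ Finset.range (m + 1), ∀ y,
      diffOp m t a₁ a₂ b₁ b₂ (fun w => (newton a₁ t (k + 1)).eval w) y =
        -y ^ 2 * (α (k + 1) * (newton a₁ t (k + 1)).eval y + β k * (newton a₁ t k).eval y) := by
    intro k hk y
    obtain ⟨e, rfl⟩ : ∃ e, m = k + e := ⟨m - k, by have := Finset.mem_range.1 hk; omega⟩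
    rw [diffOp_newton_succ b₁ b₂ ht h₁ h₂]
    simp only [hα, hβ]
    rw [show k + e + 1 - (k + 1) = e by omega, show k + e - k = e by omega,
      show k + e + (k + 1) = 2 * k + e + 1 by ring]
  have hpoly : ∑ k ∈ Finset.range (m + 1), C (d k * α k + d (k + 1) * β k) * newton a₁ t k = 0 := by
    have hX : X ^ 2 * ∑ k ∈ Finset.range (m + 1),
        C (d k * α k + d (k + 1) * β k) * newton a₁ t k = 0 := by
      refine Polynomial.funext fun y => ?_
      have h := hp y
      rw [hlin, Finset.sum_range_succ', Finset.sum_congr rfl fun k hk => by rw [hsucc k hk y],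
        diffOp_newton_zero] at h
      have hα0 : α 0 = (1 - t ^ (m + 1)) * (a₁⁻¹ * a₂⁻¹ - b₁ * b₂ * t ^ m) := by simp [hα]
      have hαn : α (m + 1) = 0 := by simp [hα]
      have hs : ∑ k ∈ Finset.range (m + 1), d (k + 1) * (α (k + 1) * (newton a₁ t (k + 1)).eval y)
          + d 0 * α 0 = ∑ k ∈ Finset.range (m + 1), d k * (α k * (newton a₁ t k).eval y) := by
        have h0 : d 0 * α 0 = d 0 * (α 0 * (newton a₁ t 0).eval y) := by simp [newton]
        rw [h0, ← Finset.sum_range_succ' (fun k => d k * (α k * (newton a₁ t k).eval y)),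
          Finset.sum_range_succ, hαn]
        ring
      rw [← hα0] at h
      simp only [eval_mul, eval_pow, eval_X, eval_finsetSum, eval_C, eval_zero]
      have h3 : ∑ k ∈ Finset.range (m + 1), (d k * α k + d (k + 1) * β k) * (newton a₁ t k).eval y =
          ∑ k ∈ Finset.range (m + 1), d k * (α k * (newton a₁ t k).eval y) +
          ∑ k ∈ Finset.range (m + 1), d (k + 1) * (β k * (newton a₁ t k).eval y) := by
        rw [← Finset.sum_add_distrib]
        exact Finset.sum_congr rfl fun k _ => by ring
      have h4 : ∑ k ∈ Finset.range (m + 1), d (k + 1) * (-y ^ 2 *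
          (α (k + 1) * (newton a₁ t (k + 1)).eval y + β k * (newton a₁ t k).eval y)) =
          -y ^ 2 * (∑ k ∈ Finset.range (m + 1),
              d (k + 1) * (α (k + 1) * (newton a₁ t (k + 1)).eval y) +
            ∑ k ∈ Finset.range (m + 1), d (k + 1) * (β k * (newton a₁ t k).eval y)) := by
        rw [← Finset.sum_add_distrib, Finset.mul_sum]
        exact Finset.sum_congr rfl fun k _ => by ring
      rw [h4] at h
      rw [h3, ← hs]
      linear_combination -h
    exact (mul_eq_zero.1 hX).resolve_left (pow_ne_zero 2 X_ne_zero)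
  have hrec := newton_coeff_eq_zero a₁ t (m + 1) _ hpoly
  have hstep : ∀ k < m + 1, (1 - t ^ (m + 1 - k)) * (1 - a₁ * a₂ * b₁ * b₂ * t ^ (m + k)) * d k =
      (-a₂) * t ^ (m - k) * (1 - t ^ (k + 1)) * ((1 - a₁ * b₁ * t ^ k) * (1 - a₁ * b₂ * t ^ k)) *
        d (k + 1) := by
    intro k hk
    have h := hrec k hk
    simp only [hα, hβ] at h
    field_simp at h
    linear_combination h
  have hprod : ∀ N ≤ m + 1, (∏ k ∈ Finset.range N,
      (1 - t ^ (m + 1 - k)) * (1 - a₁ * a₂ * b₁ * b₂ * t ^ (m + k))) * d 0 =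
      (∏ k ∈ Finset.range N, (-a₂) * t ^ (m - k) * (1 - t ^ (k + 1)) *
        ((1 - a₁ * b₁ * t ^ k) * (1 - a₁ * b₂ * t ^ k))) * d N := by
    intro N hN
    induction N with
    | zero => simp
    | succ N ih =>
      rw [Finset.prod_range_succ, Finset.prod_range_succ, mul_right_comm, ih (by omega)]
      linear_combination (∏ k ∈ Finset.range N, (-a₂) * t ^ (m - k) * (1 - t ^ (k + 1)) *
        ((1 - a₁ * b₁ * t ^ k) * (1 - a₁ * b₂ * t ^ k))) * hstep N (by omega)
  have h := hprod (m + 1) le_rfl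
  -- The factors `1 - t^k` are the same on both sides, in reverse order.
  have hne : ∏ k ∈ Finset.range (m + 1), (1 - t ^ (k + 1)) ≠ 0 :=
    Finset.prod_ne_zero_iff.2 fun k hk => sub_ne_zero.2 (hroot (k + 1) (by
      have := Finset.mem_range.1 hk; simp; omega)).symm
  have hrefl : ∏ k ∈ Finset.range (m + 1), (1 - t ^ (m + 1 - k)) =
      ∏ k ∈ Finset.range (m + 1), (1 - t ^ (k + 1)) := by
    rw [← Finset.prod_range_reflect (fun k => 1 - t ^ (k + 1))]
    refine Finset.prod_congr rfl fun k hk => ?_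
    have := Finset.mem_range.1 hk
    rw [show m + 1 - 1 - k + 1 = m + 1 - k by omega]
  have hpow : ∏ k ∈ Finset.range (m + 1), t ^ (m - k) = t ^ (m + 1).choose 2 := by
    rw [← Finset.prod_range_reflect, Finset.prod_pow_eq_pow_sum, Nat.choose_two_right,
      ← Finset.sum_range_id]
    congr 1
    refine Finset.sum_congr rfl fun k hk => ?_
    have := Finset.mem_range.1 hk
    omega
  simp only [Finset.prod_mul_distrib, Finset.prod_const, Finset.card_range, hrefl, hpow] at h
  rw [heval, ← hdn]
  apply mul_left_cancel₀ hne
  rw [Finset.prod_mul_distrib]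
  linear_combination h

/-! ### The pair weight -/

/-- The interaction `(q t⁻¹ u)_∞ / (t u)_∞` of two variables with ratio `u`. -/
noncomputable def pairRatio (q : ℝ) (t u : ℂ) : ℂ := qPoch q (q * t⁻¹ * u) / qPoch q (t * u)

/-- The weight of a pair of variables `x q^a`, `y q^b`, freed of complex powers: the factor
`(x q^a)^{2τ - 1}` is replaced by `x⁻¹ (t² / q)^a`. -/
noncomputable def pairWt (q : ℝ) (t x y : ℂ) (a b : ℕ) : ℂ :=
  x⁻¹ * (t ^ 2 / q) ^ a * pairRatio q t (y * (q : ℂ) ^ b / (x * (q : ℂ) ^ a))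

/-- The ratio `θ(t / u) / θ(t u)` of `pairRatio` at `u` and at `u⁻¹`. -/
noncomputable def thetaRatio (q : ℝ) (t u : ℂ) : ℂ := theta q (t / u) / theta q (t * u)

variable {q : ℝ} {t : ℂ}

theorem thetaRatio_mul_q (hq0 : 0 < q) (hq1 : q < 1) (ht : t ≠ 0) {u : ℂ} (hu : u ≠ 0) :
    thetaRatio q t (u * q) = t ^ 2 / q * thetaRatio q t u := by
  have hq : (q : ℂ) ≠ 0 := by exact_mod_cast hq0.ne'
  have h1 := theta_mul_q hq0 hq1 (x := t / (u * q)) (by positivity)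
  rw [show (q : ℂ) * (t / (u * q)) = t / u by field_simp] at h1
  have h2 := theta_mul_q hq0 hq1 (x := t * u) (by positivity)
  rw [show (q : ℂ) * (t * u) = t * (u * q) by ring] at h2
  have h3 : theta q (t / (u * q)) = -(t / (u * q)) * theta q (t / u) := by
    rw [h1]; field_simp
  unfold thetaRatio
  rw [h2, h3]
  field_simp

theorem thetaRatio_mul_pow (hq0 : 0 < q) (hq1 : q < 1) (ht : t ≠ 0) {u : ℂ} (hu : u ≠ 0) (N : ℕ) :
    thetaRatio q t (u * (q : ℂ) ^ N) = (t ^ 2 / q) ^ N * thetaRatio q t u := by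
  have hq : (q : ℂ) ≠ 0 := by exact_mod_cast hq0.ne'
  induction N with
  | zero => simp
  | succ N ih =>
    rw [pow_succ, ← mul_assoc, thetaRatio_mul_q hq0 hq1 ht (by positivity), ih]
    ring

theorem pairRatio_eq_thetaRatio (hq0 : 0 < q) (ht : t ≠ 0) {u : ℂ} (hu : u ≠ 0)
    (h1 : qPoch q (t / u) ≠ 0) (h2 : qPoch q (q / (t * u)) ≠ 0) :
    pairRatio q t u = thetaRatio q t u * pairRatio q t u⁻¹ := by
  have hq : (q : ℂ) ≠ 0 := by exact_mod_cast hq0.ne'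
  unfold pairRatio thetaRatio theta
  rw [show (q : ℂ) * t⁻¹ * u⁻¹ = q / (t * u) by field_simp, show t * u⁻¹ = t / u by field_simp,
    show (q : ℂ) / (t / u) = q * t⁻¹ * u by field_simp]
  by_cases h3 : qPoch q (t * u) = 0
  · simp [h3]
  · field_simp

/-- Exchanging the two members of a pair multiplies its weight by a factor that does not depend on
`a` and `b`: the power of `t² / q` compensates the quasi-periodicity of `thetaRatio`. -/
theorem pairWt_swap (hq0 : 0 < q) (hq1 : q < 1) (ht : t ≠ 0) {x y : ℂ} (hx : x ≠ 0) (hy : y ≠ 0)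
    (h1 : ∀ l : ℤ, t * (y / x) ≠ (q : ℂ) ^ l) (h2 : ∀ l : ℤ, t * (x / y) ≠ (q : ℂ) ^ l) (a b : ℕ) :
    pairWt q t x y a b = y / x * thetaRatio q t (y / x) * pairWt q t y x b a := by
  have hq : (q : ℂ) ≠ 0 := by exact_mod_cast hq0.ne'
  set u := y * (q : ℂ) ^ b / (x * (q : ℂ) ^ a) with hu
  have hu0 : u ≠ 0 := by positivity
  have e1 : (t ^ 2 / q) ^ a * thetaRatio q t u = (t ^ 2 / q) ^ b * thetaRatio q t (y / x) := by
    rw [← thetaRatio_mul_pow hq0 hq1 ht hu0, ← thetaRatio_mul_pow hq0 hq1 ht (by positivity), hu]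
    congr 1
    field_simp
  have e2 := pairRatio_eq_thetaRatio (q := q) hq0 ht hu0
    (qPoch_ne_zero_of_zpow hq0 hq1 fun l h => h2 (l + b - a) (by
      rw [zpow_sub₀ hq, zpow_add₀ hq, ← h, hu, zpow_natCast, zpow_natCast]; field_simp))
    (qPoch_ne_zero_of_zpow hq0 hq1 fun l h => h1 (1 - l + a - b) (by
      rw [zpow_sub₀ hq, zpow_add₀ hq, zpow_sub₀ hq, ← h, hu, zpow_natCast, zpow_natCast, zpow_one]
      field_simp))
  have e3 : u⁻¹ = x * (q : ℂ) ^ a / (y * (q : ℂ) ^ b) := by rw [hu, inv_div]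
  unfold pairWt
  rw [← hu, e2, ← e3]
  have : x⁻¹ * (t ^ 2 / q) ^ a * (thetaRatio q t u * pairRatio q t u⁻¹) =
    x⁻¹ * pairRatio q t u⁻¹ * ((t ^ 2 / q) ^ a * thetaRatio q t u) := by ring
  rw [this, e1]
  field_simp

theorem pairWt_succ_right (hq0 : 0 < q) (hq1 : q < 1) (ht : t ≠ 0) {x y : ℂ} (hx : x ≠ 0)
    {a b : ℕ} (h : qPoch q (t * (y * (q : ℂ) ^ b / (x * (q : ℂ) ^ a))) ≠ 0) :
    pairWt q t x y a (b + 1) * (q * (y * (q : ℂ) ^ b) - t * (x * (q : ℂ) ^ a)) =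
      pairWt q t x y a b * (t * (t * (y * (q : ℂ) ^ b) - x * (q : ℂ) ^ a)) := by
  have hq : (q : ℂ) ≠ 0 := by exact_mod_cast hq0.ne'
  set z := x * (q : ℂ) ^ a with hz
  set w := y * (q : ℂ) ^ b with hw
  have hz0 : z ≠ 0 := by positivity
  have e : y * (q : ℂ) ^ (b + 1) / z = q * (w / z) := by rw [hw]; ring
  unfold pairWt pairRatio
  rw [← hz, e]
  have h1 := qPoch_step hq0 hq1 (q * t⁻¹ * (w / z))
  have h2 := qPoch_step hq0 hq1 (t * (w / z))
  rw [show (q : ℂ) * (q * t⁻¹ * (w / z)) = q * t⁻¹ * (q * (w / z)) by ring] at h1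
  rw [show (q : ℂ) * (t * (w / z)) = t * (q * (w / z)) by ring] at h2
  rw [h2] at h
  rw [h1, h2]
  obtain ⟨h3, h4⟩ := mul_ne_zero_iff.1 h
  have h5 : z - t * w ≠ 0 := by
    intro h0; apply h3; field_simp; linear_combination h0
  field_simp
  ring

theorem pairWt_succ_left (hq0 : 0 < q) (hq1 : q < 1) (ht : t ≠ 0) {x y : ℂ} (hx : x ≠ 0)
    {a b : ℕ} (h : qPoch q (t * (y * (q : ℂ) ^ b / (x * (q : ℂ) ^ (a + 1)))) ≠ 0) :
    pairWt q t x y (a + 1) b * (q * (x * (q : ℂ) ^ a) - t * (y * (q : ℂ) ^ b)) =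
      pairWt q t x y a b * (t * (t * (x * (q : ℂ) ^ a) - y * (q : ℂ) ^ b)) := by
  have hq : (q : ℂ) ≠ 0 := by exact_mod_cast hq0.ne'
  have e : x * (q : ℂ) ^ (a + 1) = q * (x * (q : ℂ) ^ a) := by ring
  rw [e] at h
  unfold pairWt pairRatio
  rw [e]
  set z := x * (q : ℂ) ^ a with hz
  set w := y * (q : ℂ) ^ b with hw
  have hz0 : z ≠ 0 := by positivity
  have h1 := qPoch_step hq0 hq1 (q * t⁻¹ * (w / (q * z)))
  have h2 := qPoch_step hq0 hq1 (t * (w / (q * z)))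
  rw [show (q : ℂ) * (q * t⁻¹ * (w / (q * z))) = q * t⁻¹ * (w / z) by field_simp] at h1
  rw [show (q : ℂ) * (t * (w / (q * z))) = t * (w / z) by field_simp] at h2
  rw [h2] at h
  rw [h1, h2, pow_succ]
  obtain ⟨h3, h4⟩ := mul_ne_zero_iff.1 h
  have h5 : q * z - t * w ≠ 0 := by
    intro h0; apply h3; field_simp; linear_combination h0
  generalize qPoch q (q * t⁻¹ * (w / z)) = U
  generalize qPoch q (t * (w / z)) = V at h4 ⊢
  generalize (t ^ 2 / (q : ℂ)) ^ a = c
  field_simp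

theorem tendsto_pairWt_right (hq0 : 0 < q) (hq1 : q < 1) (x y : ℂ) (a : ℕ) :
    Tendsto (fun b => pairWt q t x y a b) atTop (𝓝 (x⁻¹ * (t ^ 2 / q) ^ a)) := by
  have h0 : Tendsto (fun b => y * (q : ℂ) ^ b / (x * (q : ℂ) ^ a)) atTop (𝓝 0) := by
    simpa using ((tendsto_ofReal_pow hq0 hq1).const_mul y).div_const (x * (q : ℂ) ^ a)
  have h1 : Tendsto (fun b => pairRatio q t (y * (q : ℂ) ^ b / (x * (q : ℂ) ^ a))) atTop (𝓝 1) := by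
    have ha := tendsto_qPoch_one hq0 hq1 (f := fun b => q * t⁻¹ * (y * (q : ℂ) ^ b / (x * q ^ a)))
      (by simpa using h0.const_mul (q * t⁻¹))
    have hb := tendsto_qPoch_one hq0 hq1 (f := fun b => t * (y * (q : ℂ) ^ b / (x * q ^ a)))
      (by simpa using h0.const_mul t)
    have := ha.div hb one_ne_zero
    rw [div_one] at this
    exact this
  simpa [pairWt] using h1.const_mul (x⁻¹ * (t ^ 2 / q) ^ a)

/-! ### The one-variable weight -/

/-- The one-variable factor of `Φ(z) / z`. -/
noncomputable def siteWt (q : ℝ) (a₁ a₂ b₁ b₂ z : ℂ) : ℂ :=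
  qPoch q (q * a₁⁻¹ * z) / qPoch q (b₁ * z) * (qPoch q (q * a₂⁻¹ * z) / qPoch q (b₂ * z))

theorem siteWt_mul_q (hq0 : 0 < q) (hq1 : q < 1) {a₁ a₂ b₁ b₂ z : ℂ} (h1 : qPoch q (b₁ * z) ≠ 0)
    (h2 : qPoch q (b₂ * z) ≠ 0) :
    siteWt q a₁ a₂ b₁ b₂ (q * z) * ((1 - a₁⁻¹ * (q * z)) * (1 - a₂⁻¹ * (q * z))) =
      siteWt q a₁ a₂ b₁ b₂ z * ((1 - b₁ * z) * (1 - b₂ * z)) := by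
  have e1 := qPoch_step hq0 hq1 (b₁ * z)
  have e2 := qPoch_step hq0 hq1 (b₂ * z)
  have e3 := qPoch_step hq0 hq1 (q * a₁⁻¹ * z)
  have e4 := qPoch_step hq0 hq1 (q * a₂⁻¹ * z)
  rw [show (q : ℂ) * (b₁ * z) = b₁ * (q * z) by ring] at e1
  rw [show (q : ℂ) * (b₂ * z) = b₂ * (q * z) by ring] at e2
  rw [show (q : ℂ) * (q * a₁⁻¹ * z) = q * a₁⁻¹ * (q * z) by ring] at e3
  rw [show (q : ℂ) * (q * a₂⁻¹ * z) = q * a₂⁻¹ * (q * z) by ring] at e4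
  rw [e1] at h1
  rw [e2] at h2
  unfold siteWt
  rw [e1, e2, e3, e4]
  obtain ⟨h3, h4⟩ := mul_ne_zero_iff.1 h1
  obtain ⟨h5, h6⟩ := mul_ne_zero_iff.1 h2
  generalize qPoch q (b₁ * (q * z)) = B1 at *
  generalize qPoch q (b₂ * (q * z)) = B2 at *
  generalize qPoch q (q * a₁⁻¹ * (q * z)) = U
  generalize qPoch q (q * a₂⁻¹ * (q * z)) = V
  generalize 1 - b₁ * z = β₁ at h3 ⊢
  generalize 1 - b₂ * z = β₂ at h5 ⊢
  field_simp

theorem tendsto_siteWt (hq0 : 0 < q) (hq1 : q < 1) (a₁ a₂ b₁ b₂ x : ℂ) :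
    Tendsto (fun M : ℕ => siteWt q a₁ a₂ b₁ b₂ (x * (q : ℂ) ^ M)) atTop (𝓝 1) := by
  have h0 : Tendsto (fun M : ℕ => x * (q : ℂ) ^ M) atTop (𝓝 0) := by
    simpa using (tendsto_ofReal_pow hq0 hq1).const_mul x
  have h : ∀ c : ℂ, Tendsto (fun M : ℕ => qPoch q (c * (x * (q : ℂ) ^ M))) atTop (𝓝 1) := fun c =>
    tendsto_qPoch_one hq0 hq1 (by simpa using h0.const_mul c)
  simpa [siteWt] using ((h _).div (h b₁) one_ne_zero).mul ((h _).div (h b₂) one_ne_zero)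

/-! ### The lattices, their fans and the normalized weights -/

/-- The conditions under which the evaluation holds, in a form that is stable under
`a₁ ↦ q a₁`. They involve `t` but not `τ`. The last one comprises the inequalities
`|q t^(2i-2)| < 1` for `1 ≤ i ≤ n`. -/
structure Admissible (n : ℕ) (q : ℝ) (t a₁ a₂ b₁ b₂ : ℂ) : Prop where
  q_pos : 0 < q
  q_lt_one : q < 1
  t_ne : t ≠ 0
  a₁_ne : a₁ ≠ 0
  a₂_ne : a₂ ≠ 0
  t_pole : ∀ k ∈ Finset.Icc 1 n, ∀ N : ℕ, t ^ k * (q : ℂ) ^ N ≠ 1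
  a₁b₁_pole : ∀ k < n, ∀ N : ℕ, a₁ * b₁ * t ^ k * (q : ℂ) ^ N ≠ 1
  a₁b₂_pole : ∀ k < n, ∀ N : ℕ, a₁ * b₂ * t ^ k * (q : ℂ) ^ N ≠ 1
  a₂b₁_pole : ∀ k < n, ∀ N : ℕ, a₂ * b₁ * t ^ k * (q : ℂ) ^ N ≠ 1
  a₂b₂_pole : ∀ k < n, ∀ N : ℕ, a₂ * b₂ * t ^ k * (q : ℂ) ^ N ≠ 1
  ratio_pole : ∀ m : ℤ, |m| < (n : ℤ) → ∀ l : ℤ, a₁ * a₂⁻¹ * t ^ m ≠ (q : ℂ) ^ l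
  conv : q * max 1 (‖t‖ ^ 2) ^ (n - 1) < 1

variable {n : ℕ} {a₁ a₂ b₁ b₂ : ℂ}

theorem Admissible.q_ne (h : Admissible n q t a₁ a₂ b₁ b₂) : (q : ℂ) ≠ 0 := by
  exact_mod_cast h.q_pos.ne'

theorem Admissible.ratio_pole' (h : Admissible n q t a₁ a₂ b₁ b₂) (m : ℤ) (hm : |m| < (n : ℤ))
    (l : ℤ) : a₂ * a₁⁻¹ * t ^ m ≠ (q : ℂ) ^ l := by
  intro h1
  refine h.ratio_pole (-m) (by rwa [abs_neg]) (-l) ?_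
  rw [zpow_neg, zpow_neg, ← h1]
  have := h.a₁_ne
  have := h.a₂_ne
  have := h.t_ne
  field_simp

theorem Admissible.shift (h : Admissible n q t a₁ a₂ b₁ b₂) (N : ℕ) :
    Admissible n q t (a₁ * (q : ℂ) ^ N) a₂ b₁ b₂ where
  q_pos := h.q_pos
  q_lt_one := h.q_lt_one
  t_ne := h.t_ne
  a₁_ne := mul_ne_zero h.a₁_ne (pow_ne_zero _ h.q_ne)
  a₂_ne := h.a₂_ne
  t_pole := h.t_pole
  a₁b₁_pole k hk M h1 := h.a₁b₁_pole k hk (N + M) (by rw [← h1]; ring)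
  a₁b₂_pole k hk M h1 := h.a₁b₂_pole k hk (N + M) (by rw [← h1]; ring)
  a₂b₁_pole := h.a₂b₁_pole
  a₂b₂_pole := h.a₂b₂_pole
  ratio_pole m hm l h1 := h.ratio_pole m hm (l - N) (by
    have := h.q_ne
    rw [zpow_sub₀ h.q_ne, ← h1, zpow_natCast]
    field_simp)
  conv := h.conv

/-- The membership of `ν` in the fan: `ν` is weakly increasing on each of the two blocks. -/
def InFan {n : ℕ} (i : ℕ) (ν : Fin n → ℕ) : Prop :=
  ∀ k l : Fin n, k < l → ((k : ℕ) < i ↔ (l : ℕ) < i) → ν k ≤ ν l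

/-- The normalization of the `i`-th lattice sum: the product of inverse theta functions. -/
noncomputable def thetaCoef (q : ℝ) (t a₁ a₂ : ℂ) (n i : ℕ) : ℂ :=
  (∏ j ∈ Finset.range i, (theta q (a₂ * a₁⁻¹ * t ^ (-(j : ℤ))))⁻¹) *
    ∏ k ∈ Finset.range (n - i), (theta q (a₁ * a₂⁻¹ * t ^ ((i : ℤ) - k)))⁻¹

/-- The lattice point with coordinates `x_k q^{ν_k}`. -/
def latPt (q : ℝ) {n : ℕ} (x : Fin n → ℂ) (ν : Fin n → ℕ) : Fin n → ℂ :=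
  fun k => x k * (q : ℂ) ^ ν k

/-- The weight of a lattice point relative to an arbitrary base point `x`, without the theta
factors and without the difference product. -/
noncomputable def rawWt (q : ℝ) (t a₁ a₂ b₁ b₂ : ℂ) {n : ℕ} (x : Fin n → ℂ) (ν : Fin n → ℕ) : ℂ :=
  (∏ k, (q : ℂ) ^ ν k * siteWt q a₁ a₂ b₁ b₂ (x k * (q : ℂ) ^ ν k)) *
    ∏ k, ∏ l ∈ Finset.Ioi k, pairWt q t (x k) (x l) (ν k) (ν l)

open Classical in
/-- The normalized weight of the point `ν` of the `i`-th lattice: the product of `Φ` and the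
coefficient of the `i`-th truncated integral, extended by zero off the fan. -/
noncomputable def wt (q : ℝ) (t a₁ a₂ b₁ b₂ : ℂ) {n : ℕ} (i : ℕ) (ν : Fin n → ℕ) : ℂ :=
  if InFan i ν then thetaCoef q t a₁ a₂ n i * rawWt q t a₁ a₂ b₁ b₂ (zeta t a₁ a₂ n i) ν else 0

theorem zeta_of_lt {i : ℕ} {k : Fin n} (h : (k : ℕ) < i) :
    zeta t a₁ a₂ n i k = a₁ * t ^ (k : ℕ) := if_pos h

theorem zeta_of_ge {i : ℕ} {k : Fin n} (h : i ≤ (k : ℕ)) :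
    zeta t a₁ a₂ n i k = a₂ * t ^ ((k : ℕ) - i) := if_neg (by omega)

theorem zeta_ne_zero (ht : t ≠ 0) (h₁ : a₁ ≠ 0) (h₂ : a₂ ≠ 0) (i : ℕ) (k : Fin n) :
    zeta t a₁ a₂ n i k ≠ 0 := by
  unfold zeta
  split_ifs <;> positivity

theorem zeta_same_block (i : ℕ) {k l : Fin n} (hkl : k ≤ l)
    (hb : (k : ℕ) < i ↔ (l : ℕ) < i) :
    zeta t a₁ a₂ n i l = zeta t a₁ a₂ n i k * t ^ ((l : ℕ) - k) := by
  have hkl' : (k : ℕ) ≤ l := hkl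
  by_cases h : (l : ℕ) < i
  · rw [zeta_of_lt h, zeta_of_lt (hb.2 h), mul_assoc, ← pow_add]
    congr 2; omega
  · rw [zeta_of_ge (by omega), zeta_of_ge (by have := mt hb.1 h; omega), mul_assoc, ← pow_add]
    have := mt hb.1 h
    congr 2; omega

theorem zeta_cross (ht : t ≠ 0) (h₁ : a₁ ≠ 0) {i : ℕ} {k l : Fin n} (hk : (k : ℕ) < i)
    (hl : i ≤ (l : ℕ)) : zeta t a₁ a₂ n i l / zeta t a₁ a₂ n i k =
      a₂ * a₁⁻¹ * t ^ ((l : ℤ) - i - k) := by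
  rw [zeta_of_lt hk, zeta_of_ge hl, zpow_sub₀ ht, ← Nat.cast_sub hl, zpow_natCast, zpow_natCast]
  field_simp

theorem zeta_cross_ne (h : Admissible n q t a₁ a₂ b₁ b₂) {i : ℕ} {k l : Fin n} (hk : (k : ℕ) < i)
    (hl : i ≤ (l : ℕ)) (s : ℤ) :
    t * (zeta t a₁ a₂ n i l / zeta t a₁ a₂ n i k) ≠ (q : ℂ) ^ s ∧
      t * (zeta t a₁ a₂ n i k / zeta t a₁ a₂ n i l) ≠ (q : ℂ) ^ s := by
  have ht := h.t_ne
  have h1 := h.a₁_ne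
  have h2 := h.a₂_ne
  have hln := l.2
  constructor
  · rw [zeta_cross ht h1 hk hl]
    intro h0
    refine h.ratio_pole' (1 + ((l : ℤ) - i - k)) (by rw [abs_lt]; omega) s ?_
    rw [← h0, zpow_add₀ ht, zpow_one]; ring
  · rw [← inv_div, zeta_cross ht h1 hk hl]
    intro h0
    refine h.ratio_pole (1 - ((l : ℤ) - i - k)) (by rw [abs_lt]; omega) s ?_
    rw [← h0, zpow_sub₀ ht, zpow_one]; field_simp

theorem qPoch_pair_ne_zero (h : Admissible n q t a₁ a₂ b₁ b₂) {i : ℕ} {ν : Fin n → ℕ}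
    (hν : InFan i ν) {k l : Fin n} (hkl : k < l) :
    qPoch q (t * (zeta t a₁ a₂ n i l * (q : ℂ) ^ ν l / (zeta t a₁ a₂ n i k * (q : ℂ) ^ ν k))) ≠ 0
    := by
  have ht := h.t_ne
  have hq := h.q_ne
  have hk0 := zeta_ne_zero ht h.a₁_ne h.a₂_ne i k
  have hkl' : (k : ℕ) < l := hkl
  by_cases hb : (k : ℕ) < i ↔ (l : ℕ) < i
  · refine qPoch_ne_zero h.q_pos h.q_lt_one fun N hN => ?_
    have hle := hν k l hkl hb
    refine h.t_pole (l - k + 1) (by simp; omega) (ν l - ν k + N) ?_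
    rw [zeta_same_block i hkl.le hb] at hN
    rw [← hN, pow_succ, pow_add, pow_sub₀ _ hq hle]
    field_simp
  · have hki : (k : ℕ) < i := by by_contra hc; exact hb ⟨fun h => absurd h hc, fun h => by omega⟩
    have hil : i ≤ (l : ℕ) := by by_contra hc; exact hb ⟨fun _ => by omega, fun _ => hki⟩
    refine qPoch_ne_zero_of_zpow h.q_pos h.q_lt_one fun s hs => ?_
    refine (zeta_cross_ne h hki hil (s - ν l + ν k)).1 ?_
    rw [zpow_add₀ hq, zpow_sub₀ hq, ← hs, zpow_natCast, zpow_natCast]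
    field_simp

theorem qPoch_site_ne_zero (h : Admissible n q t a₁ a₂ b₁ b₂) {i : ℕ} (k : Fin n) (N : ℕ) :
    qPoch q (b₁ * (zeta t a₁ a₂ n i k * (q : ℂ) ^ N)) ≠ 0 ∧
      qPoch q (b₂ * (zeta t a₁ a₂ n i k * (q : ℂ) ^ N)) ≠ 0 := by
  by_cases hk : (k : ℕ) < i
  · rw [zeta_of_lt hk]
    exact ⟨qPoch_ne_zero h.q_pos h.q_lt_one fun M hM => h.a₁b₁_pole k k.2 (N + M) (by
      rw [← hM]; ring), qPoch_ne_zero h.q_pos h.q_lt_one fun M hM => h.a₁b₂_pole k k.2 (N + M) (by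
      rw [← hM]; ring)⟩
  · rw [zeta_of_ge (not_lt.1 hk)]
    have : (k : ℕ) - i < n := by omega
    exact ⟨qPoch_ne_zero h.q_pos h.q_lt_one fun M hM => h.a₂b₁_pole _ this (N + M) (by
      rw [← hM]; ring), qPoch_ne_zero h.q_pos h.q_lt_one fun M hM => h.a₂b₂_pole _ this (N + M) (by
      rw [← hM]; ring)⟩

theorem rawWt_insertNth {m : ℕ} (x : Fin (m + 1) → ℂ) (r : Fin (m + 1)) (M : ℕ) (ν : Fin m → ℕ) :
    rawWt q t a₁ a₂ b₁ b₂ x (r.insertNth M ν) =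
      (q : ℂ) ^ M * siteWt q a₁ a₂ b₁ b₂ (x r * (q : ℂ) ^ M) *
      (∏ j, if r.succAbove j < r then pairWt q t (x (r.succAbove j)) (x r) (ν j) M
        else pairWt q t (x r) (x (r.succAbove j)) M (ν j)) *
      rawWt q t a₁ a₂ b₁ b₂ (fun j => x (r.succAbove j)) ν := by
  unfold rawWt
  rw [Fin.prod_univ_succAbove _ r, prod_Ioi_succAbove _ r]
  simp only [Fin.insertNth_apply_same, Fin.insertNth_apply_succAbove]
  ring

/-! ### The difference relations -/

/-- The expression whose telescoping along the `r`-th coordinate produces the difference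
relations; it is the weight times `z_r⁻¹ (1 - z_r / a₁) (1 - z_r / a₂) ∏_{j ≠ r} (z_r - t z_j)`. -/
noncomputable def bdry (q : ℝ) (t a₁ a₂ b₁ b₂ : ℂ) {m : ℕ} (i : ℕ) (r : Fin (m + 1)) (M : ℕ)
    (ν : Fin m → ℕ) : ℂ :=
  wt q t a₁ a₂ b₁ b₂ i (r.insertNth M ν) * ((zeta t a₁ a₂ (m + 1) i r * (q : ℂ) ^ M)⁻¹ *
    ((1 - a₁⁻¹ * (zeta t a₁ a₂ (m + 1) i r * (q : ℂ) ^ M)) *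
      (1 - a₂⁻¹ * (zeta t a₁ a₂ (m + 1) i r * (q : ℂ) ^ M)) *
      ∏ j, (zeta t a₁ a₂ (m + 1) i r * (q : ℂ) ^ M -
        t * (zeta t a₁ a₂ (m + 1) i (r.succAbove j) * (q : ℂ) ^ ν j))))

/-- At the origin of the `r`-th coordinate either `z_r` is `a₁` or `a₂`, or the previous variable of
the block has exponent `0` and `z_r` is `t` times that variable. -/
theorem bdry_zero {m : ℕ} (h₁ : a₁ ≠ 0) (h₂ : a₂ ≠ 0) (i : ℕ)
    (r : Fin (m + 1)) (ν : Fin m → ℕ) : bdry q t a₁ a₂ b₁ b₂ i r 0 ν = 0 := by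
  by_cases hf : InFan i (r.insertNth 0 ν : Fin (m + 1) → ℕ)
  swap
  · simp [bdry, wt, hf]
  unfold bdry
  rw [pow_zero, mul_one]
  refine mul_eq_zero_of_right _ (mul_eq_zero_of_right _ ?_)
  by_cases h0 : (r : ℕ) = 0 ∨ (r : ℕ) = i
  · refine mul_eq_zero_of_left ?_ _
    by_cases hi : (r : ℕ) < i
    · rw [zeta_of_lt hi, show (r : ℕ) = 0 by omega]
      simp [h₁]
    · rw [zeta_of_ge (not_lt.1 hi), show (r : ℕ) - i = 0 by omega]
      simp [h₂]
  · push Not at h0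
    set k : Fin (m + 1) := ⟨r - 1, by omega⟩ with hk
    have hkr : k < r := Fin.lt_def.2 (by change (r : ℕ) - 1 < r; omega)
    obtain ⟨j, hj⟩ := Fin.exists_succAbove_eq hkr.ne
    have hb : (k : ℕ) < i ↔ (r : ℕ) < i := by
      change (r : ℕ) - 1 < i ↔ _
      omega
    have h1 := hf k r hkr hb
    rw [Fin.insertNth_apply_same, ← hj, Fin.insertNth_apply_succAbove, Nat.le_zero] at h1
    refine mul_eq_zero_of_right _ (Finset.prod_eq_zero (Finset.mem_univ j) ?_)
    rw [h1, hj, zeta_same_block i hkr.le hb, show (r : ℕ) - k = 1 by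
      change (r : ℕ) - ((r : ℕ) - 1) = 1; omega]
    ring

/-- The effect of a unit shift of the `r`-th coordinate. If the shift leaves or enters the fan,
then both sides vanish, so that the weights may be extended by zero. -/
theorem bdry_succ {m : ℕ} (h : Admissible (m + 1) q t a₁ a₂ b₁ b₂) (i : ℕ)
    (r : Fin (m + 1)) (M : ℕ) (ν : Fin m → ℕ) :
    bdry q t a₁ a₂ b₁ b₂ i r (M + 1) ν =
      wt q t a₁ a₂ b₁ b₂ i (r.insertNth M ν) * ((zeta t a₁ a₂ (m + 1) i r * (q : ℂ) ^ M)⁻¹ *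
        (t ^ m * ((1 - b₁ * (zeta t a₁ a₂ (m + 1) i r * (q : ℂ) ^ M)) *
        (1 - b₂ * (zeta t a₁ a₂ (m + 1) i r * (q : ℂ) ^ M))) *
        ∏ j, (t * (zeta t a₁ a₂ (m + 1) i r * (q : ℂ) ^ M) -
        zeta t a₁ a₂ (m + 1) i (r.succAbove j) * (q : ℂ) ^ ν j))) := by
  have ht := h.t_ne
  have hq := h.q_ne
  have hx0 := zeta_ne_zero ht h.a₁_ne h.a₂_ne (n := m + 1) i r
  by_cases hf : InFan i (r.insertNth M ν : Fin (m + 1) → ℕ)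
  · by_cases hf' : InFan i (r.insertNth (M + 1) ν : Fin (m + 1) → ℕ)
    · -- Both points lie in the fan: the weights are given by the formula, factor by factor.
      have hs := qPoch_site_ne_zero h (i := i) r M
      have hsite := siteWt_mul_q h.q_pos h.q_lt_one (a₁ := a₁) (a₂ := a₂) hs.1 hs.2
      have hpair : ∀ j, (if r.succAbove j < r then
          pairWt q t (zeta t a₁ a₂ (m + 1) i (r.succAbove j)) (zeta t a₁ a₂ (m + 1) i r)
            (ν j) (M + 1)
          else pairWt q t (zeta t a₁ a₂ (m + 1) i r) (zeta t a₁ a₂ (m + 1) i (r.succAbove j))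
            (M + 1) (ν j)) * (zeta t a₁ a₂ (m + 1) i r * (q : ℂ) ^ (M + 1) -
            t * (zeta t a₁ a₂ (m + 1) i (r.succAbove j) * (q : ℂ) ^ ν j)) =
          (if r.succAbove j < r then
          pairWt q t (zeta t a₁ a₂ (m + 1) i (r.succAbove j)) (zeta t a₁ a₂ (m + 1) i r)
            (ν j) M
          else pairWt q t (zeta t a₁ a₂ (m + 1) i r) (zeta t a₁ a₂ (m + 1) i (r.succAbove j))
            M (ν j)) * (t * (t * (zeta t a₁ a₂ (m + 1) i r * (q : ℂ) ^ M) -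
            zeta t a₁ a₂ (m + 1) i (r.succAbove j) * (q : ℂ) ^ ν j)) := by
        intro j
        have hxj := zeta_ne_zero ht h.a₁_ne h.a₂_ne (n := m + 1) i (r.succAbove j)
        rcases lt_or_gt_of_ne (Fin.succAbove_ne r j) with hlt | hlt
        · rw [if_pos hlt, if_pos hlt]
          have h1 := qPoch_pair_ne_zero h hf hlt
          rw [Fin.insertNth_apply_same, Fin.insertNth_apply_succAbove] at h1
          rw [← pairWt_succ_right h.q_pos h.q_lt_one ht hxj h1]
          ring
        · rw [if_neg hlt.not_gt, if_neg hlt.not_gt]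
          have h1 := qPoch_pair_ne_zero h hf' hlt
          rw [Fin.insertNth_apply_same, Fin.insertNth_apply_succAbove] at h1
          rw [← pairWt_succ_left h.q_pos h.q_lt_one ht hx0 h1]
          ring
      have hprod := Finset.prod_congr (rfl : (Finset.univ : Finset (Fin m)) = Finset.univ)
        fun j _ => hpair j
      rw [Finset.prod_mul_distrib, Finset.prod_mul_distrib, Finset.prod_mul_distrib,
        Finset.prod_const, Finset.card_univ, Fintype.card_fin] at hprod
      unfold bdry wt
      rw [if_pos hf, if_pos hf', rawWt_insertNth, rawWt_insertNth]
      set x := zeta t a₁ a₂ (m + 1) i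
      set P' := ∏ j, if r.succAbove j < r then pairWt q t (x (r.succAbove j)) (x r) (ν j) (M + 1)
        else pairWt q t (x r) (x (r.succAbove j)) (M + 1) (ν j)
      set P := ∏ j, if r.succAbove j < r then pairWt q t (x (r.succAbove j)) (x r) (ν j) M
        else pairWt q t (x r) (x (r.succAbove j)) M (ν j)
      have e : x r * (q : ℂ) ^ (M + 1) = q * (x r * (q : ℂ) ^ M) := by ring
      rw [e] at hprod ⊢
      set z := x r * (q : ℂ) ^ M with hz
      have hz0 : z ≠ 0 := by positivity
      set S' := siteWt q a₁ a₂ b₁ b₂ (q * z)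
      set S := siteWt q a₁ a₂ b₁ b₂ z
      set R := rawWt q t a₁ a₂ b₁ b₂ (fun j => x (r.succAbove j)) ν
      set D' := ∏ j, (q * z - t * (x (r.succAbove j) * (q : ℂ) ^ ν j))
      set D := ∏ j, (t * z - x (r.succAbove j) * (q : ℂ) ^ ν j)
      set T := thetaCoef q t a₁ a₂ (m + 1) i
      rw [mul_inv, pow_succ]
      have e1 : T * ((q : ℂ) ^ M * q * S' * P' * R) * ((q : ℂ)⁻¹ * z⁻¹ *
          ((1 - a₁⁻¹ * (q * z)) * (1 - a₂⁻¹ * (q * z)) * D')) =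
          T * (q : ℂ) ^ M * R * z⁻¹ * (q * (q : ℂ)⁻¹) *
            (S' * ((1 - a₁⁻¹ * (q * z)) * (1 - a₂⁻¹ * (q * z)))) * (P' * D') := by ring
      rw [e1, hsite, hprod, mul_inv_cancel₀ hq]
      ring
    · -- The shift leaves the fan: the next variable of the block is `t z_r`.
      have hl : ∃ l, r < l ∧ ((r : ℕ) < i ↔ (l : ℕ) < i) ∧
          (r.insertNth M ν : Fin (m + 1) → ℕ) l = M := by
        unfold InFan at hf'
        push Not at hf'
        obtain ⟨k, l, hkl, hb, hlt⟩ := hf'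
        have h0 := hf k l hkl hb
        have hkr : k = r := by
          by_contra hkr
          obtain ⟨j, rfl⟩ := Fin.exists_succAbove_eq hkr
          rw [Fin.insertNth_apply_succAbove] at h0 hlt
          by_cases hlr : l = r
          · subst hlr
            rw [Fin.insertNth_apply_same] at h0 hlt
            omega
          · obtain ⟨j', rfl⟩ := Fin.exists_succAbove_eq hlr
            rw [Fin.insertNth_apply_succAbove] at h0 hlt
            omega
        subst hkr
        obtain ⟨j', rfl⟩ := Fin.exists_succAbove_eq hkl.ne'
        rw [Fin.insertNth_apply_succAbove, Fin.insertNth_apply_same] at h0 hlt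
        exact ⟨_, hkl, hb, by rw [Fin.insertNth_apply_succAbove]; omega⟩
      obtain ⟨l, hrl, hb, hlM⟩ := hl
      have hrl' : (r : ℕ) < l := hrl
      set k : Fin (m + 1) := ⟨r + 1, by omega⟩ with hk
      have hrk : r < k := Fin.lt_def.2 (by simp [hk])
      have hkb : (r : ℕ) < i ↔ (k : ℕ) < i := by simp [hk]; omega
      have hkM : (r.insertNth M ν : Fin (m + 1) → ℕ) k = M := by
        apply le_antisymm
        · rcases (show k ≤ l from Fin.le_def.2 (by simp [hk]; omega)).eq_or_lt with h0 | h0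
          · rw [h0, hlM]
          · exact (hf k l h0 (hkb.symm.trans hb)).trans hlM.le
        · have := hf r k hrk hkb
          rwa [Fin.insertNth_apply_same] at this
      obtain ⟨j, hj⟩ := Fin.exists_succAbove_eq hrk.ne'
      have hνj : ν j = M := by rw [← hkM, ← hj, Fin.insertNth_apply_succAbove]
      have e1 : bdry q t a₁ a₂ b₁ b₂ i r (M + 1) ν = 0 := by simp [bdry, wt, hf']
      rw [e1]
      symm
      refine mul_eq_zero_of_right _ (mul_eq_zero_of_right _ (mul_eq_zero_of_right _
        (Finset.prod_eq_zero (Finset.mem_univ j) ?_)))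
      rw [hνj, hj, zeta_same_block i hrk.le hkb, show (k : ℕ) - r = 1 by simp [hk]]
      ring
  · have e1 : wt q t a₁ a₂ b₁ b₂ i (r.insertNth M ν : Fin (m + 1) → ℕ) = 0 := by simp [wt, hf]
    rw [e1, zero_mul]
    by_cases hf' : InFan i (r.insertNth (M + 1) ν : Fin (m + 1) → ℕ)
    swap
    · simp [bdry, wt, hf']
    -- The shift enters the fan: `q z_r` is `t` times the previous variable of the block.
    have hl : ∃ k, k < r ∧ ((k : ℕ) < i ↔ (r : ℕ) < i) ∧
        (r.insertNth (M + 1) ν : Fin (m + 1) → ℕ) k = M + 1 := by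
      unfold InFan at hf
      push Not at hf
      obtain ⟨k, l, hkl, hb, hlt⟩ := hf
      have h0 := hf' k l hkl hb
      have hlr : l = r := by
        by_contra hlr
        obtain ⟨j, rfl⟩ := Fin.exists_succAbove_eq hlr
        rw [Fin.insertNth_apply_succAbove] at h0 hlt
        by_cases hkr : k = r
        · subst hkr
          rw [Fin.insertNth_apply_same] at h0 hlt
          omega
        · obtain ⟨j', rfl⟩ := Fin.exists_succAbove_eq hkr
          rw [Fin.insertNth_apply_succAbove] at h0 hlt
          omega
      subst hlr
      obtain ⟨j', rfl⟩ := Fin.exists_succAbove_eq hkl.ne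
      rw [Fin.insertNth_apply_succAbove, Fin.insertNth_apply_same] at h0 hlt
      exact ⟨_, hkl, hb, by rw [Fin.insertNth_apply_succAbove]; omega⟩
    obtain ⟨l, hlr, hb, hlM⟩ := hl
    have hlr' : (l : ℕ) < r := hlr
    set k : Fin (m + 1) := ⟨r - 1, by omega⟩ with hk
    have hkr : k < r := Fin.lt_def.2 (by change (r : ℕ) - 1 < r; omega)
    have hkb : (k : ℕ) < i ↔ (r : ℕ) < i := by
      change (r : ℕ) - 1 < i ↔ _
      omega
    have hkM : (r.insertNth (M + 1) ν : Fin (m + 1) → ℕ) k = M + 1 := by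
      apply le_antisymm
      · have := hf' k r hkr hkb
        rwa [Fin.insertNth_apply_same] at this
      · rcases (show l ≤ k from Fin.le_def.2 (by simp [hk]; omega)).eq_or_lt with h0 | h0
        · rw [← h0, hlM]
        · have := hf' l k h0 (hb.trans hkb.symm)
          omega
    obtain ⟨j, hj⟩ := Fin.exists_succAbove_eq hkr.ne
    have hνj : ν j = M + 1 := by rw [← hkM, ← hj, Fin.insertNth_apply_succAbove]
    unfold bdry
    refine mul_eq_zero_of_right _ (mul_eq_zero_of_right _ (mul_eq_zero_of_right _
      (Finset.prod_eq_zero (Finset.mem_univ j) ?_)))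
    rw [hνj, hj, zeta_same_block i hkr.le hkb, show (r : ℕ) - k = 1 by
      change (r : ℕ) - ((r : ℕ) - 1) = 1; omega]
    ring

/-! ### Boundary terms at infinity and their cancellation -/

theorem theta_ratio_ne (h : Admissible n q t a₁ a₂ b₁ b₂) {m : ℤ} (hm : |m| < (n : ℤ)) :
    theta q (a₁ * a₂⁻¹ * t ^ m) ≠ 0 := by
  have := h.a₁_ne
  have := h.a₂_ne
  have := h.t_ne
  exact theta_ne_zero h.q_pos h.q_lt_one (by positivity) (h.ratio_pole m hm)

theorem mul_thetaRatio (hq0 : 0 < q) (hq1 : q < 1) (ht : t ≠ 0) {u : ℂ} (hu : u ≠ 0) :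
    u * thetaRatio q t u = -t⁻¹ * (theta q (t / u) / theta q (t⁻¹ / u)) := by
  have h := theta_inv hq0 hq1 (x := t⁻¹ / u) (by positivity)
  rw [show (t⁻¹ / u)⁻¹ = t * u by field_simp] at h
  unfold thetaRatio
  rw [h]
  generalize theta q (t⁻¹ / u) = T
  field_simp

/-- The theta factors of adjacent lattices are matched so that the boundary terms cancel. The
product of theta ratios comes from moving the last variable of the first block past the second
block. -/
theorem thetaCoef_succ {m : ℕ} (h : Admissible (m + 1) q t a₁ a₂ b₁ b₂) {i : ℕ} (hi : i ≤ m) :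
    thetaCoef q t a₁ a₂ (m + 1) (i + 1) * (a₁ * t ^ i)⁻¹ *
      ∏ l ∈ Finset.range (m - i), (a₂ * t ^ l / (a₁ * t ^ i) *
        thetaRatio q t (a₂ * t ^ l / (a₁ * t ^ i))) =
      -(-1) ^ (m - i) * (thetaCoef q t a₁ a₂ (m + 1) i * (a₂ * t ^ (m - i))⁻¹) := by
  have ht := h.t_ne
  have h1 := h.a₁_ne
  have h2 := h.a₂_ne
  obtain ⟨d, rfl⟩ : ∃ d, m = i + d := ⟨m - i, by omega⟩
  rw [show i + d - i = d by omega]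
  unfold thetaCoef
  rw [show i + d + 1 - (i + 1) = d by omega, show i + d + 1 - i = d + 1 by omega,
    Finset.prod_range_succ _ i, Finset.prod_range_succ' _ d]
  have e1 : theta q (a₂ * a₁⁻¹ * t ^ (-(i : ℤ))) =
      -(a₁ * a₂⁻¹ * t ^ i)⁻¹ * theta q (a₁ * a₂⁻¹ * t ^ ((i : ℤ) - (0 : ℕ))) := by
    have := theta_inv h.q_pos h.q_lt_one (x := a₁ * a₂⁻¹ * t ^ i) (by positivity)
    rw [Nat.cast_zero, sub_zero, zpow_natCast, ← this, zpow_neg, zpow_natCast]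
    congr 1
    field_simp
  have e2 : ∀ l ∈ Finset.range d, a₂ * t ^ l / (a₁ * t ^ i) *
      thetaRatio q t (a₂ * t ^ l / (a₁ * t ^ i)) = -t⁻¹ *
        (theta q (a₁ * a₂⁻¹ * t ^ (((i + 1 : ℕ) : ℤ) - l)) *
        (theta q (a₁ * a₂⁻¹ * t ^ ((i : ℤ) - (l + 1 : ℕ))))⁻¹) := by
    intro l _
    rw [mul_thetaRatio h.q_pos h.q_lt_one ht (by positivity), div_eq_mul_inv (theta q _)]
    congr 4
    · rw [zpow_sub₀ ht, zpow_natCast, zpow_natCast]; field_simp; ring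
    · rw [zpow_sub₀ ht, zpow_natCast, zpow_natCast]; field_simp; ring
  rw [Finset.prod_congr rfl e2, Finset.prod_mul_distrib, Finset.prod_mul_distrib,
    Finset.prod_const, Finset.card_range, e1]
  have e3 : (∏ k ∈ Finset.range d, (theta q (a₁ * a₂⁻¹ * t ^ (((i + 1 : ℕ) : ℤ) - k)))⁻¹) *
      ∏ k ∈ Finset.range d, theta q (a₁ * a₂⁻¹ * t ^ (((i + 1 : ℕ) : ℤ) - k)) = 1 := by
    rw [← Finset.prod_mul_distrib]
    refine Finset.prod_eq_one fun k hk => inv_mul_cancel₀ (theta_ratio_ne h ?_)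
    have := Finset.mem_range.1 hk
    rw [abs_lt]
    omega
  set U := ∏ j ∈ Finset.range i, (theta q (a₂ * a₁⁻¹ * t ^ (-(j : ℤ))))⁻¹
  set V := ∏ k ∈ Finset.range d, (theta q (a₁ * a₂⁻¹ * t ^ (((i + 1 : ℕ) : ℤ) - k)))⁻¹
  set V' := ∏ k ∈ Finset.range d, theta q (a₁ * a₂⁻¹ * t ^ (((i + 1 : ℕ) : ℤ) - k))
  set W := ∏ k ∈ Finset.range d, (theta q (a₁ * a₂⁻¹ * t ^ ((i : ℤ) - (k + 1 : ℕ))))⁻¹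
  set T := theta q (a₁ * a₂⁻¹ * t ^ ((i : ℤ) - (0 : ℕ)))
  have e4 : (-t⁻¹) ^ d = (-1) ^ d * (t ^ d)⁻¹ := by rw [neg_pow, inv_pow]
  have e5 : (-(a₁ * a₂⁻¹ * t ^ i)⁻¹ * T)⁻¹ = -(a₁ * a₂⁻¹ * t ^ i) * T⁻¹ := by
    rw [mul_inv, inv_neg, inv_inv]
  rw [e4, e5]
  have e6 : U * (-(a₁ * a₂⁻¹ * t ^ i) * T⁻¹) * V * (a₁ * t ^ i)⁻¹ *
      ((-1) ^ d * (t ^ d)⁻¹ * (V' * W)) = (V * V') * (U * (-(a₁ * a₂⁻¹ * t ^ i) * T⁻¹) *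
      (a₁ * t ^ i)⁻¹ * ((-1) ^ d * (t ^ d)⁻¹ * W)) := by ring
  rw [e6, e3]
  generalize T⁻¹ = T'
  field_simp

/-- The common part of the boundary terms of two adjacent lattices, as a function of the other
variables, which lie on the `i`-th lattice in dimension `m`. -/
noncomputable def edgeWt (q : ℝ) (t a₁ a₂ b₁ b₂ : ℂ) {m : ℕ} (i : ℕ) (ν : Fin m → ℕ) : ℂ :=
  open Classical in
  if InFan i ν then
    rawWt q t a₁ a₂ b₁ b₂ (zeta t a₁ a₂ m i) ν * (∏ j, (zeta t a₁ a₂ m i j)⁻¹ * (t ^ 2 / q) ^ ν j) *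
      ∏ j, (0 - t * (zeta t a₁ a₂ m i j * (q : ℂ) ^ ν j))
  else 0

/-- The boundary term vanishes unless the coordinate is the last one of its block. -/
theorem tendsto_bdry_inner {m : ℕ} {i : ℕ} {r : Fin (m + 1)}
    (hr : (r : ℕ) + 1 ≠ i) (hrm : (r : ℕ) ≠ m) (ν : Fin m → ℕ) :
    Tendsto (fun M => bdry q t a₁ a₂ b₁ b₂ i r M ν) atTop (𝓝 0) := by
  set k : Fin (m + 1) := ⟨r + 1, by omega⟩ with hk
  have hrk : r < k := Fin.lt_def.2 (by simp [hk])
  obtain ⟨j, hj⟩ := Fin.exists_succAbove_eq hrk.ne'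
  refine tendsto_const_nhds.congr' ?_
  filter_upwards [eventually_gt_atTop (ν j)] with M hM
  have hf : ¬ InFan i (r.insertNth M ν : Fin (m + 1) → ℕ) := by
    intro hf
    have := hf r k hrk (by change _ ↔ (r : ℕ) + 1 < i; omega)
    rw [Fin.insertNth_apply_same, ← hj, Fin.insertNth_apply_succAbove] at this
    omega
  simp [bdry, wt, hf]

/-- The part of `bdry` that depends on the running coordinate alone. -/
theorem tendsto_bdry_site (hq0 : 0 < q) (hq1 : q < 1) {x : ℂ} (hx : x ≠ 0) {m : ℕ}
    (w : Fin m → ℂ) :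
    Tendsto (fun M : ℕ => (q : ℂ) ^ M * siteWt q a₁ a₂ b₁ b₂ (x * (q : ℂ) ^ M) *
      ((x * (q : ℂ) ^ M)⁻¹ * ((1 - a₁⁻¹ * (x * (q : ℂ) ^ M)) * (1 - a₂⁻¹ * (x * (q : ℂ) ^ M)) *
        ∏ j, (x * (q : ℂ) ^ M - w j)))) atTop (𝓝 (x⁻¹ * ∏ j, (0 - w j))) := by
  have hq : (q : ℂ) ≠ 0 := by exact_mod_cast hq0.ne'
  have h0 : Tendsto (fun M : ℕ => x * (q : ℂ) ^ M) atTop (𝓝 0) := by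
    simpa using (tendsto_ofReal_pow hq0 hq1).const_mul x
  have h1 : Tendsto (fun M : ℕ => (1 - a₁⁻¹ * (x * (q : ℂ) ^ M)) *
      (1 - a₂⁻¹ * (x * (q : ℂ) ^ M)) * ∏ j, (x * (q : ℂ) ^ M - w j)) atTop
      (𝓝 ((1 - a₁⁻¹ * 0) * (1 - a₂⁻¹ * 0) * ∏ j, (0 - w j))) :=
    ((tendsto_const_nhds.sub (h0.const_mul _)).mul
      (tendsto_const_nhds.sub (h0.const_mul _))).mul
      (tendsto_finsetProd _ fun j _ => h0.sub tendsto_const_nhds)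
  have h2 := ((tendsto_siteWt hq0 hq1 a₁ a₂ b₁ b₂ x).mul h1).const_mul x⁻¹
  rw [mul_zero, mul_zero, sub_zero, one_mul, one_mul, one_mul] at h2
  refine h2.congr fun M => ?_
  field_simp

/-- Inserting a large value at the end of a block does not affect membership in the fan. -/
theorem inFan_insertNth_iff {m : ℕ} {i i' : ℕ} {r : Fin (m + 1)} {M : ℕ} {ν : Fin m → ℕ}
    (hM : ∀ j, ν j ≤ M) (hi : ∀ j : Fin m, ((r.succAbove j : ℕ) < i ↔ (j : ℕ) < i'))
    (hr : ∀ l, r < l → ¬ ((r : ℕ) < i ↔ (l : ℕ) < i)) :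
    InFan i (r.insertNth M ν : Fin (m + 1) → ℕ) ↔ InFan i' ν := by
  constructor
  · intro h k l hkl hb
    have := h (r.succAbove k) (r.succAbove l) (Fin.strictMono_succAbove r hkl)
      (by rw [hi, hi, hb])
    simpa only [Fin.insertNth_apply_succAbove] using this
  · intro h k l hkl hb
    by_cases hkr : k = r
    · subst hkr
      exact absurd hb (hr l hkl)
    · obtain ⟨k, rfl⟩ := Fin.exists_succAbove_eq hkr
      rw [Fin.insertNth_apply_succAbove]
      by_cases hlr : l = r
      · subst hlr
        rw [Fin.insertNth_apply_same]
        exact hM k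
      · obtain ⟨l, rfl⟩ := Fin.exists_succAbove_eq hlr
        rw [Fin.insertNth_apply_succAbove]
        exact h k l ((Fin.strictMono_succAbove r).lt_iff_lt.1 hkl) (by rw [← hi, ← hi, hb])

theorem zeta_last_succAbove {m : ℕ} (i : ℕ) (j : Fin m) :
    zeta t a₁ a₂ (m + 1) i ((Fin.last m).succAbove j) = zeta t a₁ a₂ m i j := by
  simp [zeta]

theorem succAbove_mid_val {m i : ℕ} (hi : i < m + 1) (j : Fin m) :
    ((⟨i, hi⟩ : Fin (m + 1)).succAbove j : ℕ) = if (j : ℕ) < i then (j : ℕ) else j + 1 := by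
  simp only [Fin.succAbove, Fin.lt_def]
  split_ifs <;> simp_all

theorem zeta_mid_succAbove {m i : ℕ} (hi : i < m + 1) (j : Fin m) :
    zeta t a₁ a₂ (m + 1) (i + 1) ((⟨i, hi⟩ : Fin (m + 1)).succAbove j) = zeta t a₁ a₂ m i j := by
  simp only [zeta, succAbove_mid_val]
  by_cases hj : (j : ℕ) < i
  · rw [if_pos hj, if_pos hj, if_pos (by omega)]
  · rw [if_neg hj, if_neg hj, if_neg (by omega), Nat.add_sub_add_right]

/-- The boundary term of the last variable of the second block. -/
theorem tendsto_bdry_last {m : ℕ} (h : Admissible (m + 1) q t a₁ a₂ b₁ b₂) {i : ℕ} (hi : i ≤ m)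
    (ν : Fin m → ℕ) :
    Tendsto (fun M => bdry q t a₁ a₂ b₁ b₂ i (Fin.last m) M ν) atTop
      (𝓝 (thetaCoef q t a₁ a₂ (m + 1) i * (a₂ * t ^ (m - i))⁻¹ *
        edgeWt q t a₁ a₂ b₁ b₂ i ν)) := by
  have ht := h.t_ne
  have hq := h.q_ne
  set x := zeta t a₁ a₂ (m + 1) i with hx
  have hxr : x (Fin.last m) = a₂ * t ^ (m - i) := zeta_of_ge (by simpa using hi)
  have hrest' : ∀ j : Fin m, x ((Fin.last m).succAbove j) = zeta t a₁ a₂ m i j :=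
    zeta_last_succAbove i
  have hM : ∀ᶠ M in atTop, ∀ j, ν j ≤ M := by
    rw [eventually_all]; exact fun j => eventually_ge_atTop _
  have hfan : ∀ᶠ M in atTop, (InFan i ((Fin.last m).insertNth M ν : Fin (m + 1) → ℕ) ↔
      InFan i ν) := by
    filter_upwards [hM] with M hM
    refine inFan_insertNth_iff hM (fun j => by simp) fun l hl => absurd hl (Fin.le_last l).not_gt
  by_cases hf : InFan i ν
  · rw [edgeWt, if_pos hf]
    have h1 := tendsto_bdry_site (a₁ := a₁) (a₂ := a₂) (b₁ := b₁) (b₂ := b₂) h.q_pos h.q_lt_one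
      (x := x (Fin.last m)) (zeta_ne_zero ht h.a₁_ne h.a₂_ne _ _)
      (fun j => t * (zeta t a₁ a₂ m i j * (q : ℂ) ^ ν j))
    have h2 : Tendsto (fun M => ∏ j : Fin m,
        pairWt q t (zeta t a₁ a₂ m i j) (x (Fin.last m)) (ν j) M) atTop
        (𝓝 (∏ j, (zeta t a₁ a₂ m i j)⁻¹ * (t ^ 2 / q) ^ ν j)) :=
      tendsto_finsetProd _ fun j _ => tendsto_pairWt_right h.q_pos h.q_lt_one _ _ _
    have h3 := (h1.mul h2).const_mul
      (thetaCoef q t a₁ a₂ (m + 1) i * rawWt q t a₁ a₂ b₁ b₂ (zeta t a₁ a₂ m i) ν)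
    rw [← hxr]
    refine (h3.congr' ?_).trans (le_of_eq ?_)
    · filter_upwards [hfan] with M hM
      unfold bdry wt
      rw [if_pos (hM.2 hf), rawWt_insertNth]
      simp only [← hx, hrest']
      have : ∀ j : Fin m, (Fin.last m).succAbove j < Fin.last m := fun j => by
        simp [Fin.castSucc_lt_last]
      simp only [this, if_true]
      ring
    · congr 1
      ring
  · rw [edgeWt, if_neg hf, mul_zero]
    refine tendsto_const_nhds.congr' ?_
    filter_upwards [hfan] with M hM
    rw [bdry, wt, if_neg (hM.not.2 hf), zero_mul]

/-- The boundary term of the last variable of the first block, for the next lattice. Up to sign it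
is that of `tendsto_bdry_last`. -/
theorem tendsto_bdry_mid {m : ℕ} (h : Admissible (m + 1) q t a₁ a₂ b₁ b₂) {i : ℕ} (hi : i ≤ m)
    (ν : Fin m → ℕ) :
    Tendsto (fun M => bdry q t a₁ a₂ b₁ b₂ (i + 1) ⟨i, by omega⟩ M ν) atTop
      (𝓝 (-(-1) ^ (m - i) * (thetaCoef q t a₁ a₂ (m + 1) i * (a₂ * t ^ (m - i))⁻¹ *
        edgeWt q t a₁ a₂ b₁ b₂ i ν))) := by
  have ht := h.t_ne
  have hq := h.q_ne
  set r : Fin (m + 1) := ⟨i, by omega⟩ with hr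
  set x := zeta t a₁ a₂ (m + 1) (i + 1) with hx
  have hxr : x r = a₁ * t ^ i := zeta_of_lt (by simp [hr])
  have hlt : ∀ j : Fin m, r.succAbove j < r ↔ (j : ℕ) < i := by
    intro j
    rw [Fin.succAbove_lt_iff_castSucc_lt, Fin.lt_def]
    simp [hr]
  have hval : ∀ j : Fin m, (r.succAbove j : ℕ) = if (j : ℕ) < i then (j : ℕ) else j + 1 :=
    succAbove_mid_val (by omega)
  have hrest' : ∀ j : Fin m, x (r.succAbove j) = zeta t a₁ a₂ m i j :=
    zeta_mid_succAbove (by omega)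
  have hM : ∀ᶠ M in atTop, ∀ j, ν j ≤ M := by
    rw [eventually_all]; exact fun j => eventually_ge_atTop _
  have hfan : ∀ᶠ M in atTop, (InFan (i + 1) (r.insertNth M ν : Fin (m + 1) → ℕ) ↔
      InFan i ν) := by
    filter_upwards [hM] with M hM
    refine inFan_insertNth_iff hM (fun j => ?_) fun l hl => ?_
    · rw [hval]; split_ifs <;> omega
    · have : i < (l : ℕ) := hl
      change ¬ (i < i + 1 ↔ (l : ℕ) < i + 1)
      omega
  by_cases hf : InFan i ν
  · rw [edgeWt, if_pos hf]
    have h1 := tendsto_bdry_site (a₁ := a₁) (a₂ := a₂) (b₁ := b₁) (b₂ := b₂) h.q_pos h.q_lt_one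
      (x := x r) (zeta_ne_zero ht h.a₁_ne h.a₂_ne _ _)
      (fun j => t * (zeta t a₁ a₂ m i j * (q : ℂ) ^ ν j))
    -- The factor of `pairWt_swap` for the variables behind `z_r`.
    set E : Fin m → ℂ := fun j => if (j : ℕ) < i then 1 else
      zeta t a₁ a₂ m i j / x r * thetaRatio q t (zeta t a₁ a₂ m i j / x r) with hE
    have h2 : Tendsto (fun M => ∏ j : Fin m, E j *
        pairWt q t (zeta t a₁ a₂ m i j) (x r) (ν j) M) atTop
        (𝓝 (∏ j, E j * ((zeta t a₁ a₂ m i j)⁻¹ * (t ^ 2 / q) ^ ν j))) :=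
      tendsto_finsetProd _ fun j _ => (tendsto_pairWt_right h.q_pos h.q_lt_one _ _ _).const_mul _
    have hEprod : ∏ j, E j = ∏ l ∈ Finset.range (m - i), (a₂ * t ^ l / (a₁ * t ^ i) *
        thetaRatio q t (a₂ * t ^ l / (a₁ * t ^ i))) := by
      obtain ⟨d, rfl⟩ : ∃ d, m = i + d := ⟨m - i, by omega⟩
      rw [Fin.prod_univ_add, Finset.prod_eq_one (fun j _ => by simp [hE]), one_mul,
        show i + d - i = d by omega, Finset.prod_range]
      refine Finset.prod_congr rfl fun j _ => ?_
      simp [hE, zeta, hxr]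
    have h3 := (h1.mul h2).const_mul
      (thetaCoef q t a₁ a₂ (m + 1) (i + 1) * rawWt q t a₁ a₂ b₁ b₂ (zeta t a₁ a₂ m i) ν)
    refine (h3.congr' ?_).trans (le_of_eq ?_)
    · filter_upwards [hfan] with M hM
      unfold bdry wt
      rw [if_pos (hM.2 hf), rawWt_insertNth]
      simp only [← hx, hrest']
      have hpair : ∀ j : Fin m, (if r.succAbove j < r then
          pairWt q t (zeta t a₁ a₂ m i j) (x r) (ν j) M else
          pairWt q t (x r) (zeta t a₁ a₂ m i j) M (ν j)) =
          E j * pairWt q t (zeta t a₁ a₂ m i j) (x r) (ν j) M := by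
        intro j
        by_cases hj : (j : ℕ) < i
        · rw [if_pos ((hlt j).2 hj)]; simp [hE, hj]
        · rw [if_neg (mt (hlt j).1 hj)]
          simp only [hE, if_neg hj]
          have hne := fun s => zeta_cross_ne h (i := i + 1) (k := r) (l := r.succAbove j)
            (by simp [hr]) (by rw [hval, if_neg hj]; omega) s
          rw [← hx, hrest'] at hne
          exact pairWt_swap h.q_pos h.q_lt_one ht (zeta_ne_zero ht h.a₁_ne h.a₂_ne _ _)
            (zeta_ne_zero ht h.a₁_ne h.a₂_ne _ _) (fun s => (hne s).1) (fun s => (hne s).2) _ _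
      simp only [hpair]
      ring
    · congr 1
      rw [Finset.prod_mul_distrib, hEprod, hxr]
      linear_combination (rawWt q t a₁ a₂ b₁ b₂ (zeta t a₁ a₂ m i) ν *
        (∏ j, (zeta t a₁ a₂ m i j)⁻¹ * (t ^ 2 / q) ^ ν j) *
        ∏ j, (0 - t * (zeta t a₁ a₂ m i j * (q : ℂ) ^ ν j))) * thetaCoef_succ h hi
  · rw [edgeWt, if_neg hf, mul_zero, mul_zero]
    refine tendsto_const_nhds.congr' ?_
    filter_upwards [hfan] with M hM
    rw [bdry, wt, if_neg (hM.not.2 hf), zero_mul]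

/-! ### Growth of theta functions along geometric progressions -/

theorem tendsto_pow_mul_gaussian (hq0 : 0 < q) (hq1 : q < 1) (w : ℝ) :
    Tendsto (fun N : ℕ => w ^ N * q ^ (N + 1).choose 2) atTop (𝓝 0) := by
  rcases eq_or_ne w 0 with rfl | hw
  · refine tendsto_const_nhds.congr' ?_
    filter_upwards [eventually_ge_atTop 1] with N hN
    rw [zero_pow (by omega), zero_mul]
  · refine (summable_of_ratio_test_tendsto_lt_one (l := 0) zero_lt_one
      (Eventually.of_forall fun N => by positivity) ?_).tendsto_atTop_zero
    have h : Tendsto (fun N : ℕ => |w| * q ^ (N + 1)) atTop (𝓝 0) := by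
      simpa using ((tendsto_pow_atTop_nhds_zero_of_lt_one hq0.le hq1).comp
        (tendsto_add_atTop_nat 1)).const_mul |w|
    refine h.congr fun N => ?_
    rw [Nat.choose_succ_succ' (N + 1) 1, Nat.choose_one_right, pow_add, pow_succ w]
    simp only [norm_mul, norm_pow, Real.norm_eq_abs, abs_of_pos hq0]
    have : |w| ≠ 0 := abs_ne_zero.2 hw
    field_simp
    rw [pow_add, pow_succ]

theorem norm_ofReal_pos (hq0 : 0 < q) : ‖(q : ℂ)‖ = q := by
  rw [Complex.norm_real, Real.norm_of_nonneg hq0.le]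

theorem exists_theta_inv_bound (hq0 : 0 < q) (hq1 : q < 1) {v : ℂ} (hv : v ≠ 0) :
    ∃ C : ℝ, 0 < C ∧ ∀ N : ℕ, ‖(theta q (v * (q : ℂ) ^ N))⁻¹‖ ≤ C * (‖v‖ ^ N * q ^ N.choose 2) := by
  have hq : (q : ℂ) ≠ 0 := by exact_mod_cast hq0.ne'
  refine ⟨‖(theta q v)⁻¹‖ + 1, by positivity, fun N => ?_⟩
  have h := theta_mul_pow hq0 hq1 hv N
  have h2 : (theta q (v * (q : ℂ) ^ N))⁻¹ = (theta q v)⁻¹ * ((-v) ^ N * (q : ℂ) ^ N.choose 2) := by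
    have h3 : (-v) ^ N * (q : ℂ) ^ N.choose 2 ≠ 0 :=
      mul_ne_zero (pow_ne_zero _ (neg_ne_zero.2 hv)) (pow_ne_zero _ hq)
    rw [← h, mul_inv, mul_assoc, inv_mul_cancel₀ h3, mul_one]
  rw [h2, norm_mul, norm_mul, norm_pow, norm_pow, norm_neg, norm_ofReal_pos hq0]
  gcongr
  linarith

/-- `1 / θ(u q^(-N))` tends to zero faster than any geometric progression. -/
theorem tendsto_theta_inv (hq0 : 0 < q) (hq1 : q < 1) {u : ℂ} (hu : u ≠ 0)
    (κ : ℝ) :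
    Tendsto (fun N : ℕ => κ ^ N * ‖(theta q (u * (q : ℂ) ^ (-N : ℤ)))⁻¹‖) atTop (𝓝 0) := by
  have hq : (q : ℂ) ≠ 0 := by exact_mod_cast hq0.ne'
  have h := (tendsto_pow_mul_gaussian hq0 hq1 (κ / ‖u‖)).const_mul ‖(theta q u)⁻¹‖
  rw [mul_zero] at h
  refine h.congr fun N => ?_
  have h1 := theta_mul_zpow_neg hq0 hq1 hu N
  have h2 : (theta q (u * (q : ℂ) ^ (-N : ℤ)))⁻¹ =
      (theta q u)⁻¹ * ((-u) ^ N)⁻¹ * (q : ℂ) ^ (N + 1).choose 2 := by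
    have h3 : (q : ℂ) ^ (N + 1).choose 2 ≠ 0 := pow_ne_zero _ hq
    rw [← mul_inv, mul_comm (theta q u), ← h1, mul_inv, mul_assoc, inv_mul_cancel₀ h3, mul_one]
  rw [h2, norm_mul, norm_mul, norm_pow, norm_ofReal_pos hq0, norm_inv ((-u) ^ N), norm_pow, norm_neg,
    div_pow]
  ring

theorem qPoch_neg_bound (hq0 : 0 < q) (hq1 : q < 1) {u : ℂ} (hu : u ≠ 0)
    (h : ∀ l : ℤ, u ≠ (q : ℂ) ^ l) :
    ∃ C : ℝ, 0 < C ∧ ∀ m : ℕ, ‖qPoch q (u * (q : ℂ) ^ (-m : ℤ))‖ ≤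
      C * (‖u‖ ^ m / q ^ (m + 1).choose 2) := by
  have hq : (q : ℂ) ≠ 0 := by exact_mod_cast hq0.ne'
  obtain ⟨C, hC0, hC⟩ := exists_qPoch_inv_bound hq0 hq1 ((q : ℂ) / u)
  refine ⟨(‖theta q u‖ + 1) * C, by positivity, fun m => ?_⟩
  have h1 := theta_mul_zpow_neg hq0 hq1 hu m
  have e : (q : ℂ) / (u * (q : ℂ) ^ (-m : ℤ)) = q / u * (q : ℂ) ^ m := by
    rw [zpow_neg, zpow_natCast]; field_simp
  have hne : qPoch q (q / u * (q : ℂ) ^ m) ≠ 0 := by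
    refine qPoch_ne_zero hq0 hq1 fun N hN => h (1 + m + N) ?_
    rw [zpow_add₀ hq, zpow_add₀ hq, zpow_one, zpow_natCast, zpow_natCast]
    field_simp at hN
    rw [hN]
  have h2 : qPoch q (u * (q : ℂ) ^ (-m : ℤ)) =
      theta q u * ((-u) ^ m / (q : ℂ) ^ (m + 1).choose 2) * (qPoch q (q / u * (q : ℂ) ^ m))⁻¹ := by
    rw [theta, e] at h1
    have h3 : (q : ℂ) ^ (m + 1).choose 2 ≠ 0 := pow_ne_zero _ hq
    generalize qPoch q (q / u * (q : ℂ) ^ m) = G at hne h1 ⊢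
    generalize qPoch q (u * (q : ℂ) ^ (-m : ℤ)) = F at h1 ⊢
    field_simp
    linear_combination h1
  rw [h2, norm_mul, norm_mul, norm_div, norm_pow, norm_pow, norm_neg, norm_ofReal_pos hq0]
  calc _ ≤ (‖theta q u‖ + 1) * (‖u‖ ^ m / q ^ (m + 1).choose 2) * C := by
        gcongr
        · linarith
        · exact hC m
    _ = _ := by ring

theorem qPoch_div_theta_bound (hq0 : 0 < q) (hq1 : q < 1) {u v : ℂ} (hu : u ≠ 0) (hv : v ≠ 0)
    (h : ∀ l : ℤ, u ≠ (q : ℂ) ^ l) :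
    ∃ C : ℝ, 0 < C ∧ ∀ N ν : ℕ,
      (ν ≤ N → ‖qPoch q (u * (q : ℂ) ^ ν / (q : ℂ) ^ N)‖ * ‖(theta q (v * (q : ℂ) ^ N))⁻¹‖ ≤
        C * (‖u‖ ^ (N - ν) * ‖v‖ ^ N * q ^ N.choose 2 / q ^ (N - ν + 1).choose 2)) ∧
      (N ≤ ν → ‖qPoch q (u * (q : ℂ) ^ ν / (q : ℂ) ^ N)‖ * ‖(theta q (v * (q : ℂ) ^ N))⁻¹‖ ≤
        C * (‖v‖ ^ N * q ^ N.choose 2)) := by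
  have hq : (q : ℂ) ≠ 0 := by exact_mod_cast hq0.ne'
  obtain ⟨C₁, h10, h1⟩ := exists_theta_inv_bound hq0 hq1 hv
  obtain ⟨C₂, h20, h2⟩ := qPoch_neg_bound hq0 hq1 hu h
  obtain ⟨C₃, h30, h3⟩ := exists_qPoch_bound hq0 hq1 u
  refine ⟨(C₂ + C₃) * C₁, by positivity, fun N ν => ⟨fun hν => ?_, fun hν => ?_⟩⟩
  · have e : u * (q : ℂ) ^ ν / (q : ℂ) ^ N = u * (q : ℂ) ^ (-((N - ν : ℕ) : ℤ)) := by
      rw [zpow_neg, zpow_natCast, pow_sub₀ _ hq hν]; field_simp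
    rw [e]
    calc _ ≤ (C₂ * (‖u‖ ^ (N - ν) / q ^ (N - ν + 1).choose 2)) *
          (C₁ * (‖v‖ ^ N * q ^ N.choose 2)) := mul_le_mul (h2 _) (h1 N) (norm_nonneg _)
            (by positivity)
      _ = C₂ * C₁ * (‖u‖ ^ (N - ν) * ‖v‖ ^ N * q ^ N.choose 2 / q ^ (N - ν + 1).choose 2) := by ring
      _ ≤ _ := by gcongr; linarith
  · have e : u * (q : ℂ) ^ ν / (q : ℂ) ^ N = u * (q : ℂ) ^ (ν - N) := by
      rw [pow_sub₀ _ hq hν]; field_simp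
    rw [e]
    calc _ ≤ C₃ * (C₁ * (‖v‖ ^ N * q ^ N.choose 2)) := mul_le_mul (h3 _) (h1 N) (norm_nonneg _)
            (by positivity)
      _ = C₃ * C₁ * (‖v‖ ^ N * q ^ N.choose 2) := by ring
      _ ≤ _ := by gcongr; linarith

/-- A quotient `(u q^(ν-N))_∞ / θ(v q^N)` grows at most like a geometric progression: the Gaussian
factors of numerator and denominator cancel. -/
theorem qPoch_div_theta_geometric (hq0 : 0 < q) (hq1 : q < 1) {u v : ℂ} (hu : u ≠ 0) (hv : v ≠ 0)
    (h : ∀ l : ℤ, u ≠ (q : ℂ) ^ l) :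
    ∃ C κ : ℝ, 0 < C ∧ 0 < κ ∧ ∀ N ν : ℕ,
      ‖qPoch q (u * (q : ℂ) ^ ν / (q : ℂ) ^ N)‖ * ‖(theta q (v * (q : ℂ) ^ N))⁻¹‖ ≤ C * κ ^ N := by
  obtain ⟨C, hC0, hC⟩ := qPoch_div_theta_bound hq0 hq1 hu hv h
  have hv' : 0 < ‖v‖ := norm_pos_iff.2 hv
  have hu' : 0 < ‖u‖ := norm_pos_iff.2 hu
  refine ⟨C, max 1 ‖u‖ * ‖v‖ / q, hC0, by positivity, fun N ν => ?_⟩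
  rcases le_total ν N with hν | hν
  · refine ((hC N ν).1 hν).trans ?_
    rw [div_pow, mul_pow]
    have e1 : ‖u‖ ^ (N - ν) ≤ max 1 ‖u‖ ^ N :=
      (pow_le_pow_left₀ hu'.le (le_max_right _ _) _).trans
        (pow_le_pow_right₀ (le_max_left _ _) (Nat.sub_le _ _))
    have e2 : q ^ N.choose 2 / q ^ (N - ν + 1).choose 2 ≤ 1 / q ^ N := by
      rw [div_le_div_iff₀ (by positivity) (by positivity), one_mul, ← pow_add]
      refine pow_le_pow_of_le_one hq0.le hq1.le ?_
      calc (N - ν + 1).choose 2 ≤ (N + 1).choose 2 := Nat.choose_le_choose _ (by omega)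
        _ = N.choose 2 + N := by rw [Nat.choose_succ_succ' N 1, Nat.choose_one_right, add_comm]
    calc _ = C * (‖u‖ ^ (N - ν) * ‖v‖ ^ N * (q ^ N.choose 2 / q ^ (N - ν + 1).choose 2)) := by ring
      _ ≤ C * (max 1 ‖u‖ ^ N * ‖v‖ ^ N * (1 / q ^ N)) := by gcongr
      _ = _ := by ring
  · refine ((hC N ν).2 hν).trans ?_
    rw [div_pow, mul_pow]
    have e1 : 1 ≤ max 1 ‖u‖ ^ N := one_le_pow₀ (le_max_left _ _)
    have e2 : q ^ N.choose 2 ≤ 1 := pow_le_one₀ hq0.le hq1.le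
    have e3 : 1 ≤ 1 / q ^ N := by
      rw [le_div_iff₀ (by positivity), one_mul]; exact pow_le_one₀ hq0.le hq1.le
    calc _ ≤ C * (‖v‖ ^ N * 1) := by gcongr
      _ = C * (1 * ‖v‖ ^ N * 1) := by ring
      _ ≤ C * (max 1 ‖u‖ ^ N * ‖v‖ ^ N * (1 / q ^ N)) := by gcongr
      _ = _ := by ring

theorem choose_two_add (k l : ℕ) : (k + l).choose 2 = k.choose 2 + l.choose 2 + k * l := by
  induction l with
  | zero => simp
  | succ l ih =>
    rw [← add_assoc, Nat.choose_succ_succ' (k + l) 1, Nat.choose_one_right, ih,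
      Nat.choose_succ_succ' l 1, Nat.choose_one_right]
    ring

/-- When `u v = q` the quotient is uniformly bounded, and only `ν = 0` survives as `N → ∞`. -/
theorem qPoch_div_theta_uniform (hq0 : 0 < q) (hq1 : q < 1) {u v : ℂ} (hu : u ≠ 0) (hv : v ≠ 0)
    (h : ∀ l : ℤ, u ≠ (q : ℂ) ^ l) (huv : u * v = q) :
    (∃ C : ℝ, 0 < C ∧ ∀ N ν : ℕ,
      ‖qPoch q (u * (q : ℂ) ^ ν / (q : ℂ) ^ N)‖ * ‖(theta q (v * (q : ℂ) ^ N))⁻¹‖ ≤ C) ∧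
    ∀ ν : ℕ, Tendsto (fun N : ℕ => qPoch q (u * (q : ℂ) ^ ν / (q : ℂ) ^ N) *
      (theta q (v * (q : ℂ) ^ N))⁻¹) atTop (𝓝 (if ν = 0 then 1 else 0)) := by
  have hq : (q : ℂ) ≠ 0 := by exact_mod_cast hq0.ne'
  obtain ⟨C, hC0, hC⟩ := qPoch_div_theta_bound hq0 hq1 hu hv h
  have hv' : 0 < ‖v‖ := norm_pos_iff.2 hv
  have hu' : 0 < ‖u‖ := norm_pos_iff.2 hu
  have hv2 : ‖v‖ = ‖u‖⁻¹ * q := by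
    rw [← norm_ofReal_pos hq0, ← huv, norm_mul]; field_simp
  have hN2 : ∀ N : ℕ, ‖v‖ ^ N * q ^ N.choose 2 = ‖u‖⁻¹ ^ N * q ^ (N + 1).choose 2 := by
    intro N
    rw [hv2, mul_pow, Nat.choose_succ_succ' N 1, Nat.choose_one_right, pow_add]; ring
  have hle : ∀ N ν : ℕ, ν ≤ N →
      ‖u‖ ^ (N - ν) * ‖v‖ ^ N * q ^ N.choose 2 / q ^ (N - ν + 1).choose 2 =
        ‖u‖⁻¹ ^ ν * q ^ ((ν + 1).choose 2 + (N - ν) * ν) := by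
    intro N ν hν
    obtain ⟨d, rfl⟩ := Nat.exists_eq_add_of_le hν
    rw [Nat.add_sub_cancel_left, mul_assoc, hN2, show ν + d + 1 = d + 1 + ν by ring,
      choose_two_add (d + 1) ν, Nat.choose_succ_succ' ν 1, Nat.choose_one_right]
    field_simp
    rw [show (d + 1).choose 2 + ν.choose 2 + (d + 1) * ν =
      (d + 1).choose 2 + (ν + ν.choose 2 + d * ν) by ring, pow_add q ((d + 1).choose 2)]
    have e : ‖u‖ ^ d * (1 / ‖u‖) ^ d = 1 := by
      rw [← mul_pow, mul_one_div_cancel hu'.ne', one_pow]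
    simp only [Nat.reduceAdd]
    rw [pow_add (1 / ‖u‖)]
    linear_combination ((1 / ‖u‖) ^ ν * q ^ (d + 1).choose 2 *
      q ^ (ν + ν.choose 2 + d * ν)) * e
  refine ⟨?_, fun ν => ?_⟩
  · obtain ⟨D, hD⟩ := (Metric.isBounded_range_of_tendsto _
      (tendsto_pow_mul_gaussian hq0 hq1 ‖u‖⁻¹)).exists_norm_le
    have hD' : ∀ N, ‖u‖⁻¹ ^ N * q ^ (N + 1).choose 2 ≤ max D 1 := fun N =>
      (le_abs_self _).trans ((hD _ ⟨N, rfl⟩).trans (le_max_left _ _))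
    refine ⟨C * max D 1, by positivity, fun N ν => ?_⟩
    rcases le_total ν N with hν | hν
    · refine ((hC N ν).1 hν).trans ?_
      rw [hle N ν hν]
      gcongr
      refine le_trans ?_ (hD' ν)
      gcongr ?_ * ?_
      exact pow_le_pow_of_le_one hq0.le hq1.le (Nat.le_add_right _ _)
    · refine ((hC N ν).2 hν).trans ?_
      rw [hN2 N]
      gcongr
      exact hD' N
  · by_cases hν0 : ν = 0
    · rw [if_pos hν0, hν0]
      have h0 : Tendsto (fun N : ℕ => v * (q : ℂ) ^ N) atTop (𝓝 0) := by
        simpa using (tendsto_ofReal_pow hq0 hq1).const_mul v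
      have h1 := (tendsto_qPoch_one hq0 hq1 h0).inv₀ one_ne_zero
      rw [inv_one] at h1
      refine h1.congr fun N => ?_
      have e : (q : ℂ) / (v * (q : ℂ) ^ N) = u * (q : ℂ) ^ 0 / (q : ℂ) ^ N := by
        rw [← huv]; field_simp
      have hne : qPoch q (u * (q : ℂ) ^ 0 / (q : ℂ) ^ N) ≠ 0 := by
        refine qPoch_ne_zero_of_zpow hq0 hq1 fun l hl => h (l + N) ?_
        rw [zpow_add₀ hq, ← hl, zpow_natCast]; field_simp
      rw [theta, e, mul_inv]
      generalize qPoch q (u * (q : ℂ) ^ 0 / (q : ℂ) ^ N) = G at hne ⊢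
      field_simp
    · rw [if_neg hν0]
      have h1 : Tendsto (fun N : ℕ => C * ‖u‖⁻¹ ^ ν * q ^ (N - ν)) atTop (𝓝 0) := by
        simpa using ((tendsto_pow_atTop_nhds_zero_of_lt_one hq0.le hq1).comp
          (tendsto_sub_atTop_nat ν)).const_mul (C * ‖u‖⁻¹ ^ ν)
      refine squeeze_zero_norm' ?_ h1
      filter_upwards [eventually_ge_atTop ν] with N hν
      rw [norm_mul]
      refine ((hC N ν).1 hν).trans ?_
      rw [hle N ν hν, ← mul_assoc]
      gcongr ?_ * ?_
      refine pow_le_pow_of_le_one hq0.le hq1.le ?_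
      have : N - ν ≤ (N - ν) * ν := Nat.le_mul_of_pos_right _ (Nat.pos_of_ne_zero hν0)
      omega

/-! ### Bounds for the weights -/

theorem pairRatio_bounded (hq0 : 0 < q) (hq1 : q < 1) (t u : ℂ) :
    ∃ C : ℝ, 0 < C ∧ ∀ d : ℕ, ‖pairRatio q t (u * (q : ℂ) ^ d)‖ ≤ C := by
  obtain ⟨C₁, h10, h1⟩ := exists_qPoch_bound hq0 hq1 (q * t⁻¹ * u)
  obtain ⟨C₂, h20, h2⟩ := exists_qPoch_inv_bound hq0 hq1 (t * u)
  refine ⟨C₁ * C₂, by positivity, fun d => ?_⟩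
  rw [pairRatio, div_eq_mul_inv, norm_mul, ← mul_assoc, ← mul_assoc t]
  exact mul_le_mul (h1 d) (h2 d) (norm_nonneg _) h10.le

theorem pairWt_le (hq0 : 0 < q) (hq1 : q < 1) {x y u : ℂ} {C : ℝ} (hx : x ≠ 0)
    (hC : ∀ d : ℕ, ‖pairRatio q t (u * (q : ℂ) ^ d)‖ ≤ C) {a b d : ℕ}
    (h : y * (q : ℂ) ^ b = u * (q : ℂ) ^ d * (x * (q : ℂ) ^ a)) :
    ‖pairWt q t x y a b‖ * (‖x * (q : ℂ) ^ a‖ + ‖y * (q : ℂ) ^ b‖) ≤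
      C * (1 + ‖u‖) * (‖t‖ ^ 2) ^ a := by
  have hq : (q : ℂ) ≠ 0 := by exact_mod_cast hq0.ne'
  have e : y * (q : ℂ) ^ b / (x * (q : ℂ) ^ a) = u * (q : ℂ) ^ d := by
    rw [h]; field_simp
  have hx' : ‖x‖ ≠ 0 := norm_ne_zero_iff.2 hx
  have hC0 : 0 ≤ C := (norm_nonneg _).trans (hC 0)
  rw [pairWt, e, h]
  simp only [norm_mul, norm_pow, norm_inv, norm_div, norm_ofReal_pos hq0, div_pow]
  have h1 : q ^ d ≤ 1 := pow_le_one₀ hq0.le hq1.le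
  calc ‖x‖⁻¹ * ((‖t‖ ^ 2) ^ a / q ^ a) * ‖pairRatio q t (u * (q : ℂ) ^ d)‖ *
        (‖x‖ * q ^ a + ‖u‖ * q ^ d * (‖x‖ * q ^ a))
      = ‖pairRatio q t (u * (q : ℂ) ^ d)‖ * (1 + ‖u‖ * q ^ d) * (‖t‖ ^ 2) ^ a := by
        field_simp
    _ ≤ C * (1 + ‖u‖ * 1) * (‖t‖ ^ 2) ^ a := by
        gcongr
        exact hC d
    _ = _ := by rw [mul_one]

/-- The bound for a pair in one block. The common factor `c` makes it uniform in `a₁ q^N`. -/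
theorem pairWt_bound_same (hq0 : 0 < q) (hq1 : q < 1) (t : ℂ) {x : ℂ} (y : ℂ) (hx : x ≠ 0) :
    ∃ C : ℝ, 0 < C ∧ ∀ (c : ℂ), c ≠ 0 → ∀ a b : ℕ, a ≤ b →
      ‖pairWt q t (x * c) (y * c) a b‖ * (‖x * c * (q : ℂ) ^ a‖ + ‖y * c * (q : ℂ) ^ b‖) ≤
        C * max 1 (‖t‖ ^ 2) ^ min a b := by
  obtain ⟨C, hC0, hC⟩ := pairRatio_bounded hq0 hq1 t (y / x)
  refine ⟨C * (1 + ‖y / x‖), by positivity, fun c hc a b hab => ?_⟩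
  refine (pairWt_le hq0 hq1 (mul_ne_zero hx hc) hC (d := b - a) ?_).trans ?_
  · obtain ⟨d, rfl⟩ := Nat.exists_eq_add_of_le hab
    rw [Nat.add_sub_cancel_left, pow_add]
    field_simp
  · rw [min_eq_left hab]
    gcongr
    exact le_max_right _ _

/-- The bound for a pair in different blocks. The exponents are not ordered; if the second variable
is the larger one, then the pair is exchanged with `pairWt_swap`. -/
theorem pairWt_bound_cross (hq0 : 0 < q) (hq1 : q < 1) (ht : t ≠ 0) {x y : ℂ} (hx : x ≠ 0)
    (hy : y ≠ 0) (h1 : ∀ l : ℤ, t * (y / x) ≠ (q : ℂ) ^ l)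
    (h2 : ∀ l : ℤ, t * (x / y) ≠ (q : ℂ) ^ l) :
    ∃ C : ℝ, 0 < C ∧ ∀ N a b : ℕ,
      ‖pairWt q t (x * (q : ℂ) ^ N) y a b‖ *
        (‖x * (q : ℂ) ^ N * (q : ℂ) ^ a‖ + ‖y * (q : ℂ) ^ b‖) ≤
        C * max 1 (‖t‖ ^ 2)⁻¹ ^ N * max 1 (‖t‖ ^ 2) ^ min a b := by
  have hq : (q : ℂ) ≠ 0 := by exact_mod_cast hq0.ne'
  obtain ⟨C₁, h10, hC₁⟩ := pairRatio_bounded hq0 hq1 t (y / x)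
  obtain ⟨C₂, h20, hC₂⟩ := pairRatio_bounded hq0 hq1 t (x / y)
  set s := ‖t‖ ^ 2 with hs
  have hs0 : 0 < s := by positivity
  set D := ‖y / x‖ * ‖thetaRatio q t (y / x)‖ with hD
  refine ⟨C₁ * (1 + ‖y / x‖) + D * (C₂ * (1 + ‖x / y‖)), by positivity, fun N a b => ?_⟩
  have hR1 : 1 ≤ max 1 s⁻¹ ^ N := one_le_pow₀ (le_max_left _ _)
  have hxN : x * (q : ℂ) ^ N ≠ 0 := by positivity
  rcases le_total (a + N) b with hab | hab
  · have h3 := pairWt_le (t := t) hq0 hq1 hxN hC₁ (a := a) (b := b) (y := y) (d := b - (a + N)) (by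
      rw [pow_sub₀ _ hq hab, pow_add]; field_simp)
    refine h3.trans ?_
    rw [min_eq_left (by omega), ← hs]
    calc C₁ * (1 + ‖y / x‖) * s ^ a ≤ C₁ * (1 + ‖y / x‖) * 1 * max 1 s ^ a := by
          rw [mul_one]; gcongr; exact le_max_right _ _
      _ ≤ _ := by
          gcongr
          have : 0 ≤ D * (C₂ * (1 + ‖x / y‖)) := by positivity
          linarith
  · have e1 : y / (x * (q : ℂ) ^ N) * (q : ℂ) ^ N = y / x := by field_simp
    have hsw := pairWt_swap hq0 hq1 ht hxN hy (fun l hl => h1 (l + N) (by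
        rw [zpow_add₀ hq, ← hl, zpow_natCast]; field_simp)) (fun l hl => h2 (l - N) (by
        rw [zpow_sub₀ hq, ← hl, zpow_natCast]; field_simp)) a b
    have e2 := thetaRatio_mul_pow hq0 hq1 ht (u := y / (x * (q : ℂ) ^ N)) (by positivity) N
    rw [e1] at e2
    have h3 := pairWt_le (t := t) hq0 hq1 hy hC₂ (a := b) (b := a) (y := x * (q : ℂ) ^ N)
      (d := a + N - b) (by rw [pow_sub₀ _ hq hab, pow_add]; field_simp)
    have e3 : ‖y / (x * (q : ℂ) ^ N) * thetaRatio q t (y / (x * (q : ℂ) ^ N))‖ =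
        D * (s ^ N)⁻¹ := by
      have : thetaRatio q t (y / (x * (q : ℂ) ^ N)) =
          ((t ^ 2 / q) ^ N)⁻¹ * thetaRatio q t (y / x) := by
        rw [e2]; field_simp
      rw [this]
      simp only [hD, hs, norm_mul, norm_div, norm_inv, norm_pow, norm_ofReal_pos hq0, div_pow]
      field_simp
    rw [hsw, norm_mul, e3, add_comm ‖x * (q : ℂ) ^ N * (q : ℂ) ^ a‖, mul_assoc]
    have h4 : s ^ b * (s ^ N)⁻¹ ≤ max 1 s⁻¹ ^ N * max 1 s ^ min a b := by
      rcases le_total 1 s with h | h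
      · rw [max_eq_right h]
        have : s ^ b * (s ^ N)⁻¹ ≤ s ^ min a b := by
          rw [← div_eq_mul_inv, div_le_iff₀ (by positivity), ← pow_add]
          exact pow_le_pow_right₀ h (by omega)
        calc _ ≤ 1 * s ^ min a b := by rwa [one_mul]
          _ ≤ _ := by gcongr
      · rw [max_eq_left h, one_pow, mul_one, ← inv_pow]
        calc s ^ b * s⁻¹ ^ N ≤ 1 * s⁻¹ ^ N := by gcongr; exact pow_le_one₀ hs0.le h
          _ ≤ _ := by rw [one_mul]; gcongr; exact le_max_right _ _
    calc D * (s ^ N)⁻¹ * _ ≤ D * (s ^ N)⁻¹ * (C₂ * (1 + ‖x / y‖) * s ^ b) := by gcongr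
      _ = D * (C₂ * (1 + ‖x / y‖)) * (s ^ b * (s ^ N)⁻¹) := by ring
      _ ≤ D * (C₂ * (1 + ‖x / y‖)) * (max 1 s⁻¹ ^ N * max 1 s ^ min a b) := by gcongr
      _ = D * (C₂ * (1 + ‖x / y‖)) * max 1 s⁻¹ ^ N * max 1 s ^ min a b := by ring
      _ ≤ _ := by
          gcongr
          have : 0 ≤ C₁ * (1 + ‖y / x‖) := by positivity
          linarith

/-- The theta factor attached to the index `k` in the normalization of the `i`-th lattice. -/
noncomputable def thetaFac (q : ℝ) (t a₁ a₂ : ℂ) (i k : ℕ) : ℂ :=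
  if k < i then (theta q (a₂ * a₁⁻¹ * t ^ (-(k : ℤ))))⁻¹
  else (theta q (a₁ * a₂⁻¹ * t ^ ((i : ℤ) - ((k - i : ℕ) : ℤ))))⁻¹

theorem thetaCoef_eq_prod {i : ℕ} (hi : i ≤ n) :
    thetaCoef q t a₁ a₂ n i = ∏ k : Fin n, thetaFac q t a₁ a₂ i k := by
  obtain ⟨d, rfl⟩ := Nat.exists_eq_add_of_le hi
  rw [thetaCoef, Fin.prod_univ_add, Finset.prod_range, Nat.add_sub_cancel_left, Finset.prod_range]
  simp [thetaFac]

theorem zeta_shift_of_lt {i : ℕ} (N : ℕ) {k : Fin n} (hk : (k : ℕ) < i) :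
    zeta t (a₁ * (q : ℂ) ^ N) a₂ n i k = zeta t a₁ a₂ n i k * (q : ℂ) ^ N := by
  rw [zeta_of_lt hk, zeta_of_lt hk]; ring

theorem zeta_shift_of_ge {i : ℕ} (N : ℕ) {k : Fin n} (hk : i ≤ (k : ℕ)) :
    zeta t (a₁ * (q : ℂ) ^ N) a₂ n i k = zeta t a₁ a₂ n i k := by
  rw [zeta_of_ge hk, zeta_of_ge hk]

theorem pairWt_bound (h : Admissible n q t a₁ a₂ b₁ b₂) (i : ℕ) {k l : Fin n} (hkl : k < l) :
    ∃ C κ : ℝ, 0 < C ∧ 0 < κ ∧ (i = 0 → κ = 1) ∧ ∀ (N : ℕ) (ν : Fin n → ℕ), InFan i ν →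
      ‖pairWt q t (zeta t (a₁ * (q : ℂ) ^ N) a₂ n i k) (zeta t (a₁ * (q : ℂ) ^ N) a₂ n i l)
        (ν k) (ν l)‖ * (‖latPt q (zeta t (a₁ * (q : ℂ) ^ N) a₂ n i) ν k‖ +
          ‖latPt q (zeta t (a₁ * (q : ℂ) ^ N) a₂ n i) ν l‖) ≤
        C * κ ^ N * max 1 (‖t‖ ^ 2) ^ min (ν k) (ν l) := by
  have hkl' : (k : ℕ) < l := hkl
  have hx := zeta_ne_zero (n := n) h.t_ne h.a₁_ne h.a₂_ne i
  unfold latPt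
  by_cases hk : (k : ℕ) < i
  · by_cases hl : (l : ℕ) < i
    · obtain ⟨C, hC0, hC⟩ := pairWt_bound_same h.q_pos h.q_lt_one t (zeta t a₁ a₂ n i l) (hx k)
      refine ⟨C, 1, hC0, one_pos, fun _ => rfl, fun N ν hν => ?_⟩
      rw [zeta_shift_of_lt N hk, zeta_shift_of_lt N hl, one_pow, mul_one]
      exact hC _ (pow_ne_zero _ h.q_ne) _ _ (hν k l hkl (by omega))
    · have hne := zeta_cross_ne h hk (not_lt.1 hl)
      obtain ⟨C, hC0, hC⟩ := pairWt_bound_cross h.q_pos h.q_lt_one h.t_ne (hx k) (hx l)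
        (fun s => (hne s).1) (fun s => (hne s).2)
      refine ⟨C, max 1 (‖t‖ ^ 2)⁻¹, hC0, by positivity, fun h0 => by omega, fun N ν hν => ?_⟩
      rw [zeta_shift_of_lt N hk, zeta_shift_of_ge N (not_lt.1 hl)]
      exact hC _ _ _
  · obtain ⟨C, hC0, hC⟩ := pairWt_bound_same h.q_pos h.q_lt_one t (zeta t a₁ a₂ n i l) (hx k)
    refine ⟨C, 1, hC0, one_pos, fun _ => rfl, fun N ν hν => ?_⟩
    rw [zeta_shift_of_ge N (by omega), zeta_shift_of_ge N (by omega), one_pow, mul_one]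
    simpa using hC 1 one_ne_zero _ _ (hν k l hkl (by omega))

/-- The one-variable weight together with the theta factor of the same index. In the second block
the growth of `(q z / (a₁ q^N))_∞` is compensated by the theta function, and for `i = 0` completely
so, since there the product of the two arguments is `q`. -/
theorem siteWt_bound (h : Admissible n q t a₁ a₂ b₁ b₂) {i : ℕ} (k : Fin n) :
    ∃ C κ : ℝ, 0 < C ∧ 0 < κ ∧ (i = 0 → κ = 1) ∧ ∀ N ν : ℕ,
      ‖siteWt q (a₁ * (q : ℂ) ^ N) a₂ b₁ b₂
        (zeta t (a₁ * (q : ℂ) ^ N) a₂ n i k * (q : ℂ) ^ ν)‖ *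
        ‖thetaFac q t (a₁ * (q : ℂ) ^ N) a₂ i k‖ ≤
        C * κ ^ N * (if (k : ℕ) < i then ‖thetaFac q t (a₁ * (q : ℂ) ^ N) a₂ i k‖ else 1) := by
  have hq0 := h.q_pos
  have hq1 := h.q_lt_one
  have hq := h.q_ne
  have ht := h.t_ne
  have h1 := h.a₁_ne
  have h2 := h.a₂_ne
  by_cases hk : (k : ℕ) < i
  · set x := zeta t a₁ a₂ n i k with hx
    obtain ⟨C₁, h10, hC₁⟩ := exists_qPoch_bound hq0 hq1 (q * a₁⁻¹ * x)
    obtain ⟨C₂, h20, hC₂⟩ := exists_qPoch_bound hq0 hq1 (q * a₂⁻¹ * x)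
    obtain ⟨C₃, h30, hC₃⟩ := exists_qPoch_inv_bound hq0 hq1 (b₁ * x)
    obtain ⟨C₄, h40, hC₄⟩ := exists_qPoch_inv_bound hq0 hq1 (b₂ * x)
    refine ⟨C₁ * C₃ * (C₂ * C₄), 1, by positivity, one_pos, fun _ => rfl, fun N ν => ?_⟩
    rw [if_pos hk, zeta_shift_of_lt N hk, one_pow, mul_one, ← hx]
    gcongr
    rw [siteWt, div_eq_mul_inv, div_eq_mul_inv, norm_mul, norm_mul, norm_mul,
      show (q : ℂ) * (a₁ * (q : ℂ) ^ N)⁻¹ * (x * (q : ℂ) ^ N * (q : ℂ) ^ ν) =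
        q * a₁⁻¹ * x * (q : ℂ) ^ ν by field_simp,
      show (q : ℂ) * a₂⁻¹ * (x * (q : ℂ) ^ N * (q : ℂ) ^ ν) =
        q * a₂⁻¹ * x * (q : ℂ) ^ (N + ν) by ring,
      show b₁ * (x * (q : ℂ) ^ N * (q : ℂ) ^ ν) = b₁ * x * (q : ℂ) ^ (N + ν) by ring,
      show b₂ * (x * (q : ℂ) ^ N * (q : ℂ) ^ ν) = b₂ * x * (q : ℂ) ^ (N + ν) by ring]
    exact mul_le_mul (mul_le_mul (hC₁ _) (hC₃ _) (norm_nonneg _) h10.le)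
      (mul_le_mul (hC₂ _) (hC₄ _) (norm_nonneg _) h20.le) (by positivity) (by positivity)
  · -- The factor that grows with `N` is compensated by the theta function of the same index.
    have hk' : i ≤ (k : ℕ) := not_lt.1 hk
    have hkn := k.2
    set x := zeta t a₁ a₂ n i k with hx
    have hxk : x = a₂ * t ^ ((k : ℕ) - i) := zeta_of_ge hk'
    set u : ℂ := q * a₁⁻¹ * x with hu
    set v : ℂ := a₁ * a₂⁻¹ * t ^ ((i : ℤ) - ((k - i : ℕ) : ℤ)) with hv
    have hu0 : u ≠ 0 := by
      have : x ≠ 0 := zeta_ne_zero ht h1 h2 i k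
      positivity
    have hv0 : v ≠ 0 := by positivity
    have hul : ∀ l : ℤ, u ≠ (q : ℂ) ^ l := by
      intro l hl
      refine h.ratio_pole' ((k - i : ℕ) : ℤ) (by rw [abs_lt]; omega) (l - 1) ?_
      rw [zpow_sub₀ hq, ← hl, zpow_natCast, hu, hxk, zpow_one]
      field_simp
    obtain ⟨C, κ, hC0, hκ0, hκ, hC⟩ : ∃ C κ : ℝ, 0 < C ∧ 0 < κ ∧ (i = 0 → κ = 1) ∧ ∀ N ν : ℕ,
        ‖qPoch q (u * (q : ℂ) ^ ν / (q : ℂ) ^ N)‖ * ‖(theta q (v * (q : ℂ) ^ N))⁻¹‖ ≤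
          C * κ ^ N := by
      by_cases hi0 : i = 0
      · obtain ⟨C, hC0, hC⟩ := (qPoch_div_theta_uniform hq0 hq1 hu0 hv0 hul (by
          rw [hu, hv, hxk, hi0, Nat.cast_zero, zero_sub, zpow_neg, zpow_natCast]
          field_simp)).1
        exact ⟨C, 1, hC0, one_pos, fun _ => rfl, fun N ν => by simpa using hC N ν⟩
      · obtain ⟨C, κ, hC0, hκ0, hC⟩ := qPoch_div_theta_geometric hq0 hq1 hu0 hv0 hul
        exact ⟨C, κ, hC0, hκ0, fun h => absurd h hi0, hC⟩
    obtain ⟨C₂, h20, hC₂⟩ := exists_qPoch_bound hq0 hq1 (q * a₂⁻¹ * x)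
    obtain ⟨C₃, h30, hC₃⟩ := exists_qPoch_inv_bound hq0 hq1 (b₁ * x)
    obtain ⟨C₄, h40, hC₄⟩ := exists_qPoch_inv_bound hq0 hq1 (b₂ * x)
    refine ⟨C * C₃ * (C₂ * C₄), κ, by positivity, hκ0, hκ, fun N ν => ?_⟩
    rw [if_neg hk, zeta_shift_of_ge N hk', mul_one, ← hx, thetaFac, if_neg hk,
      show a₁ * (q : ℂ) ^ N * a₂⁻¹ * t ^ ((i : ℤ) - ((k - i : ℕ) : ℤ)) = v * (q : ℂ) ^ N by
        rw [hv]; ring]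
    rw [siteWt, div_eq_mul_inv, div_eq_mul_inv, norm_mul, norm_mul, norm_mul,
      show (q : ℂ) * (a₁ * (q : ℂ) ^ N)⁻¹ * (x * (q : ℂ) ^ ν) = u * (q : ℂ) ^ ν / (q : ℂ) ^ N by
        rw [hu]; field_simp,
      show (q : ℂ) * a₂⁻¹ * (x * (q : ℂ) ^ ν) = q * a₂⁻¹ * x * (q : ℂ) ^ ν by ring,
      show b₁ * (x * (q : ℂ) ^ ν) = b₁ * x * (q : ℂ) ^ ν by ring,
      show b₂ * (x * (q : ℂ) ^ ν) = b₂ * x * (q : ℂ) ^ ν by ring]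
    calc _ = (‖qPoch q (u * (q : ℂ) ^ ν / (q : ℂ) ^ N)‖ * ‖(theta q (v * (q : ℂ) ^ N))⁻¹‖) *
          ‖(qPoch q (b₁ * x * (q : ℂ) ^ ν))⁻¹‖ * (‖qPoch q (q * a₂⁻¹ * x * (q : ℂ) ^ ν)‖ *
          ‖(qPoch q (b₂ * x * (q : ℂ) ^ ν))⁻¹‖) := by ring
      _ ≤ (C * κ ^ N) * C₃ * (C₂ * C₄) :=
        mul_le_mul (mul_le_mul (hC _ _) (hC₃ _) (norm_nonneg _) (by positivity))
          (mul_le_mul (hC₂ _) (hC₄ _) (norm_nonneg _) h20.le) (by positivity) (by positivity)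
      _ = _ := by ring

/-- The majorant of the weights, `∏_k q^(ν_k) ∏_{k<l} R^(min (ν_k, ν_l))`. -/
noncomputable def gauge (q R : ℝ) {n : ℕ} (ν : Fin n → ℕ) : ℝ :=
  (∏ k, q ^ ν k) * ∏ k, ∏ l ∈ Finset.Ioi k, R ^ min (ν k) (ν l)

/-- Bounds of the form `C κ^N g` are stable under finite products. -/
theorem prod_exists_bound {ι : Type*} (s : Finset ι) {P : Prop} {β : Type*} (f : ι → ℕ → β → ℝ)
    (good : β → Prop) (g : ι → ℕ → β → ℝ) (hf : ∀ k ∈ s, ∀ N b, 0 ≤ f k N b)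
    (h : ∀ k ∈ s, ∃ C κ : ℝ, 0 < C ∧ 0 < κ ∧ (P → κ = 1) ∧ ∀ N b, good b →
      f k N b ≤ C * κ ^ N * g k N b) :
    ∃ C κ : ℝ, 0 < C ∧ 0 < κ ∧ (P → κ = 1) ∧ ∀ N b, good b →
      ∏ k ∈ s, f k N b ≤ C * κ ^ N * ∏ k ∈ s, g k N b := by
  classical
  induction s using Finset.induction_on with
  | empty => exact ⟨1, 1, one_pos, one_pos, fun _ => rfl, fun N b _ => by simp⟩
  | insert a s ha ih =>
    obtain ⟨C₁, κ₁, h1, h2, h3, h4⟩ := ih (fun k hk => hf k (Finset.mem_insert_of_mem hk))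
      (fun k hk => h k (Finset.mem_insert_of_mem hk))
    obtain ⟨C₂, κ₂, h5, h6, h7, h8⟩ := h a (Finset.mem_insert_self _ _)
    refine ⟨C₂ * C₁, κ₂ * κ₁, by positivity, by positivity,
      fun hP => by rw [h3 hP, h7 hP, one_mul], fun N b hb => ?_⟩
    rw [Finset.prod_insert ha, Finset.prod_insert ha, mul_pow]
    have h9 := hf a (Finset.mem_insert_self _ _) N b
    have h10 := Finset.prod_nonneg fun k hk => hf k (Finset.mem_insert_of_mem hk) N b
    calc _ ≤ (C₂ * κ₂ ^ N * g a N b) * (C₁ * κ₁ ^ N * ∏ k ∈ s, g k N b) :=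
          mul_le_mul (h8 N b hb) (h4 N b hb) h10 (h9.trans (h8 N b hb))
      _ = _ := by ring

/-- The weights times the products `∏ (|z_k| + |z_l|)`, uniformly along `a₁ q^N`. For `i = 0` the
bound does not depend on `N`; for `i > 0` it contains theta factors that tend to zero faster than
any geometric progression. -/
theorem wt_bound (h : Admissible n q t a₁ a₂ b₁ b₂) {i : ℕ} (hi : i ≤ n) :
    ∃ C κ : ℝ, 0 < C ∧ 0 < κ ∧ (i = 0 → κ = 1) ∧ ∀ (N : ℕ) (ν : Fin n → ℕ),
      ‖wt q t (a₁ * (q : ℂ) ^ N) a₂ b₁ b₂ i ν‖ * ∏ k, ∏ l ∈ Finset.Ioi k,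
        (‖latPt q (zeta t (a₁ * (q : ℂ) ^ N) a₂ n i) ν k‖ +
          ‖latPt q (zeta t (a₁ * (q : ℂ) ^ N) a₂ n i) ν l‖) ≤
      C * κ ^ N * (∏ k : Fin n, if (k : ℕ) < i then ‖thetaFac q t (a₁ * (q : ℂ) ^ N) a₂ i k‖
        else 1) * gauge q (max 1 (‖t‖ ^ 2)) ν := by
  have hq0 := h.q_pos
  obtain ⟨C₁, κ₁, h10, k10, hk1, hC₁⟩ := prod_exists_bound (P := i = 0) Finset.univ
    (fun (k : Fin n) (N : ℕ) (ν : Fin n → ℕ) => q ^ ν k * (‖siteWt q (a₁ * (q : ℂ) ^ N) a₂ b₁ b₂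
        (zeta t (a₁ * (q : ℂ) ^ N) a₂ n i k * (q : ℂ) ^ ν k)‖ *
        ‖thetaFac q t (a₁ * (q : ℂ) ^ N) a₂ i k‖)) (fun _ => True)
    (fun k N ν => q ^ ν k * (if (k : ℕ) < i then ‖thetaFac q t (a₁ * (q : ℂ) ^ N) a₂ i k‖ else 1))
    (fun k _ N ν => by positivity) (fun k _ => by
      obtain ⟨C, κ, hC0, hκ0, hκ, hC⟩ := siteWt_bound h (i := i) k
      refine ⟨C, κ, hC0, hκ0, hκ, fun N ν _ => ?_⟩
      refine (mul_le_mul_of_nonneg_left (hC N (ν k)) (pow_nonneg hq0.le (ν k))).trans (le_of_eq ?_)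
      ring)
  obtain ⟨C₂, κ₂, h20, k20, hk2, hC₂⟩ := prod_exists_bound (P := i = 0) Finset.univ
    (fun (k : Fin n) (N : ℕ) (ν : Fin n → ℕ) => ∏ l ∈ Finset.Ioi k,
      (‖pairWt q t (zeta t (a₁ * (q : ℂ) ^ N) a₂ n i k) (zeta t (a₁ * (q : ℂ) ^ N) a₂ n i l)
        (ν k) (ν l)‖ * (‖latPt q (zeta t (a₁ * (q : ℂ) ^ N) a₂ n i) ν k‖ +
          ‖latPt q (zeta t (a₁ * (q : ℂ) ^ N) a₂ n i) ν l‖))) (fun ν => InFan i ν)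
    (fun k N ν => ∏ l ∈ Finset.Ioi k, max 1 (‖t‖ ^ 2) ^ min (ν k) (ν l))
    (fun k _ N ν => Finset.prod_nonneg fun l _ => by positivity) (fun k _ =>
      prod_exists_bound _ _ _ (fun l N (ν : Fin n → ℕ) => max 1 (‖t‖ ^ 2) ^ min (ν k) (ν l))
        (fun l _ N ν => by positivity) fun l hl =>
        pairWt_bound h i (Finset.mem_Ioi.1 hl))
  refine ⟨C₁ * C₂, κ₁ * κ₂, by positivity, by positivity,
    fun h0 => by rw [hk1 h0, hk2 h0, one_mul], fun N ν => ?_⟩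
  have hg : 0 ≤ gauge q (max 1 (‖t‖ ^ 2)) ν := by unfold gauge; positivity
  by_cases hf : InFan i ν
  swap
  · rw [wt, if_neg hf, norm_zero, zero_mul]
    refine mul_nonneg (mul_nonneg (by positivity) (Finset.prod_nonneg fun k _ => ?_)) hg
    split_ifs <;> positivity
  have e1 := hC₁ N ν trivial
  have e2 := hC₂ N ν hf
  rw [Finset.prod_mul_distrib, Finset.prod_mul_distrib, Finset.prod_mul_distrib] at e1
  simp only [Finset.prod_mul_distrib] at e2
  rw [wt, if_pos hf, thetaCoef_eq_prod hi, rawWt, gauge, mul_pow]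
  simp only [norm_mul, norm_prod, norm_pow, norm_ofReal_pos hq0, Finset.prod_mul_distrib]
  have e3 := mul_le_mul e1 e2 (by positivity) (e1.trans' (by positivity))
  refine (le_of_eq ?_).trans (e3.trans (le_of_eq ?_)) <;> ring

/-! ### Summability and the total functional -/

theorem summable_prod_pow {ρ : ℝ} (h0 : 0 ≤ ρ) (h1 : ρ < 1) (n : ℕ) :
    Summable fun ν : Fin n → ℕ => ∏ k, ρ ^ ν k := by
  induction n with
  | zero => exact (hasSum_fintype _).summable
  | succ n ih =>
    have h := (summable_geometric_of_lt_one h0 h1).mul_of_nonneg ih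
      (fun _ => pow_nonneg h0 _) (fun ν => Finset.prod_nonneg fun k _ => pow_nonneg h0 _)
    rw [← (Fin.consEquiv fun _ : Fin (n + 1) => ℕ).summable_iff]
    refine h.congr fun x => ?_
    simp [Fin.consEquiv, Fin.prod_univ_succ]

/-- The pairs that contain the running coordinate are charged to the other coordinate, so that the
bound decays like `q^M` in the running coordinate. -/
theorem gauge_insertNth_le {R : ℝ} (hq0 : 0 < q) (hR : 1 ≤ R) {m : ℕ} (r : Fin (m + 1)) (M : ℕ)
    (ν : Fin m → ℕ) :
    gauge q R (r.insertNth M ν : Fin (m + 1) → ℕ) ≤ q ^ M * ∏ k, (q * R ^ m) ^ ν k := by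
  have hR0 : 0 ≤ R := zero_le_one.trans hR
  unfold gauge
  rw [Fin.prod_univ_succAbove _ r,
    prod_Ioi_succAbove_symm _ (fun i j => by rw [min_comm]) r]
  simp only [Fin.insertNth_apply_same, Fin.insertNth_apply_succAbove]
  rw [mul_assoc]
  refine mul_le_mul_of_nonneg_left ?_ (by positivity)
  rw [← Finset.prod_mul_distrib, ← Finset.prod_mul_distrib]
  refine Finset.prod_le_prod (fun k _ => by positivity) fun k _ => ?_
  rw [mul_pow]
  refine mul_le_mul_of_nonneg_left ?_ (by positivity)
  -- The coordinate `k` is charged with the pair `(r, k)` and with the pairs `(k, l)`, `k < l`.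
  calc R ^ min M (ν k) * ∏ l ∈ Finset.Ioi k, R ^ min (ν k) (ν l)
      ≤ R ^ ν k * ∏ l ∈ Finset.Ioi k, R ^ ν k := by
        gcongr <;> first | exact hR | exact min_le_right _ _ | exact min_le_left _ _
    _ = (R ^ ν k) ^ (m - k) := by
        rw [Finset.prod_const, Fin.card_Ioi, ← pow_succ']
        congr 1; omega
    _ ≤ (R ^ ν k) ^ m := pow_le_pow_right₀ (one_le_pow₀ hR) (Nat.sub_le _ _)
    _ = (R ^ m) ^ ν k := by rw [← pow_mul, ← pow_mul, mul_comm]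

theorem gauge_le {R : ℝ} (hq0 : 0 < q) (hR : 1 ≤ R) (ν : Fin n → ℕ) :
    gauge q R ν ≤ ∏ k, (q * R ^ (n - 1)) ^ ν k := by
  rcases n with _ | m
  · simp [gauge]
  · have h := gauge_insertNth_le (q := q) hq0 hR 0 (ν 0) (fun j => ν (Fin.succAbove 0 j))
    have e : (Fin.insertNth 0 (ν 0) (fun j => ν (Fin.succAbove 0 j)) : Fin (m + 1) → ℕ) = ν :=
      Fin.insertNth_self_removeNth 0 ν
    rw [e] at h
    refine h.trans ?_
    rw [Fin.prod_univ_succAbove _ 0, Nat.add_sub_cancel]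
    gcongr
    · exact le_mul_of_one_le_right hq0.le (one_le_pow₀ hR)

theorem Admissible.rate_nonneg (h : Admissible n q t a₁ a₂ b₁ b₂) :
    0 ≤ q * max 1 (‖t‖ ^ 2) ^ (n - 1) := by
  have := h.q_pos
  positivity

theorem wt_bound_zero (h : Admissible n q t a₁ a₂ b₁ b₂) {i : ℕ} (hi : i ≤ n) :
    ∃ C : ℝ, 0 < C ∧ ∀ ν : Fin n → ℕ,
      ‖wt q t a₁ a₂ b₁ b₂ i ν‖ * ∏ k, ∏ l ∈ Finset.Ioi k,
        (‖latPt q (zeta t a₁ a₂ n i) ν k‖ + ‖latPt q (zeta t a₁ a₂ n i) ν l‖) ≤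
      C * gauge q (max 1 (‖t‖ ^ 2)) ν := by
  obtain ⟨C, κ, hC0, hκ0, -, hC⟩ := wt_bound h hi
  have hnn : 0 ≤ ∏ k : Fin n, if (k : ℕ) < i then ‖thetaFac q t a₁ a₂ i k‖ else 1 :=
    Finset.prod_nonneg fun k _ => by split_ifs <;> positivity
  refine ⟨C * (∏ k : Fin n, if (k : ℕ) < i then ‖thetaFac q t a₁ a₂ i k‖ else 1) + 1,
    by positivity, fun ν => ?_⟩
  have h0 := hC 0 ν
  simp only [pow_zero, mul_one] at h0
  refine h0.trans ?_
  have hq0 := h.q_pos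
  have : 0 ≤ gauge q (max 1 (‖t‖ ^ 2)) ν := by unfold gauge; positivity
  rw [add_mul, one_mul]
  linarith

theorem norm_Delta_le (z : Fin n → ℂ) :
    ‖Delta z‖ ≤ ∏ k, ∏ l ∈ Finset.Ioi k, (‖z k‖ + ‖z l‖) := by
  simp only [Delta, norm_prod]
  exact Finset.prod_le_prod (fun k _ => Finset.prod_nonneg fun l _ => norm_nonneg _) fun k _ =>
    Finset.prod_le_prod (fun l _ => norm_nonneg _) fun l _ => norm_sub_le _ _

theorem norm_latPt_le (hq0 : 0 < q) (hq1 : q < 1) (x : Fin n → ℂ) (ν : Fin n → ℕ) (k : Fin n) :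
    ‖latPt q x ν k‖ ≤ ‖x k‖ := by
  rw [latPt, norm_mul, norm_pow, norm_ofReal_pos hq0]
  exact mul_le_of_le_one_right (norm_nonneg _) (pow_le_one₀ hq0.le hq1.le)

theorem summable_norm_wt_mul (h : Admissible n q t a₁ a₂ b₁ b₂) {i : ℕ} (hi : i ≤ n)
    (g : (Fin n → ℂ) → ℂ) (hg : Continuous g) :
    Summable fun ν : Fin n → ℕ => ‖wt q t a₁ a₂ b₁ b₂ i ν *
      Delta (latPt q (zeta t a₁ a₂ n i) ν) * g (latPt q (zeta t a₁ a₂ n i) ν)‖ := by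
  obtain ⟨C, hC0, hC⟩ := wt_bound_zero h hi
  obtain ⟨D, hD⟩ := (isCompact_univ_pi fun k : Fin n =>
    isCompact_closedBall (0 : ℂ) ‖zeta t a₁ a₂ n i k‖).exists_bound_of_continuousOn hg.continuousOn
  have hD' : ∀ ν, ‖g (latPt q (zeta t a₁ a₂ n i) ν)‖ ≤ max D 0 := fun ν =>
    (hD _ (by
      rw [Set.mem_univ_pi]
      intro k
      rw [mem_closedBall_zero_iff]
      exact norm_latPt_le h.q_pos h.q_lt_one _ _ _)).trans (le_max_left _ _)
  refine Summable.of_nonneg_of_le (fun _ => norm_nonneg _) (fun ν => ?_)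
    (((summable_prod_pow h.rate_nonneg h.conv n).mul_left C).mul_right (max D 0))
  rw [norm_mul, norm_mul]
  refine mul_le_mul ?_ (hD' ν) (norm_nonneg _) ?_
  · refine (mul_le_mul_of_nonneg_left (norm_Delta_le _) (norm_nonneg _)).trans ((hC ν).trans ?_)
    exact mul_le_mul_of_nonneg_left (gauge_le h.q_pos (le_max_left _ _) ν) hC0.le
  · exact mul_nonneg hC0.le (Finset.prod_nonneg fun k _ => pow_nonneg h.rate_nonneg _)

/-- The sum of `g` over all lattices against the weights and the difference product. It is called
the mean of `g` below, although it is not normalized. -/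
noncomputable def total (q : ℝ) (t a₁ a₂ b₁ b₂ : ℂ) (n : ℕ) (g : (Fin n → ℂ) → ℂ) : ℂ :=
  ∑ i ∈ Finset.range (n + 1), ∑' ν : Fin n → ℕ, wt q t a₁ a₂ b₁ b₂ i ν *
    Delta (latPt q (zeta t a₁ a₂ n i) ν) * g (latPt q (zeta t a₁ a₂ n i) ν)

theorem total_sum (h : Admissible n q t a₁ a₂ b₁ b₂) {ι : Type*} (s : Finset ι) (c : ι → ℂ)
    (g : ι → (Fin n → ℂ) → ℂ) (hg : ∀ k ∈ s, Continuous (g k)) :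
    total q t a₁ a₂ b₁ b₂ n (fun z => ∑ k ∈ s, c k * g k z) =
      ∑ k ∈ s, c k * total q t a₁ a₂ b₁ b₂ n (g k) := by
  unfold total
  simp only [Finset.mul_sum]
  rw [Finset.sum_comm]
  refine Finset.sum_congr rfl fun i hi => ?_
  have hi' : i ≤ n := Nat.lt_succ_iff.1 (Finset.mem_range.1 hi)
  have hs : ∀ k ∈ s, Summable fun ν : Fin n → ℕ => wt q t a₁ a₂ b₁ b₂ i ν *
      Delta (latPt q (zeta t a₁ a₂ n i) ν) * (c k * g k (latPt q (zeta t a₁ a₂ n i) ν)) :=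
    fun k hk => (((summable_norm_wt_mul h hi' (g k) (hg k hk)).of_norm).mul_left (c k)).congr
      fun ν => by ring
  rw [Summable.tsum_finsetSum hs]
  refine Finset.sum_congr rfl fun k _ => ?_
  rw [← tsum_mul_left]
  exact tsum_congr fun ν => by ring

/-! ### The difference relations for the total functional -/

/-- The cofactor of `bdry` in the antisymmetrized difference relations: the difference product of the
variables other than `z_r`, times `∏ (y - z_j)` over these. -/
noncomputable def cofactor (q : ℝ) (t a₁ a₂ y : ℂ) {m : ℕ} (i : ℕ) (r : Fin (m + 1))
    (ν : Fin m → ℕ) : ℂ :=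
  Delta (fun j => zeta t a₁ a₂ (m + 1) i (r.succAbove j) * (q : ℂ) ^ ν j) *
    ∏ j, (y - zeta t a₁ a₂ (m + 1) i (r.succAbove j) * (q : ℂ) ^ ν j)

theorem cofactor_bdry_bound_aux {V P₁ W A P₂ K L D₁ D₂ D₃ C Γ x Q : ℝ} (hQ : 0 < Q)
    (hP₁ : 0 ≤ P₁) (hW : 0 ≤ W) (hA : 0 ≤ A) (hP₂ : 0 ≤ P₂) (hx : 0 ≤ x)
    (hL : 0 ≤ L) (hD₃ : 0 ≤ D₃) (h4 : V ≤ L) (h1 : P₁ ≤ D₁) (h2 : A ≤ D₂)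
    (h3 : P₂ ≤ D₃ * K) (h8 : W * (K * L) ≤ C * (Q * Γ)) :
    V * P₁ * (W * (x * Q⁻¹ * (A * P₂))) ≤ C * x * D₁ * D₂ * D₃ * Γ := by
  have hD₁ : 0 ≤ D₁ := hP₁.trans h1
  have hD₂ : 0 ≤ D₂ := hA.trans h2
  have hQ' : 0 ≤ x * Q⁻¹ := mul_nonneg hx (inv_nonneg.2 hQ.le)
  have e1 : V * P₁ ≤ L * D₁ := mul_le_mul h4 h1 hP₁ hL
  have e2 : A * P₂ ≤ D₂ * (D₃ * K) := mul_le_mul h2 h3 hP₂ hD₂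
  calc V * P₁ * (W * (x * Q⁻¹ * (A * P₂)))
      ≤ L * D₁ * (W * (x * Q⁻¹ * (D₂ * (D₃ * K)))) :=
        mul_le_mul e1 (mul_le_mul_of_nonneg_left (mul_le_mul_of_nonneg_left e2 hQ') hW)
          (mul_nonneg hW (mul_nonneg hQ' (mul_nonneg hA hP₂))) (mul_nonneg hL hD₁)
    _ = x * Q⁻¹ * (D₁ * (D₂ * D₃)) * (W * (K * L)) := by ring
    _ ≤ x * Q⁻¹ * (D₁ * (D₂ * D₃)) * (C * (Q * Γ)) :=
        mul_le_mul_of_nonneg_left h8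
          (mul_nonneg hQ' (mul_nonneg hD₁ (mul_nonneg hD₂ hD₃)))
    _ = C * x * D₁ * D₂ * D₃ * Γ * (Q⁻¹ * Q) := by ring
    _ = C * x * D₁ * D₂ * D₃ * Γ := by rw [inv_mul_cancel₀ hQ.ne', mul_one]

/-- The bound is uniform in the running coordinate `M`: the factor `z_r⁻¹` of `bdry` grows like
`q^(-M)` and is compensated by the weight. -/
theorem cofactor_bdry_bound {m : ℕ} (h : Admissible (m + 1) q t a₁ a₂ b₁ b₂) (y : ℂ) {i : ℕ}
    (hi : i ≤ m + 1) (r : Fin (m + 1)) :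
    ∃ C : ℝ, ∀ (M : ℕ) (ν : Fin m → ℕ),
      ‖cofactor q t a₁ a₂ y i r ν * bdry q t a₁ a₂ b₁ b₂ i r M ν‖ ≤
        C * ∏ k, (q * max 1 (‖t‖ ^ 2) ^ m) ^ ν k := by
  have hq0 := h.q_pos
  have hq1 := h.q_lt_one
  obtain ⟨C, hC0, hC⟩ := wt_bound_zero h hi
  set x := zeta t a₁ a₂ (m + 1) i with hx
  have hxr : x r ≠ 0 := zeta_ne_zero h.t_ne h.a₁_ne h.a₂_ne i r
  set D₁ := ∏ j : Fin m, (‖y‖ + ‖x (r.succAbove j)‖) with hD₁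
  set D₂ := (1 + ‖a₁⁻¹‖ * ‖x r‖) * (1 + ‖a₂⁻¹‖ * ‖x r‖) with hD₂
  set D₃ := (1 + ‖t‖) ^ m with hD₃
  refine ⟨C * ‖x r‖⁻¹ * D₁ * D₂ * D₃, fun M ν => ?_⟩
  have hpow : ∀ (k : Fin (m + 1)) (N : ℕ), ‖x k * (q : ℂ) ^ N‖ ≤ ‖x k‖ := fun k N => by
    rw [norm_mul, norm_pow, norm_ofReal_pos hq0]
    exact mul_le_of_le_one_right (norm_nonneg _) (pow_le_one₀ hq0.le hq1.le)
  have h1 : ‖∏ j, (y - x (r.succAbove j) * (q : ℂ) ^ ν j)‖ ≤ D₁ := by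
    rw [norm_prod]
    exact Finset.prod_le_prod (fun _ _ => norm_nonneg _) fun j _ =>
      (norm_sub_le _ _).trans (by gcongr; exact hpow _ _)
  have h2 : ‖(1 - a₁⁻¹ * (x r * (q : ℂ) ^ M)) * (1 - a₂⁻¹ * (x r * (q : ℂ) ^ M))‖ ≤ D₂ := by
    have h0 : ∀ a : ℂ, ‖1 - a * (x r * (q : ℂ) ^ M)‖ ≤ 1 + ‖a‖ * ‖x r‖ := fun a => by
      refine (norm_sub_le _ _).trans ?_
      rw [norm_one, norm_mul]
      exact add_le_add_right (mul_le_mul_of_nonneg_left (hpow _ _) (norm_nonneg _)) _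
    rw [norm_mul]
    exact mul_le_mul (h0 _) (h0 _) (norm_nonneg _) (by positivity)
  have h3 : ‖∏ j, (x r * (q : ℂ) ^ M - t * (x (r.succAbove j) * (q : ℂ) ^ ν j))‖ ≤
      D₃ * ∏ j, (‖x r * (q : ℂ) ^ M‖ + ‖x (r.succAbove j) * (q : ℂ) ^ ν j‖) := by
    rw [norm_prod]
    calc _ ≤ ∏ j, ((1 + ‖t‖) * (‖x r * (q : ℂ) ^ M‖ + ‖x (r.succAbove j) * (q : ℂ) ^ ν j‖)) := by
          refine Finset.prod_le_prod (fun _ _ => norm_nonneg _) fun j _ =>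
            (norm_sub_le _ _).trans ?_
          rw [norm_mul t]
          nlinarith [norm_nonneg t, norm_nonneg (x r * (q : ℂ) ^ M),
            norm_nonneg (x (r.succAbove j) * (q : ℂ) ^ ν j)]
      _ = _ := by rw [Finset.prod_mul_distrib, Finset.prod_const, Finset.card_univ,
            Fintype.card_fin]
  have h4 := norm_Delta_le (fun j => x (r.succAbove j) * (q : ℂ) ^ ν j)
  have h5 := hC (r.insertNth M ν)
  rw [prod_Ioi_succAbove_symm _ (fun a b => add_comm _ _) r] at h5
  simp only [latPt, Fin.insertNth_apply_same, Fin.insertNth_apply_succAbove] at h5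
  have h6 := gauge_insertNth_le (q := q) hq0 (le_max_left 1 (‖t‖ ^ 2)) r M ν
  have h7 : ‖(x r * (q : ℂ) ^ M)⁻¹‖ = ‖x r‖⁻¹ * (q ^ M)⁻¹ := by
    rw [norm_inv, norm_mul, norm_pow, norm_ofReal_pos hq0, mul_inv]
  unfold cofactor bdry
  rw [← hx]
  set V := Delta (fun j => x (r.succAbove j) * (q : ℂ) ^ ν j)
  set W := wt q t a₁ a₂ b₁ b₂ i (r.insertNth M ν : Fin (m + 1) → ℕ)
  set P₁ := ∏ j, (y - x (r.succAbove j) * (q : ℂ) ^ ν j)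
  set A := (1 - a₁⁻¹ * (x r * (q : ℂ) ^ M)) * (1 - a₂⁻¹ * (x r * (q : ℂ) ^ M))
  set P₂ := ∏ j, (x r * (q : ℂ) ^ M - t * (x (r.succAbove j) * (q : ℂ) ^ ν j))
  set K := ∏ j, (‖x r * (q : ℂ) ^ M‖ + ‖x (r.succAbove j) * (q : ℂ) ^ ν j‖)
  set L := ∏ k : Fin m, ∏ l ∈ Finset.Ioi k,
    (‖x (r.succAbove k) * (q : ℂ) ^ ν k‖ + ‖x (r.succAbove l) * (q : ℂ) ^ ν l‖)
  set Γ := ∏ k, (q * max 1 (‖t‖ ^ 2) ^ m) ^ ν k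
  have hL : 0 ≤ L := Finset.prod_nonneg fun _ _ => Finset.prod_nonneg fun _ _ => by positivity
  have hD3 : 0 ≤ D₃ := by positivity
  have h8 : ‖W‖ * (K * L) ≤ C * (q ^ M * Γ) :=
    h5.trans (mul_le_mul_of_nonneg_left h6 hC0.le)
  rw [norm_mul, norm_mul V, norm_mul W, norm_mul (x r * (q : ℂ) ^ M)⁻¹, h7, norm_mul A]
  exact cofactor_bdry_bound_aux (pow_pos hq0 M) (norm_nonneg _) (norm_nonneg _) (norm_nonneg _)
    (norm_nonneg _) (inv_nonneg.2 (norm_nonneg _)) hL hD3 h4 h1 h2 h3 h8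

/-- The `t`-difference operator applied to `∏ (z_j - y)`, as a sum of differences in the single
variables. -/
theorem wt_mul_Delta_mul_diffOp {m : ℕ} (h : Admissible (m + 1) q t a₁ a₂ b₁ b₂) (y : ℂ) (i : ℕ)
    (ν : Fin (m + 1) → ℕ) :
    wt q t a₁ a₂ b₁ b₂ i ν * Delta (latPt q (zeta t a₁ a₂ (m + 1) i) ν) *
        diffOp m t a₁ a₂ b₁ b₂
          (fun w => ∏ j, (latPt q (zeta t a₁ a₂ (m + 1) i) ν j - w)) y =
      y ^ 2 * ((1 - t) * (-1) ^ (m + 1)) * ∑ r : Fin (m + 1), (-1) ^ (r : ℕ) *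
        (cofactor q t a₁ a₂ y i r (r.removeNth ν) *
          (bdry q t a₁ a₂ b₁ b₂ i r (ν r) (r.removeNth ν) -
            bdry q t a₁ a₂ b₁ b₂ i r (ν r + 1) (r.removeNth ν))) := by
  have hz : ∀ r, latPt q (zeta t a₁ a₂ (m + 1) i) ν r ≠ 0 := fun r =>
    mul_ne_zero (zeta_ne_zero h.t_ne h.a₁_ne h.a₂_ne i r) (pow_ne_zero _ h.q_ne)
  have hrel := sum_relations h.t_ne (-(a₁⁻¹ + a₂⁻¹)) (a₁⁻¹ * a₂⁻¹) (-(b₁ + b₂)) (b₁ * b₂) y _ hz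
  rw [mul_assoc]
  unfold diffOp
  rw [← hrel, mul_left_comm, mul_assoc (y ^ 2), mul_left_comm _ ((1 - t) * (-1) ^ (m + 1)),
    Finset.mul_sum]
  congr 2
  refine Finset.sum_congr rfl fun r _ => ?_
  rw [bdry_succ h]
  unfold bdry cofactor
  rw [Fin.insertNth_self_removeNth]
  simp only [latPt, Fin.removeNth]
  ring

theorem sum_piFinset_range_insertNth {m : ℕ} (M : ℕ) (r : Fin (m + 1))
    (f : (Fin (m + 1) → ℕ) → ℂ) :
    ∑ ν ∈ Fintype.piFinset fun _ => Finset.range M, f ν =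
      ∑ ν ∈ Fintype.piFinset fun _ : Fin m => Finset.range M, ∑ k ∈ Finset.range M,
        f (r.insertNth k ν) := by
  rw [Finset.sum_sigma']
  refine Finset.sum_nbij' (fun ν => ⟨r.removeNth ν, ν r⟩) (fun x => r.insertNth x.2 x.1)
    ?_ ?_ ?_ ?_ ?_
  · intro ν hν
    simp only [Fintype.mem_piFinset] at hν
    simp only [Finset.mem_sigma, Fintype.mem_piFinset]
    exact ⟨fun j => hν _, hν r⟩
  · rintro ⟨ν, k⟩ hν
    simp only [Finset.mem_sigma, Fintype.mem_piFinset] at hν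
    rw [Fintype.mem_piFinset, Fin.forall_iff_succAbove r]
    simpa using ⟨Finset.mem_range.1 hν.2, fun j => Finset.mem_range.1 (hν.1 j)⟩
  · intro ν _
    exact Fin.insertNth_self_removeNth r ν
  · rintro ⟨ν, k⟩ _
    simp
  · intro ν _
    simp only [Fin.insertNth_self_removeNth]

/-- Summation of the difference relations over a cube leaves only boundary terms. -/
theorem sum_cube_wt_mul_Delta_mul_diffOp {m : ℕ} (h : Admissible (m + 1) q t a₁ a₂ b₁ b₂) (y : ℂ)
    (i M : ℕ) :
    ∑ ν ∈ Fintype.piFinset fun _ => Finset.range M,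
      wt q t a₁ a₂ b₁ b₂ i ν * Delta (latPt q (zeta t a₁ a₂ (m + 1) i) ν) *
        diffOp m t a₁ a₂ b₁ b₂
          (fun w => ∏ j, (latPt q (zeta t a₁ a₂ (m + 1) i) ν j - w)) y =
      -(y ^ 2 * ((1 - t) * (-1) ^ (m + 1))) * ∑ r : Fin (m + 1), (-1) ^ (r : ℕ) *
        ∑ ν ∈ Fintype.piFinset fun _ => Finset.range M,
          cofactor q t a₁ a₂ y i r ν * bdry q t a₁ a₂ b₁ b₂ i r M ν := by
  rw [Finset.sum_congr rfl fun ν _ => wt_mul_Delta_mul_diffOp h y i ν, ← Finset.mul_sum,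
    Finset.sum_comm, neg_mul, ← mul_neg, ← Finset.sum_neg_distrib]
  congr 1
  refine Finset.sum_congr rfl fun r _ => ?_
  rw [sum_piFinset_range_insertNth M r, ← mul_neg, ← Finset.sum_neg_distrib, Finset.mul_sum]
  refine Finset.sum_congr rfl fun ν _ => ?_
  simp only [Fin.removeNth_insertNth, Fin.insertNth_apply_same]
  rw [← Finset.mul_sum, ← Finset.mul_sum,
    Finset.sum_range_sub' (fun k => bdry q t a₁ a₂ b₁ b₂ i r k ν),
    bdry_zero h.a₁_ne h.a₂_ne, zero_sub, mul_neg]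

theorem tendsto_piFinset_range (m : ℕ) :
    Tendsto (fun M => Fintype.piFinset fun _ : Fin m => Finset.range M) atTop atTop := by
  refine tendsto_atTop_finset_of_monotone (fun a b hab =>
    Fintype.piFinset_subset _ _ fun _ => Finset.range_mono hab) fun ν => ?_
  refine ⟨∑ k, ν k + 1, Fintype.mem_piFinset.2 fun k => Finset.mem_range.2 ?_⟩
  exact Nat.lt_succ_of_le (Finset.single_le_sum (fun _ _ => Nat.zero_le _) (Finset.mem_univ k))

/-- Dominated convergence for sums over growing cubes. -/
theorem tendsto_sum_piFinset_range {m : ℕ} {F : ℕ → (Fin m → ℕ) → ℂ} {L : (Fin m → ℕ) → ℂ}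
    {bound : (Fin m → ℕ) → ℝ} (hb : Summable bound) (hF : ∀ M ν, ‖F M ν‖ ≤ bound ν)
    (hL : ∀ ν, Tendsto (fun M => F M ν) atTop (𝓝 (L ν))) :
    Tendsto (fun M => ∑ ν ∈ Fintype.piFinset fun _ => Finset.range M, F M ν) atTop
      (𝓝 (∑' ν, L ν)) := by
  classical
  have h := tendsto_tsum_of_dominated_convergence (𝓕 := atTop)
    (f := fun M ν => if ν ∈ Fintype.piFinset (fun _ => Finset.range M) then F M ν else 0)
    (g := L) hb (fun ν => (hL ν).congr' ?_) (Eventually.of_forall fun M ν => ?_)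
  · refine h.congr fun M => ?_
    rw [tsum_eq_sum (s := Fintype.piFinset fun _ => Finset.range M) fun ν hν => if_neg hν]
    exact Finset.sum_congr rfl fun ν hν => if_pos hν
  · filter_upwards [(tendsto_piFinset_range m).eventually_ge_atTop {ν}] with M hM
    rw [if_pos (hM (Finset.mem_singleton_self ν))]
  · split_ifs
    · exact hF M ν
    · rw [norm_zero]
      exact (norm_nonneg _).trans (hF M ν)

/-- The limit of the boundary sum at the end of a block. The end of the second block of the `i`-th
lattice and the end of the first block of the next lattice give the same sum up to sign. -/
noncomputable def edgeSum (q : ℝ) (t a₁ a₂ b₁ b₂ y : ℂ) (m i : ℕ) : ℂ :=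
  ∑' ν : Fin m → ℕ, Delta (latPt q (zeta t a₁ a₂ m i) ν) *
    (∏ j, (y - latPt q (zeta t a₁ a₂ m i) ν j)) *
    (thetaCoef q t a₁ a₂ (m + 1) i * (a₂ * t ^ (m - i))⁻¹ * edgeWt q t a₁ a₂ b₁ b₂ i ν)

theorem tendsto_sum_cofactor_bdry {m : ℕ} (h : Admissible (m + 1) q t a₁ a₂ b₁ b₂) (y : ℂ) {i : ℕ}
    (hi : i ≤ m + 1) (r : Fin (m + 1)) :
    Tendsto (fun M => ∑ ν ∈ Fintype.piFinset fun _ => Finset.range M,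
        cofactor q t a₁ a₂ y i r ν * bdry q t a₁ a₂ b₁ b₂ i r M ν) atTop
      (𝓝 (if (r : ℕ) + 1 = i then -(-1) ^ (m - r) * edgeSum q t a₁ a₂ b₁ b₂ y m r
        else if (r : ℕ) = m then edgeSum q t a₁ a₂ b₁ b₂ y m i else 0)) := by
  obtain ⟨C, hC⟩ := cofactor_bdry_bound h y hi r
  have hb : Summable fun ν : Fin m → ℕ => C * ∏ k, (q * max 1 (‖t‖ ^ 2) ^ m) ^ ν k :=
    (summable_prod_pow h.rate_nonneg h.conv m).mul_left C
  have key := fun L => tendsto_sum_piFinset_range (L := L) hb hC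
  split_ifs with h1 h2
  · subst h1
    have e : ∀ ν, cofactor q t a₁ a₂ y (r + 1) r ν = Delta (latPt q (zeta t a₁ a₂ m r) ν) *
        (∏ j, (y - latPt q (zeta t a₁ a₂ m r) ν j)) := fun ν => by
      simp only [cofactor, latPt, zeta_mid_succAbove (t := t) (a₁ := a₁) (a₂ := a₂) r.2]
      rfl
    convert key _ (fun ν => (tendsto_bdry_mid h (Nat.lt_succ_iff.1 r.2) ν).const_mul _) using 2
    rw [edgeSum, ← tsum_mul_left]
    refine tsum_congr fun ν => ?_
    rw [e]
    ring
  · obtain rfl : r = Fin.last m := Fin.ext h2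
    rw [Fin.val_last] at h1
    have e : ∀ ν, cofactor q t a₁ a₂ y i (Fin.last m) ν = Delta (latPt q (zeta t a₁ a₂ m i) ν) *
        (∏ j, (y - latPt q (zeta t a₁ a₂ m i) ν j)) := fun ν => by
      simp only [cofactor, latPt, zeta_last_succAbove]
      rfl
    convert key _ (fun ν => (tendsto_bdry_last h (by omega : i ≤ m) ν).const_mul _) using 2
    rw [edgeSum]
    exact tsum_congr fun ν => by rw [e]
  · convert key _ (fun ν => (tendsto_bdry_inner h1 h2 ν).const_mul _) using 2
    simp

/-- The boundary limits of all lattices cancel. The terms with `r = m` and `i ≤ m` come from second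
blocks, and the terms with `r + 1 = i` from first blocks. -/
theorem sum_boundary_limits (m : ℕ) (S : ℕ → ℂ) :
    ∑ i ∈ Finset.range (m + 2), ∑ r : Fin (m + 1), (-1 : ℂ) ^ (r : ℕ) *
      (if (r : ℕ) + 1 = i then -(-1) ^ (m - r) * S r else if (r : ℕ) = m then S i else 0) = 0 := by
  have h1 : ∀ i ∈ Finset.range (m + 2), ∑ r : Fin (m + 1), (-1 : ℂ) ^ (r : ℕ) *
      (if (r : ℕ) + 1 = i then -(-1) ^ (m - r) * S r else if (r : ℕ) = m then S i else 0) =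
      ∑ r ∈ Finset.range (m + 1), (if r + 1 = i then -(-1) ^ m * S r else 0) +
        (if i < m + 1 then (-1) ^ m * S i else 0) := by
    intro i hi
    rw [Finset.mem_range] at hi
    rw [Finset.sum_range (fun r => if r + 1 = i then -(-1) ^ m * S r else 0)]
    have h2 : (if i < m + 1 then (-1) ^ m * S i else 0) =
        ∑ r : Fin (m + 1), if r = Fin.last m then (if i < m + 1 then (-1) ^ m * S i else 0)
          else 0 := by
      rw [Finset.sum_ite_eq' Finset.univ (Fin.last m), if_pos (Finset.mem_univ _)]
    rw [h2, ← Finset.sum_add_distrib]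
    refine Finset.sum_congr rfl fun r _ => ?_
    have hr := r.2
    have e : (-1 : ℂ) ^ (r : ℕ) * (-1) ^ (m - r) = (-1) ^ m := by
      rw [← pow_add]; congr 1; omega
    have hl : r = Fin.last m ↔ (r : ℕ) = m := by rw [Fin.ext_iff, Fin.val_last]
    simp only [hl]
    by_cases ha : (r : ℕ) + 1 = i
    · rw [if_pos ha, if_pos ha, ← e]
      by_cases hb : (r : ℕ) = m
      · rw [if_pos hb, if_neg (by omega)]; ring
      · rw [if_neg hb]; ring
    · rw [if_neg ha, if_neg ha]
      by_cases hb : (r : ℕ) = m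
      · rw [if_pos hb, if_pos hb, if_pos (by omega), hb]; ring
      · rw [if_neg hb, if_neg hb]; ring
  rw [Finset.sum_congr rfl h1, Finset.sum_add_distrib, Finset.sum_comm,
    Finset.sum_range_succ _ (m + 1), if_neg (lt_irrefl _), add_zero, ← Finset.sum_add_distrib]
  refine Finset.sum_eq_zero fun r hr => ?_
  rw [Finset.mem_range] at hr
  rw [Finset.sum_ite_eq (Finset.range (m + 2)) (r + 1), if_pos (Finset.mem_range.2 (by omega)),
    if_pos hr]
  ring

/-- The mean of `∏ (z_j - y)` solves the `t`-difference equation. -/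
theorem total_diffOp {m : ℕ} (h : Admissible (m + 1) q t a₁ a₂ b₁ b₂) (y : ℂ) :
    total q t a₁ a₂ b₁ b₂ (m + 1)
      (fun z => diffOp m t a₁ a₂ b₁ b₂ (fun w => ∏ j, (z j - w)) y) = 0 := by
  have hcont : Continuous fun z : Fin (m + 1) → ℂ =>
      diffOp m t a₁ a₂ b₁ b₂ (fun w => ∏ j, (z j - w)) y := by
    unfold diffOp
    fun_prop
  unfold total
  have h1 : ∀ i ∈ Finset.range (m + 1 + 1), _ := fun i hi =>
    ((summable_norm_wt_mul h (Nat.lt_succ_iff.1 (Finset.mem_range.1 hi)) _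
      hcont).of_norm.hasSum.comp (tendsto_piFinset_range (m + 1)))
  have h2 := tendsto_finsetSum _ h1
  refine tendsto_nhds_unique h2 ?_
  have h3 := (tendsto_finsetSum (Finset.range (m + 1 + 1)) fun i hi =>
    tendsto_finsetSum Finset.univ fun r _ =>
      (tendsto_sum_cofactor_bdry h y (Nat.lt_succ_iff.1 (Finset.mem_range.1 hi)) r).const_mul
        ((-1 : ℂ) ^ (r : ℕ))).const_mul (-(y ^ 2 * ((1 - t) * (-1) ^ (m + 1))))
  rw [sum_boundary_limits, mul_zero] at h3
  refine h3.congr fun M => ?_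
  rw [Finset.mul_sum]
  exact Finset.sum_congr rfl fun i _ => (sum_cube_wt_mul_Delta_mul_diffOp h y i M).symm

/-- The polynomial `y ↦ total (∏_j (z_j - y))`. -/
noncomputable def totalPoly (q : ℝ) (t a₁ a₂ b₁ b₂ : ℂ) (n : ℕ) : Polynomial ℂ :=
  ∑ T ∈ (Finset.univ : Finset (Fin n)).powerset,
    Polynomial.C (total q t a₁ a₂ b₁ b₂ n fun z => ∏ j ∈ T, z j) *
      (-Polynomial.X) ^ (Finset.univ \ T).card

theorem totalPoly_eval (h : Admissible n q t a₁ a₂ b₁ b₂) (y : ℂ) :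
    (totalPoly q t a₁ a₂ b₁ b₂ n).eval y =
      total q t a₁ a₂ b₁ b₂ n fun z => ∏ j, (z j - y) := by
  have h1 : (fun z : Fin n → ℂ => ∏ j, (z j - y)) = fun z => ∑ T ∈ Finset.univ.powerset,
      (-y) ^ (Finset.univ \ T).card * ∏ j ∈ T, z j := by
    funext z
    simp only [sub_eq_add_neg]
    rw [Finset.prod_add]
    exact Finset.sum_congr rfl fun T _ => by rw [Finset.prod_const, mul_comm]
  rw [h1, total_sum h _ _ (fun T z => ∏ j ∈ T, z j) (fun T _ => by fun_prop), totalPoly,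
    Polynomial.eval_finsetSum]
  refine Finset.sum_congr rfl fun T _ => ?_
  simp [mul_comm]

theorem natDegree_totalPoly_le : (totalPoly q t a₁ a₂ b₁ b₂ n).natDegree ≤ n := by
  refine Polynomial.natDegree_sum_le_of_forall_le _ _ fun T _ => ?_
  refine (Polynomial.natDegree_C_mul_le _ _).trans ?_
  refine Polynomial.natDegree_pow_le.trans ?_
  rw [Polynomial.natDegree_neg, Polynomial.natDegree_X, mul_one]
  exact (Finset.card_le_univ _).trans (Fintype.card_fin n).le

theorem coeff_totalPoly : (totalPoly q t a₁ a₂ b₁ b₂ n).coeff n =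
    (-1) ^ n * total q t a₁ a₂ b₁ b₂ n fun _ => 1 := by
  have hX : ∀ k : ℕ, (-Polynomial.X : Polynomial ℂ) ^ k =
      Polynomial.C ((-1) ^ k) * Polynomial.X ^ k := fun k => by
    rw [neg_pow, Polynomial.C_pow, Polynomial.C_neg, Polynomial.C_1]
  simp only [totalPoly, Polynomial.finsetSum_coeff, hX, Polynomial.coeff_C_mul,
    Polynomial.coeff_X_pow]
  rw [Finset.sum_eq_single ∅]
  · simp [mul_comm]
  · intro T _ hT
    rw [if_neg, mul_zero, mul_zero]
    intro h
    refine hT (Finset.card_eq_zero.1 ?_)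
    have := Finset.card_sdiff_add_card_eq_card (Finset.subset_univ T)
    rw [Finset.card_univ, Fintype.card_fin] at this
    omega
  · intro h; simp at h

theorem diffOp_totalPoly {m : ℕ} (h : Admissible (m + 1) q t a₁ a₂ b₁ b₂) (y : ℂ) :
    diffOp m t a₁ a₂ b₁ b₂ (fun w => (totalPoly q t a₁ a₂ b₁ b₂ (m + 1)).eval w) y = 0 := by
  rw [← total_diffOp h y]
  set c : Fin 3 → ℂ := ![t ^ (m + 1) * (1 + -(a₁⁻¹ + a₂⁻¹) * y + a₁⁻¹ * a₂⁻¹ * y ^ 2),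
    t ^ m * (1 + -(b₁ + b₂) * y + b₁ * b₂ * y ^ 2),
    -(t ^ m * (1 + t) + (t ^ (m + 1) * (-(a₁⁻¹ + a₂⁻¹)) + t ^ m * (-(b₁ + b₂))) * y +
        (a₁⁻¹ * a₂⁻¹ + t ^ (2 * m + 1) * (b₁ * b₂)) * y ^ 2)] with hc
  set x : Fin 3 → ℂ := ![y / t, t * y, y] with hx
  have h1 : (fun z : Fin (m + 1) → ℂ => diffOp m t a₁ a₂ b₁ b₂ (fun w => ∏ j, (z j - w)) y) =
      fun z => ∑ k, c k * ∏ j, (z j - x k) := by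
    funext z
    rw [Fin.sum_univ_three]
    simp only [diffOp, hc, hx, Matrix.cons_val]
    ring
  rw [h1, total_sum h _ _ (fun k z => ∏ j, (z j - x k)) (fun T _ => by fun_prop),
    Fin.sum_univ_three]
  simp only [diffOp, hc, hx, Matrix.cons_val, totalPoly_eval h]
  ring

/-- The consequence of the difference relations: the mean of `∏_k (z_k - a₁)` in terms of the
mean of `1`. -/
theorem total_prod_sub {m : ℕ} (h : Admissible (m + 1) q t a₁ a₂ b₁ b₂) :
    (∏ k ∈ Finset.range (m + 1), (1 - a₁ * a₂ * b₁ * b₂ * t ^ (m + k))) *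
        total q t a₁ a₂ b₁ b₂ (m + 1) (fun z => ∏ j, (z j - a₁)) =
      a₂ ^ (m + 1) * t ^ ((m + 1).choose 2) * (∏ k ∈ Finset.range (m + 1),
        (1 - a₁ * b₁ * t ^ k) * (1 - a₁ * b₂ * t ^ k)) *
        total q t a₁ a₂ b₁ b₂ (m + 1) fun _ => 1 := by
  have h1 := eval_of_diffOp_eq_zero h.t_ne h.a₁_ne h.a₂_ne
    (fun k hk => by simpa using h.t_pole k hk 0) _ natDegree_totalPoly_le (diffOp_totalPoly h)
  rw [totalPoly_eval h, coeff_totalPoly] at h1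
  rw [h1, neg_pow a₂]
  have : ((-1 : ℂ) ^ (m + 1)) * (-1) ^ (m + 1) = 1 := by
    rw [← mul_pow]; simp
  linear_combination (a₂ ^ (m + 1) * t ^ ((m + 1).choose 2) * (∏ k ∈ Finset.range (m + 1),
        (1 - a₁ * b₁ * t ^ k) * (1 - a₁ * b₂ * t ^ k)) *
        total q t a₁ a₂ b₁ b₂ (m + 1) fun _ => 1) * this

/-! ### The shift of the parameter `a₁` -/

theorem siteWt_shift (hq0 : 0 < q) (hq1 : q < 1) (h₁ : a₁ ≠ 0) (z : ℂ) :
    siteWt q (a₁ * q) a₂ b₁ b₂ z * (-a₁) = (z - a₁) * siteWt q a₁ a₂ b₁ b₂ z := by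
  have hq : (q : ℂ) ≠ 0 := by exact_mod_cast hq0.ne'
  have h1 := qPoch_step hq0 hq1 (a₁⁻¹ * z)
  unfold siteWt
  rw [show (q : ℂ) * (a₁ * q)⁻¹ * z = a₁⁻¹ * z by field_simp, h1, ← mul_assoc (q : ℂ)]
  generalize qPoch q (q * a₁⁻¹ * z) = U
  field_simp
  ring

theorem pairWt_shift (q : ℝ) (t x y : ℂ) (c d a b : ℕ) :
    pairWt q t (x * (q : ℂ) ^ c) (y * (q : ℂ) ^ d) a b * (t ^ 2) ^ c =
      pairWt q t x y (a + c) (b + d) := by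
  unfold pairWt
  rw [show y * (q : ℂ) ^ d * (q : ℂ) ^ b = y * (q : ℂ) ^ (b + d) by ring,
    show x * (q : ℂ) ^ c * (q : ℂ) ^ a = x * (q : ℂ) ^ (a + c) by ring, pow_add (t ^ 2 / q),
    div_pow _ _ c, mul_inv]
  ring

/-- The points of the lattice with base point `x_k q^(c_k)` are points of the lattice with base
point `x`. This compares the weights for `q a₁` and for `a₁` at such a point. -/
theorem rawWt_shift (hq0 : 0 < q) (hq1 : q < 1) (h₁ : a₁ ≠ 0) (x : Fin n → ℂ) (c ν : Fin n → ℕ) :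
    rawWt q t (a₁ * q) a₂ b₁ b₂ (fun k => x k * (q : ℂ) ^ c k) ν *
        ∏ k : Fin n, (-a₁ * (q : ℂ) ^ c k * (t ^ 2) ^ (c k * (n - 1 - k))) =
      rawWt q t a₁ a₂ b₁ b₂ x (fun k => ν k + c k) *
        ∏ k, (x k * (q : ℂ) ^ (ν k + c k) - a₁) := by
  have hq : (q : ℂ) ≠ 0 := by exact_mod_cast hq0.ne'
  have hpair : (∏ k, ∏ l ∈ Finset.Ioi k, pairWt q t (x k * (q : ℂ) ^ c k) (x l * (q : ℂ) ^ c l)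
      (ν k) (ν l)) * ∏ k : Fin n, (t ^ 2) ^ (c k * (n - 1 - k)) =
      ∏ k, ∏ l ∈ Finset.Ioi k, pairWt q t (x k) (x l) (ν k + c k) (ν l + c l) := by
    rw [← Finset.prod_mul_distrib]
    refine Finset.prod_congr rfl fun k _ => ?_
    rw [pow_mul, ← Fin.card_Ioi, ← Finset.prod_const, ← Finset.prod_mul_distrib]
    exact Finset.prod_congr rfl fun l _ => pairWt_shift q t _ _ _ _ _ _
  have hsite : (∏ k, (q : ℂ) ^ ν k * siteWt q (a₁ * q) a₂ b₁ b₂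
      (x k * (q : ℂ) ^ c k * (q : ℂ) ^ ν k)) * ∏ k, (-a₁ * (q : ℂ) ^ c k) =
      (∏ k, (q : ℂ) ^ (ν k + c k) * siteWt q a₁ a₂ b₁ b₂ (x k * (q : ℂ) ^ (ν k + c k))) *
        ∏ k, (x k * (q : ℂ) ^ (ν k + c k) - a₁) := by
    rw [← Finset.prod_mul_distrib, ← Finset.prod_mul_distrib]
    refine Finset.prod_congr rfl fun k _ => ?_
    have := siteWt_shift (a₂ := a₂) (b₁ := b₁) (b₂ := b₂) hq0 hq1 h₁ (x k * (q : ℂ) ^ (ν k + c k))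
    rw [show x k * (q : ℂ) ^ c k * (q : ℂ) ^ ν k = x k * (q : ℂ) ^ (ν k + c k) by ring]
    rw [pow_add _ (ν k)] at this ⊢
    linear_combination (q : ℂ) ^ ν k * (q : ℂ) ^ c k * this
  have e := Finset.prod_mul_distrib (s := Finset.univ) (f := fun k => -a₁ * (q : ℂ) ^ c k)
    (g := fun k : Fin n => (t ^ 2) ^ (c k * (n - 1 - k)))
  beta_reduce at e
  unfold rawWt
  rw [e, ← hpair, mul_right_comm (∏ k, (q : ℂ) ^ (ν k + c k) * _), ← hsite]
  ring

theorem theta_inv_mul_q (hq0 : 0 < q) (hq1 : q < 1) {x : ℂ} (hx : x ≠ 0) :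
    (theta q (q * x))⁻¹ = -x * (theta q x)⁻¹ := by
  rw [theta_mul_q hq0 hq1 hx, mul_inv, ← neg_inv, inv_inv]

theorem thetaCoef_shift (h : Admissible n q t a₁ a₂ b₁ b₂) (i : ℕ) :
    thetaCoef q t (a₁ * q) a₂ n i =
      (∏ j ∈ Finset.range i, -(q * a₁ * a₂⁻¹ * t ^ j)) *
        (∏ k ∈ Finset.range (n - i), -(a₁ * a₂⁻¹ * t ^ ((i : ℤ) - k))) *
        thetaCoef q t a₁ a₂ n i := by
  have hq := h.q_ne
  have ht := h.t_ne
  have h1 := h.a₁_ne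
  have h2 := h.a₂_ne
  have hA : ∀ j : ℕ, (theta q (a₂ * (a₁ * q)⁻¹ * t ^ (-(j : ℤ))))⁻¹ =
      -(q * a₁ * a₂⁻¹ * t ^ j) * (theta q (a₂ * a₁⁻¹ * t ^ (-(j : ℤ))))⁻¹ := fun j => by
    have hx : a₂ * (a₁ * q)⁻¹ * t ^ (-(j : ℤ)) ≠ 0 :=
      mul_ne_zero (by positivity) (zpow_ne_zero _ ht)
    have := theta_inv_mul_q h.q_pos h.q_lt_one hx
    rw [show (q : ℂ) * (a₂ * (a₁ * q)⁻¹ * t ^ (-(j : ℤ))) = a₂ * a₁⁻¹ * t ^ (-(j : ℤ)) by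
      field_simp] at this
    rw [this, ← mul_assoc]
    have e : -(q * a₁ * a₂⁻¹ * t ^ j) * -(a₂ * (a₁ * q)⁻¹ * t ^ (-(j : ℤ))) = 1 := by
      rw [zpow_neg, zpow_natCast]
      field_simp
    rw [e, one_mul]
  have hB : ∀ k : ℕ, (theta q (a₁ * q * a₂⁻¹ * t ^ ((i : ℤ) - k)))⁻¹ =
      -(a₁ * a₂⁻¹ * t ^ ((i : ℤ) - k)) * (theta q (a₁ * a₂⁻¹ * t ^ ((i : ℤ) - k)))⁻¹ := fun k => by
    have hx : a₁ * a₂⁻¹ * t ^ ((i : ℤ) - k) ≠ 0 :=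
      mul_ne_zero (by positivity) (zpow_ne_zero _ ht)
    rw [← theta_inv_mul_q h.q_pos h.q_lt_one hx]
    congr 2
    ring
  unfold thetaCoef
  simp only [hA, hB, Finset.prod_mul_distrib]
  ring

theorem prod_pow_range (t : ℂ) (d : ℕ) : ∏ j ∈ Finset.range d, t ^ j = t ^ d.choose 2 := by
  rw [Finset.prod_pow_eq_pow_sum, Finset.sum_range_id, Nat.choose_two_right]

/-- The constant produced by the shift of `a₁` is the same for all lattices. -/
theorem shift_constant (hq : (q : ℂ) ≠ 0) (ht : t ≠ 0) (h₂ : a₂ ≠ 0) {i : ℕ} (hi : i ≤ n) :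
    (∏ j ∈ Finset.range i, -(q * a₁ * a₂⁻¹ * t ^ j)) *
        (∏ k ∈ Finset.range (n - i), -(a₁ * a₂⁻¹ * t ^ ((i : ℤ) - k))) *
        (a₂ ^ n * t ^ n.choose 2) =
      ∏ k : Fin n, (-a₁ * (q : ℂ) ^ (if (k : ℕ) < i then 1 else 0) *
        (t ^ 2) ^ ((if (k : ℕ) < i then 1 else 0) * (n - 1 - k))) := by
  obtain ⟨d, rfl⟩ := Nat.exists_eq_add_of_le hi
  rw [Fin.prod_univ_add, Nat.add_sub_cancel_left]
  have e1 : ∏ j ∈ Finset.range i, -(q * a₁ * a₂⁻¹ * t ^ j) =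
      (-(q * a₁ * a₂⁻¹)) ^ i * t ^ i.choose 2 := by
    rw [← prod_pow_range, ← Finset.card_range i, ← Finset.prod_const, Finset.card_range,
      ← Finset.prod_mul_distrib]
    exact Finset.prod_congr rfl fun j _ => by ring
  have e2 : (∏ k ∈ Finset.range d, -(a₁ * a₂⁻¹ * t ^ ((i : ℤ) - k))) * t ^ d.choose 2 =
      (-(a₁ * a₂⁻¹)) ^ d * t ^ (i * d) := by
    rw [← prod_pow_range, ← Finset.prod_mul_distrib]
    have : ∀ k ∈ Finset.range d, -(a₁ * a₂⁻¹ * t ^ ((i : ℤ) - k)) * t ^ k =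
        -(a₁ * a₂⁻¹) * t ^ i := fun k _ => by
      rw [zpow_sub₀ ht, zpow_natCast, zpow_natCast]
      field_simp
    rw [Finset.prod_congr rfl this, Finset.prod_const, Finset.card_range, mul_pow, pow_mul]
  have e3 : (∏ k : Fin i, (-a₁ * (q : ℂ) ^ (if (Fin.castAdd d k : ℕ) < i then 1 else 0) *
      (t ^ 2) ^ ((if (Fin.castAdd d k : ℕ) < i then 1 else 0) *
        (i + d - 1 - (Fin.castAdd d k : ℕ))))) =
      (-a₁ * q) ^ i * (t ^ 2) ^ (i * d + i.choose 2) := by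
    have : ∀ k : Fin i, (-a₁ * (q : ℂ) ^ (if (Fin.castAdd d k : ℕ) < i then 1 else 0) *
      (t ^ 2) ^ ((if (Fin.castAdd d k : ℕ) < i then 1 else 0) *
        (i + d - 1 - (Fin.castAdd d k : ℕ)))) = -a₁ * q * ((t ^ 2) ^ d * (t ^ 2) ^ (i - 1 - k)) :=
      fun k => by
        have hk := k.2
        rw [Fin.val_castAdd, if_pos hk, pow_one, one_mul, ← pow_add]
        congr 2
        omega
    rw [Finset.prod_congr rfl fun k _ => this k, ← Finset.prod_range (fun k => -a₁ * (q : ℂ) *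
      ((t ^ 2) ^ d * (t ^ 2) ^ (i - 1 - k))), Finset.prod_mul_distrib, Finset.prod_const,
      Finset.prod_mul_distrib, Finset.prod_const, Finset.card_range,
      Finset.prod_range_reflect (fun k => (t ^ 2) ^ k), prod_pow_range, ← pow_mul, ← pow_add, mul_comm d]
  have e4 : (∏ k : Fin d, (-a₁ * (q : ℂ) ^ (if (Fin.natAdd i k : ℕ) < i then 1 else 0) *
      (t ^ 2) ^ ((if (Fin.natAdd i k : ℕ) < i then 1 else 0) *
        (i + d - 1 - (Fin.natAdd i k : ℕ))))) = (-a₁) ^ d := by simp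
  rw [e3, e4, e1, choose_two_add]
  have : (-(q * a₁ * a₂⁻¹)) ^ i * (-(a₁ * a₂⁻¹)) ^ d * a₂ ^ (i + d) = (-a₁ * q) ^ i * (-a₁) ^ d := by
    rw [pow_add, show (-(q * a₁ * a₂⁻¹)) ^ i * (-(a₁ * a₂⁻¹)) ^ d * (a₂ ^ i * a₂ ^ d) =
      (-(q * a₁ * a₂⁻¹) * a₂) ^ i * (-(a₁ * a₂⁻¹) * a₂) ^ d by rw [mul_pow, mul_pow]; ring]
    congr 2 <;> field_simp
  generalize ∏ k ∈ Finset.range d, -(a₁ * a₂⁻¹ * t ^ ((i : ℤ) - k)) = E at e2 ⊢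
  linear_combination (-(q * a₁ * a₂⁻¹)) ^ i * t ^ i.choose 2 * a₂ ^ (i + d) *
    t ^ (i.choose 2 + i * d) * e2 + (t ^ 2) ^ (i * d + i.choose 2) * this

theorem latPt_zeta_shift (i : ℕ) (ν : Fin n → ℕ) :
    latPt q (zeta t (a₁ * q) a₂ n i) ν =
      latPt q (zeta t a₁ a₂ n i) fun k => ν k + if (k : ℕ) < i then 1 else 0 := by
  funext k
  unfold latPt zeta
  by_cases hk : (k : ℕ) < i
  · simp only [if_pos hk]; ring
  · simp only [if_neg hk]; ring

theorem zeta_mul_q (i : ℕ) : zeta t (a₁ * q) a₂ n i =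
    fun k => zeta t a₁ a₂ n i k * (q : ℂ) ^ if (k : ℕ) < i then 1 else 0 := by
  funext k
  unfold zeta
  split_ifs <;> ring

theorem inFan_shift_iff (i : ℕ) (ν : Fin n → ℕ) :
    InFan i (fun k => ν k + if (k : ℕ) < i then 1 else 0) ↔ InFan i ν := by
  refine forall_congr' fun k => forall_congr' fun l => forall_congr' fun _ =>
    forall_congr' fun hb => ?_
  by_cases hk : (k : ℕ) < i
  · simp [hk, hb.1 hk]
  · simp [hk, mt hb.2 hk]

theorem wt_shift (h : Admissible n q t a₁ a₂ b₁ b₂) {i : ℕ} (hi : i ≤ n) (ν : Fin n → ℕ) :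
    a₂ ^ n * t ^ n.choose 2 * wt q t (a₁ * q) a₂ b₁ b₂ i ν =
      wt q t a₁ a₂ b₁ b₂ i (fun k => ν k + if (k : ℕ) < i then 1 else 0) *
        ∏ k, (latPt q (zeta t (a₁ * q) a₂ n i) ν k - a₁) := by
  unfold wt
  by_cases hν : InFan i ν
  · rw [if_pos hν, if_pos ((inFan_shift_iff i ν).2 hν), thetaCoef_shift h, latPt_zeta_shift]
    have h1 := rawWt_shift (t := t) (a₂ := a₂) (b₁ := b₁) (b₂ := b₂) h.q_pos h.q_lt_one h.a₁_ne
      (zeta t a₁ a₂ n i) (fun k => if (k : ℕ) < i then 1 else 0) ν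
    beta_reduce at h1
    rw [← shift_constant h.q_ne h.t_ne h.a₂_ne hi, ← zeta_mul_q] at h1
    unfold latPt
    linear_combination thetaCoef q t a₁ a₂ n i * h1
  · rw [if_neg hν, if_neg (mt (inFan_shift_iff i ν).1 hν), mul_zero, zero_mul]

/-- The total mass at `q a₁` is the mean of `∏_k (z_k - a₁)` at `a₁`: the points that are lost in
the shift are the zeros of this product. -/
theorem total_shift (h : Admissible n q t a₁ a₂ b₁ b₂) :
    a₂ ^ n * t ^ n.choose 2 * total q t (a₁ * q) a₂ b₁ b₂ n (fun _ => 1) =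
      total q t a₁ a₂ b₁ b₂ n fun z => ∏ j, (z j - a₁) := by
  unfold total
  rw [Finset.mul_sum]
  refine Finset.sum_congr rfl fun i hi => ?_
  have hi' : i ≤ n := Nat.lt_succ_iff.1 (Finset.mem_range.1 hi)
  set s : (Fin n → ℕ) → Fin n → ℕ := fun ν k => ν k + if (k : ℕ) < i then 1 else 0 with hs
  have hinj : Function.Injective s := fun ν ν' hνν' => funext fun k => by
    simpa [hs] using congrFun hνν' k
  rw [← tsum_mul_left]
  refine Eq.trans (tsum_congr fun ν => ?_) (hinj.tsum_eq ?_)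
  · have h1 := wt_shift h hi' ν
    have h2 : latPt q (zeta t (a₁ * q) a₂ n i) ν = latPt q (zeta t a₁ a₂ n i) (s ν) :=
      latPt_zeta_shift i ν
    rw [h2] at h1 ⊢
    linear_combination Delta (latPt q (zeta t a₁ a₂ n i) (s ν)) * h1
  · intro ν hν
    by_contra hr
    refine hν ?_
    by_cases hf : InFan i ν
    · obtain ⟨k, hki, hk0⟩ : ∃ k : Fin n, (k : ℕ) < i ∧ ν k = 0 := by
        by_contra! hc
        refine hr ⟨fun k => ν k - if (k : ℕ) < i then 1 else 0, funext fun k => ?_⟩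
        simp only [hs]
        split_ifs with hk
        · exact Nat.sub_add_cancel (Nat.one_le_iff_ne_zero.2 (hc k hk))
        · simp
      -- The first exponent of the first block vanishes as well, so that `z_0 = a₁`.
      set k₀ : Fin n := ⟨0, k.pos⟩ with hk₀
      have h0 : ν k₀ = 0 := by
        rcases (show k₀ ≤ k from Fin.le_def.2 (Nat.zero_le _)).eq_or_lt with h1 | h1
        · rw [h1, hk0]
        · exact Nat.le_zero.1 (hk0 ▸ hf k₀ k h1 (by simp [hk₀, hki]; omega))
      refine mul_eq_zero_of_right _ (Finset.prod_eq_zero (Finset.mem_univ k₀) ?_)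
      rw [latPt, h0, zeta_of_lt (by simp [hk₀]; omega)]
      simp [hk₀]
    · simp [wt, hf]

/-- The contiguity relation of the total mass. -/
theorem total_one_recursion {m : ℕ} (h : Admissible (m + 1) q t a₁ a₂ b₁ b₂) :
    (∏ k ∈ Finset.range (m + 1), (1 - a₁ * b₁ * t ^ k) * (1 - a₁ * b₂ * t ^ k)) *
        total q t a₁ a₂ b₁ b₂ (m + 1) (fun _ => 1) =
      (∏ k ∈ Finset.range (m + 1), (1 - a₁ * a₂ * b₁ * b₂ * t ^ (m + k))) *
        total q t (a₁ * q) a₂ b₁ b₂ (m + 1) fun _ => 1 := by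
  have h1 := total_prod_sub h
  rw [← total_shift h] at h1
  have h2 : a₂ ^ (m + 1) * t ^ (m + 1).choose 2 ≠ 0 :=
    mul_ne_zero (pow_ne_zero _ h.a₂_ne) (pow_ne_zero _ h.t_ne)
  refine mul_left_cancel₀ h2 ?_
  linear_combination -h1

theorem total_one_iterate {m : ℕ} (h : Admissible (m + 1) q t a₁ a₂ b₁ b₂) (N : ℕ) :
    (∏ k ∈ Finset.range (m + 1), (∏ j ∈ Finset.range N, (1 - (q : ℂ) ^ j * (a₁ * b₁ * t ^ k))) *
        ∏ j ∈ Finset.range N, (1 - (q : ℂ) ^ j * (a₁ * b₂ * t ^ k))) *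
        total q t a₁ a₂ b₁ b₂ (m + 1) (fun _ => 1) =
      (∏ k ∈ Finset.range (m + 1), ∏ j ∈ Finset.range N,
        (1 - (q : ℂ) ^ j * (a₁ * a₂ * b₁ * b₂ * t ^ (m + k)))) *
        total q t (a₁ * (q : ℂ) ^ N) a₂ b₁ b₂ (m + 1) fun _ => 1 := by
  induction N with
  | zero => simp
  | succ N ih =>
    have h1 := total_one_recursion (h.shift N)
    rw [mul_assoc a₁ _ (q : ℂ), ← pow_succ] at h1
    have e1 : ∀ k, (∏ j ∈ Finset.range (N + 1), (1 - (q : ℂ) ^ j * (a₁ * b₁ * t ^ k))) *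
        ∏ j ∈ Finset.range (N + 1), (1 - (q : ℂ) ^ j * (a₁ * b₂ * t ^ k)) =
        (∏ j ∈ Finset.range N, (1 - (q : ℂ) ^ j * (a₁ * b₁ * t ^ k))) *
        (∏ j ∈ Finset.range N, (1 - (q : ℂ) ^ j * (a₁ * b₂ * t ^ k))) *
        ((1 - a₁ * (q : ℂ) ^ N * b₁ * t ^ k) * (1 - a₁ * (q : ℂ) ^ N * b₂ * t ^ k)) := fun k => by
      rw [Finset.prod_range_succ, Finset.prod_range_succ]; ring
    have e2 : ∀ k, ∏ j ∈ Finset.range (N + 1),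
        (1 - (q : ℂ) ^ j * (a₁ * a₂ * b₁ * b₂ * t ^ (m + k))) =
        (∏ j ∈ Finset.range N, (1 - (q : ℂ) ^ j * (a₁ * a₂ * b₁ * b₂ * t ^ (m + k)))) *
        (1 - a₁ * (q : ℂ) ^ N * a₂ * b₁ * b₂ * t ^ (m + k)) := fun k => by
      rw [Finset.prod_range_succ]; ring
    have e3 := Finset.prod_mul_distrib (s := Finset.range (m + 1))
      (f := fun k => (∏ j ∈ Finset.range N, (1 - (q : ℂ) ^ j * (a₁ * b₁ * t ^ k))) *
        (∏ j ∈ Finset.range N, (1 - (q : ℂ) ^ j * (a₁ * b₂ * t ^ k))))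
      (g := fun k => (1 - a₁ * (q : ℂ) ^ N * b₁ * t ^ k) * (1 - a₁ * (q : ℂ) ^ N * b₂ * t ^ k))
    have e4 := Finset.prod_mul_distrib (s := Finset.range (m + 1))
      (f := fun k => ∏ j ∈ Finset.range N, (1 - (q : ℂ) ^ j * (a₁ * a₂ * b₁ * b₂ * t ^ (m + k))))
      (g := fun k => 1 - a₁ * (q : ℂ) ^ N * a₂ * b₁ * b₂ * t ^ (m + k))
    beta_reduce at e3 e4
    rw [Finset.prod_congr rfl fun k _ => e1 k, Finset.prod_congr rfl fun k _ => e2 k, e3, e4,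
      mul_assoc (∏ k ∈ Finset.range (m + 1), ∏ j ∈ Finset.range N, _), ← h1, mul_right_comm, ih]
    ring

/-! ### The limit `a₁ → 0` along `a₁ q^N` -/

theorem tendsto_prod_thetaFac (h : Admissible n q t a₁ a₂ b₁ b₂) {i : ℕ} (hi0 : i ≠ 0)
    (hi : i ≤ n) (κ : ℝ) :
    Tendsto (fun N : ℕ => κ ^ N * ∏ k : Fin n,
      if (k : ℕ) < i then ‖thetaFac q t (a₁ * (q : ℂ) ^ N) a₂ i k‖ else 1) atTop (𝓝 0) := by
  have hq := h.q_ne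
  have hfac : ∀ (κ : ℝ) (k : ℕ), k < i →
      Tendsto (fun N : ℕ => κ ^ N * ‖thetaFac q t (a₁ * (q : ℂ) ^ N) a₂ i k‖) atTop (𝓝 0) := by
    intro κ k hk
    refine (tendsto_theta_inv h.q_pos h.q_lt_one (u := a₂ * a₁⁻¹ * t ^ (-(k : ℤ)))
      (mul_ne_zero (mul_ne_zero h.a₂_ne (inv_ne_zero h.a₁_ne)) (zpow_ne_zero _ h.t_ne)) κ).congr
      fun N => ?_
    rw [thetaFac, if_pos hk, zpow_neg (q : ℂ), zpow_natCast, mul_inv]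
    congr 4
    ring
  set k₀ : Fin n := ⟨0, by omega⟩ with hk₀
  have h1 : Tendsto (fun N : ℕ => ∏ k ∈ Finset.univ.erase k₀,
      if (k : ℕ) < i then ‖thetaFac q t (a₁ * (q : ℂ) ^ N) a₂ i k‖ else 1) atTop
      (𝓝 (∏ k ∈ Finset.univ.erase k₀, if (k : ℕ) < i then 0 else 1)) := by
    refine tendsto_finsetProd _ fun k _ => ?_
    split_ifs with hk
    · simpa using hfac 1 k hk
    · exact tendsto_const_nhds
  have h2 := (hfac κ 0 (by omega)).mul h1
  rw [zero_mul] at h2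
  refine h2.congr fun N => ?_
  rw [← Finset.mul_prod_erase Finset.univ _ (Finset.mem_univ k₀), if_pos (by simp [hk₀]; omega),
    mul_assoc]

theorem summable_gauge (h : Admissible n q t a₁ a₂ b₁ b₂) :
    Summable fun ν : Fin n → ℕ => gauge q (max 1 (‖t‖ ^ 2)) ν := by
  have hq0 := h.q_pos
  refine Summable.of_nonneg_of_le (fun ν => ?_) (fun ν => gauge_le h.q_pos (le_max_left _ _) ν)
    (summable_prod_pow h.rate_nonneg h.conv n)
  unfold gauge
  positivity

theorem wt_mul_Delta_bound (h : Admissible n q t a₁ a₂ b₁ b₂) {i : ℕ} (hi : i ≤ n) :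
    ∃ C κ : ℝ, 0 < C ∧ 0 < κ ∧ (i = 0 → κ = 1) ∧ ∀ (N : ℕ) (ν : Fin n → ℕ),
      ‖wt q t (a₁ * (q : ℂ) ^ N) a₂ b₁ b₂ i ν *
        Delta (latPt q (zeta t (a₁ * (q : ℂ) ^ N) a₂ n i) ν) * 1‖ ≤
      C * κ ^ N * (∏ k : Fin n, if (k : ℕ) < i then ‖thetaFac q t (a₁ * (q : ℂ) ^ N) a₂ i k‖
        else 1) * gauge q (max 1 (‖t‖ ^ 2)) ν := by
  obtain ⟨C, κ, hC0, hκ0, hκ1, hC⟩ := wt_bound h hi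
  refine ⟨C, κ, hC0, hκ0, hκ1, fun N ν => ?_⟩
  rw [mul_one, norm_mul]
  exact (mul_le_mul_of_nonneg_left (norm_Delta_le _) (norm_nonneg _)).trans (hC N ν)

/-- All lattices but the one on which only `a₂` occurs are negligible in the limit. -/
theorem tendsto_latticeSum_of_ne_zero (h : Admissible n q t a₁ a₂ b₁ b₂) {i : ℕ} (hi0 : i ≠ 0)
    (hi : i ≤ n) :
    Tendsto (fun N : ℕ => ∑' ν : Fin n → ℕ, wt q t (a₁ * (q : ℂ) ^ N) a₂ b₁ b₂ i ν *
        Delta (latPt q (zeta t (a₁ * (q : ℂ) ^ N) a₂ n i) ν) * 1) atTop (𝓝 0) := by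
  obtain ⟨C, κ, hC0, hκ0, -, hC⟩ := wt_mul_Delta_bound h hi
  have hs := summable_gauge h
  have h1 := ((tendsto_prod_thetaFac h hi0 hi κ).const_mul C).mul_const
    (∑' ν : Fin n → ℕ, gauge q (max 1 (‖t‖ ^ 2)) ν)
  rw [mul_zero, zero_mul] at h1
  refine squeeze_zero_norm (fun N => ?_) h1
  refine (tsum_of_norm_bounded (hs.mul_left _).hasSum (hC N)).trans ?_
  rw [tsum_mul_left, mul_assoc C]

theorem prod_Ioi_val_eq {M : Type*} [CommMonoid M] (k : Fin n) (f : ℕ → M) :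
    ∏ l ∈ Finset.Ioi k, f l = ∏ d ∈ Finset.range (n - 1 - k), f (k + 1 + d) := by
  have h : ∏ l ∈ Finset.Ioi k, f l = ∏ l ∈ (Finset.Ioi k).map Fin.valEmbedding, f l :=
    by rw [Finset.prod_map]; rfl
  have h' : Finset.Ioo (k : ℕ) n = Finset.Ico ((k : ℕ) + 1) n := by ext; simp
  rw [h, Fin.map_valEmbedding_Ioi, h', Finset.prod_Ico_eq_prod_range, Nat.sub_sub, add_comm 1]

/-- A telescoping product: the factor with index `d` is `(q t^d)_∞ (1 - t^(d+1)) / (t^(d+2))_∞`. -/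
theorem prod_pairRatio_pow (hq0 : 0 < q) (hq1 : q < 1) (ht : t ≠ 0) (e : ℕ)
    (hpole : ∀ d < e, qPoch q (t ^ (d + 2)) ≠ 0) :
    (∏ d ∈ Finset.range e, (pairRatio q t (t ^ (d + 1)) * (1 - t ^ (d + 1)))) *
      (qPoch q (q * t ^ e) * qPoch q (t ^ (e + 1))) = qPoch q q * qPoch q t := by
  induction e with
  | zero => simp
  | succ e ih =>
    rw [← ih fun d hd => hpole d (by omega), Finset.prod_range_succ]
    have h1 := qPoch_step hq0 hq1 (t ^ (e + 1))
    have h2 : pairRatio q t (t ^ (e + 1)) = qPoch q (q * t ^ e) / qPoch q (t ^ (e + 2)) := by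
      rw [pairRatio, pow_succ' t (e + 1)]
      congr 2
      rw [pow_succ]
      field_simp
    have h3 := hpole e (by omega)
    rw [h1, h2]
    field_simp

theorem qPoch_t_pow_ne_zero (h : Admissible n q t a₁ a₂ b₁ b₂) {k : ℕ} (h1 : 1 ≤ k) (hk : k ≤ n) :
    qPoch q (t ^ k) ≠ 0 :=
  qPoch_ne_zero h.q_pos h.q_lt_one fun N => h.t_pole k (Finset.mem_Icc.2 ⟨h1, hk⟩) N

theorem qPoch_q_mul_t_pow_ne_zero (h : Admissible n q t a₁ a₂ b₁ b₂) {k : ℕ} (hk : k ≤ n) :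
    qPoch q (q * t ^ k) ≠ 0 := by
  refine qPoch_ne_zero h.q_pos h.q_lt_one fun N hN => ?_
  rcases k with _ | k
  · rw [pow_zero, mul_one, ← pow_succ', ← Complex.ofReal_pow, Complex.ofReal_eq_one] at hN
    exact (pow_lt_one₀ h.q_pos.le h.q_lt_one (Nat.succ_ne_zero N)).ne hN
  · exact h.t_pole (k + 1) (by simp; omega) (N + 1) (by rw [← hN]; ring)

/-- The contribution of the origin of the `0`-th lattice in the limit, simplified as in
`origin_eq_limitTerm`. -/
noncomputable def limitTerm (q : ℝ) (t a₂ b₁ b₂ : ℂ) (n : ℕ) : ℂ :=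
  ∏ k ∈ Finset.range n, qPoch q q * qPoch q t /
    (qPoch q (t ^ (k + 1)) * (qPoch q (a₂ * b₁ * t ^ k) * qPoch q (a₂ * b₂ * t ^ k)))

theorem origin_eq_limitTerm (h : Admissible n q t a₁ a₂ b₁ b₂) :
    (∏ k : Fin n, qPoch q (q * t ^ (k : ℕ)) /
      (qPoch q (b₁ * (a₂ * t ^ (k : ℕ))) * qPoch q (b₂ * (a₂ * t ^ (k : ℕ))))) *
      ((∏ k : Fin n, ∏ l ∈ Finset.Ioi k, pairWt q t (a₂ * t ^ (k : ℕ)) (a₂ * t ^ (l : ℕ)) 0 0) *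
        Delta fun k : Fin n => a₂ * t ^ (k : ℕ)) = limitTerm q t a₂ b₁ b₂ n := by
  have ht := h.t_ne
  have h2 := h.a₂_ne
  unfold Delta
  rw [← Finset.prod_mul_distrib]
  have e1 : ∀ k : Fin n, (∏ l ∈ Finset.Ioi k, pairWt q t (a₂ * t ^ (k : ℕ)) (a₂ * t ^ (l : ℕ)) 0 0) *
      ∏ l ∈ Finset.Ioi k, (a₂ * t ^ (k : ℕ) - a₂ * t ^ (l : ℕ)) =
      qPoch q q * qPoch q t / (qPoch q (q * t ^ (n - 1 - k)) * qPoch q (t ^ (n - 1 - k + 1))) := by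
    intro k
    have hk := k.2
    rw [eq_div_iff (mul_ne_zero (qPoch_q_mul_t_pow_ne_zero h (by omega))
      (qPoch_t_pow_ne_zero h (by omega) (by omega))), ← prod_pairRatio_pow h.q_pos h.q_lt_one ht
      (n - 1 - k) fun d hd => qPoch_t_pow_ne_zero h (by omega) (by omega), ← Finset.prod_mul_distrib,
      prod_Ioi_val_eq k fun l => pairWt q t (a₂ * t ^ (k : ℕ)) (a₂ * t ^ l) 0 0 *
        (a₂ * t ^ (k : ℕ) - a₂ * t ^ l)]
    congr 1
    refine Finset.prod_congr rfl fun d _ => ?_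
    have e2 : a₂ * t ^ ((k : ℕ) + 1 + d) = a₂ * t ^ (k : ℕ) * t ^ (d + 1) := by ring
    have h3 : a₂ * t ^ (k : ℕ) ≠ 0 := by positivity
    rw [pairWt, e2]
    simp only [pow_zero, mul_one]
    rw [mul_div_cancel_left₀ _ h3]
    field_simp
  rw [Finset.prod_congr rfl fun k _ => e1 k, ← Finset.prod_range (fun k => qPoch q (q * t ^ k) /
    (qPoch q (b₁ * (a₂ * t ^ k)) * qPoch q (b₂ * (a₂ * t ^ k)))), ← Finset.prod_range (fun k =>
    qPoch q q * qPoch q t / (qPoch q (q * t ^ (n - 1 - k)) * qPoch q (t ^ (n - 1 - k + 1)))),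
    Finset.prod_range_reflect (fun k => qPoch q q * qPoch q t / (qPoch q (q * t ^ k) *
      qPoch q (t ^ (k + 1)))), ← Finset.prod_mul_distrib, limitTerm]
  refine Finset.prod_congr rfl fun k hk => ?_
  have h3 := qPoch_q_mul_t_pow_ne_zero h (Finset.mem_range.1 hk).le
  rw [show b₁ * (a₂ * t ^ k) = a₂ * b₁ * t ^ k by ring,
    show b₂ * (a₂ * t ^ k) = a₂ * b₂ * t ^ k by ring]
  field_simp

/-- On the lattice on which only `a₂` occurs, the product of `(q z_k / (a₁ q^N))_∞` and its theta
factor tends to `1` at the exponent `0` and to `0` otherwise. -/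
theorem tendsto_latticeSum_zero (h : Admissible n q t a₁ a₂ b₁ b₂) :
    Tendsto (fun N : ℕ => ∑' ν : Fin n → ℕ, wt q t (a₁ * (q : ℂ) ^ N) a₂ b₁ b₂ 0 ν *
        Delta (latPt q (zeta t (a₁ * (q : ℂ) ^ N) a₂ n 0) ν) * 1) atTop
      (𝓝 (limitTerm q t a₂ b₁ b₂ n)) := by
  classical
  have hq := h.q_ne
  have ht := h.t_ne
  have h1 := h.a₁_ne
  have h2 := h.a₂_ne
  obtain ⟨C, κ, -, -, hκ, hC⟩ := wt_mul_Delta_bound h (Nat.zero_le n)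
  rw [hκ rfl] at hC
  have hz : ∀ N : ℕ, zeta t (a₁ * (q : ℂ) ^ N) a₂ n 0 = fun k : Fin n => a₂ * t ^ (k : ℕ) := fun N => by
    funext k; simp [zeta]
  set x : Fin n → ℂ := fun k => a₂ * t ^ (k : ℕ) with hx
  set L : (Fin n → ℕ) → ℂ := fun ν => (if InFan 0 ν then
    (∏ k, if ν k = 0 then qPoch q (q * t ^ (k : ℕ)) /
      (qPoch q (b₁ * (a₂ * t ^ (k : ℕ))) * qPoch q (b₂ * (a₂ * t ^ (k : ℕ)))) else 0) *
      ∏ k, ∏ l ∈ Finset.Ioi k, pairWt q t (x k) (x l) (ν k) (ν l) else 0) *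
      Delta (latPt q x ν) * 1 with hL
  have hsum : ∑' ν, L ν = limitTerm q t a₂ b₁ b₂ n := by
    rw [tsum_eq_single 0, ← origin_eq_limitTerm h]
    · have hf : InFan 0 (0 : Fin n → ℕ) := fun _ _ _ _ => le_rfl
      simp only [hL, if_pos hf, Pi.zero_apply, if_true, mul_one, hx, mul_assoc]
      congr 3
      funext k
      simp [latPt]
    · intro ν hν
      obtain ⟨k, hk⟩ := Function.ne_iff.1 hν
      simp only [hL]
      split_ifs
      · rw [Finset.prod_eq_zero (Finset.mem_univ k) (if_neg hk)]
        simp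
      · simp
  rw [← hsum]
  refine tendsto_tsum_of_dominated_convergence
    (bound := fun ν => C * gauge q (max 1 (‖t‖ ^ 2)) ν) ((summable_gauge h).mul_left C)
    (fun ν => ?_) (Eventually.of_forall fun N ν => by simpa using hC N ν)
  simp only [hz, hL]
  refine Tendsto.mul_const _ (Tendsto.mul_const _ ?_)
  unfold wt
  split_ifs with hf
  swap
  · exact tendsto_const_nhds
  simp only [hz, rawWt]
  have hprod : Tendsto (fun N : ℕ => ∏ k : Fin n,
      (theta q (a₁ * a₂⁻¹ * t ^ (-(k : ℤ)) * (q : ℂ) ^ N))⁻¹ * ((q : ℂ) ^ ν k *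
        siteWt q (a₁ * (q : ℂ) ^ N) a₂ b₁ b₂ (x k * (q : ℂ) ^ ν k))) atTop
      (𝓝 (∏ k, if ν k = 0 then qPoch q (q * t ^ (k : ℕ)) /
      (qPoch q (b₁ * (a₂ * t ^ (k : ℕ))) * qPoch q (b₂ * (a₂ * t ^ (k : ℕ)))) else 0)) := by
    refine tendsto_finsetProd _ fun k _ => ?_
    have hk := k.2
    have hlim := (qPoch_div_theta_uniform h.q_pos h.q_lt_one (u := q * a₁⁻¹ * (a₂ * t ^ (k : ℕ)))
      (v := a₁ * a₂⁻¹ * t ^ (-(k : ℤ))) (by positivity)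
      (mul_ne_zero (by positivity) (zpow_ne_zero _ ht)) (fun l hl => by
        refine h.ratio_pole' k (by rw [abs_lt]; omega) (l - 1) ?_
        rw [zpow_sub₀ hq, ← hl, zpow_natCast, zpow_one]
        field_simp) (by rw [zpow_neg, zpow_natCast]; field_simp)).2 (ν k)
    have h3 := hlim.mul_const ((q : ℂ) ^ ν k * (qPoch q (q * a₂⁻¹ * (x k * (q : ℂ) ^ ν k)) /
      (qPoch q (b₁ * (x k * (q : ℂ) ^ ν k)) * qPoch q (b₂ * (x k * (q : ℂ) ^ ν k)))))
    have e : (if ν k = 0 then qPoch q (q * t ^ (k : ℕ)) /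
        (qPoch q (b₁ * (a₂ * t ^ (k : ℕ))) * qPoch q (b₂ * (a₂ * t ^ (k : ℕ)))) else 0) =
        (if ν k = 0 then 1 else 0) * ((q : ℂ) ^ ν k * (qPoch q (q * a₂⁻¹ * (x k * (q : ℂ) ^ ν k)) /
      (qPoch q (b₁ * (x k * (q : ℂ) ^ ν k)) * qPoch q (b₂ * (x k * (q : ℂ) ^ ν k))))) := by
      split_ifs with h0
      · rw [h0, pow_zero, mul_one, one_mul, one_mul, hx,
          show (q : ℂ) * a₂⁻¹ * (a₂ * t ^ (k : ℕ)) = q * t ^ (k : ℕ) by field_simp]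
      · rw [zero_mul]
    rw [e]
    refine h3.congr fun N => ?_
    rw [siteWt, show q * (a₁ * (q : ℂ) ^ N)⁻¹ * (x k * (q : ℂ) ^ ν k) =
      q * a₁⁻¹ * (a₂ * t ^ (k : ℕ)) * (q : ℂ) ^ ν k / (q : ℂ) ^ N by rw [hx]; field_simp]
    ring
  refine (hprod.mul_const _).congr fun N => ?_
  rw [← mul_assoc, Finset.prod_mul_distrib, thetaCoef, Finset.prod_range_zero, one_mul, Nat.sub_zero,
    Finset.prod_range]
  congr 3
  funext k
  congr 2
  simp only [Nat.cast_zero, zero_sub]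
  ring

theorem tendsto_total_one (h : Admissible n q t a₁ a₂ b₁ b₂) :
    Tendsto (fun N : ℕ => total q t (a₁ * (q : ℂ) ^ N) a₂ b₁ b₂ n fun _ => 1) atTop
      (𝓝 (limitTerm q t a₂ b₁ b₂ n)) := by
  have h1 := tendsto_finsetSum (Finset.range n) fun i hi =>
    tendsto_latticeSum_of_ne_zero h (Nat.succ_ne_zero i) (Finset.mem_range.1 hi)
  have h2 := h1.add (tendsto_latticeSum_zero h)
  rw [Finset.sum_const_zero, zero_add] at h2
  refine h2.congr fun N => ?_
  rw [total, Finset.sum_range_succ']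

theorem qPoch_ab_ne_zero (h : Admissible n q t a₁ a₂ b₁ b₂) {k : ℕ} (hk : k < n) :
    qPoch q (a₁ * b₁ * t ^ k) ≠ 0 ∧ qPoch q (a₁ * b₂ * t ^ k) ≠ 0 :=
  ⟨qPoch_ne_zero h.q_pos h.q_lt_one fun N => h.a₁b₁_pole k hk N,
    qPoch_ne_zero h.q_pos h.q_lt_one fun N => h.a₁b₂_pole k hk N⟩

/-- The evaluation of the total mass: the limit of the iterated contiguity relation. -/
theorem total_one {m : ℕ} (h : Admissible (m + 1) q t a₁ a₂ b₁ b₂) :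
    total q t a₁ a₂ b₁ b₂ (m + 1) (fun _ => 1) = ∏ k ∈ Finset.range (m + 1),
      qPoch q q * qPoch q t * qPoch q (a₁ * a₂ * b₁ * b₂ * t ^ (m + k)) /
        (qPoch q (t ^ (k + 1)) * (qPoch q (a₁ * b₁ * t ^ k) * qPoch q (a₁ * b₂ * t ^ k) *
          qPoch q (a₂ * b₁ * t ^ k) * qPoch q (a₂ * b₂ * t ^ k))) := by
  have hp := tendsto_prod_qPoch h.q_pos h.q_lt_one
  have h1 : Tendsto (fun N => (∏ k ∈ Finset.range (m + 1),
      (∏ j ∈ Finset.range N, (1 - (q : ℂ) ^ j * (a₁ * b₁ * t ^ k))) *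
        ∏ j ∈ Finset.range N, (1 - (q : ℂ) ^ j * (a₁ * b₂ * t ^ k))) *
        total q t a₁ a₂ b₁ b₂ (m + 1) (fun _ => 1)) atTop _ :=
    (tendsto_finsetProd _ fun k _ => (hp (a₁ * b₁ * t ^ k)).mul (hp (a₁ * b₂ * t ^ k))).mul_const _
  have h2 := (tendsto_finsetProd (Finset.range (m + 1)) fun k _ =>
    hp (a₁ * a₂ * b₁ * b₂ * t ^ (m + k))).mul (tendsto_total_one h)
  have h3 := tendsto_nhds_unique h1 (h2.congr fun N => (total_one_iterate h N).symm)
  have h4 : ∏ k ∈ Finset.range (m + 1), qPoch q (a₁ * b₁ * t ^ k) * qPoch q (a₁ * b₂ * t ^ k) ≠ 0 :=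
    Finset.prod_ne_zero_iff.2 fun k hk =>
      mul_ne_zero (qPoch_ab_ne_zero h (Finset.mem_range.1 hk)).1
        (qPoch_ab_ne_zero h (Finset.mem_range.1 hk)).2
  refine mul_left_cancel₀ h4 ?_
  rw [h3, limitTerm, ← Finset.prod_mul_distrib, ← Finset.prod_mul_distrib]
  refine Finset.prod_congr rfl fun k hk => ?_
  obtain ⟨h5, h6⟩ := qPoch_ab_ne_zero h (Finset.mem_range.1 hk)
  field_simp

/-! ### Complex powers and the passage to the normalized weights -/

/-- The principal power is multiplicative when one factor is a positive real number. -/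
theorem mul_pow_cpow (hq0 : 0 < q) {x : ℂ} (hx : x ≠ 0) (N : ℕ) (c : ℂ) :
    (x * (q : ℂ) ^ N) ^ c = x ^ c * ((q : ℂ) ^ c) ^ N := by
  have hq : (q : ℂ) ≠ 0 := by exact_mod_cast hq0.ne'
  have hN : (0 : ℝ) < q ^ N := pow_pos hq0 N
  rw [Complex.cpow_def_of_ne_zero (mul_ne_zero hx (pow_ne_zero _ hq)),
    Complex.cpow_def_of_ne_zero hx, Complex.cpow_def_of_ne_zero hq, ← Complex.exp_nat_mul,
    ← Complex.exp_add, ← Complex.ofReal_pow, Complex.log_mul_ofReal _ hN _ hx, Real.log_pow,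
    ← Complex.ofReal_log hq0.le]
  congr 1
  push_cast
  ring

theorem cpow_two_mul_sub_one (hq : (q : ℂ) ≠ 0) {τ : ℂ} (ht : t = (q : ℂ) ^ τ) :
    (q : ℂ) ^ (2 * τ - 1) = t ^ 2 / q := by
  rw [Complex.cpow_sub _ _ hq, Complex.cpow_one, ht, ← Complex.cpow_nat_mul]
  norm_num

/-- `Φ` and the weight `rawWt` differ by a factor that depends on the base point only. -/
theorem Phi_eq_rawWt (hq0 : 0 < q) {τ : ℂ} (ht : t = (q : ℂ) ^ τ) {x : Fin n → ℂ}
    (hx : ∀ k, x k ≠ 0) (ν : Fin n → ℕ) :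
    Phi q τ t a₁ a₂ b₁ b₂ (latPt q x ν) =
      (∏ k : Fin n, x k * (x k ^ (2 * τ)) ^ (n - 1 - (k : ℕ))) * rawWt q t a₁ a₂ b₁ b₂ x ν := by
  have hq : (q : ℂ) ≠ 0 := by exact_mod_cast hq0.ne'
  have h1 : ∀ k, (∏ l ∈ Finset.Ioi k, latPt q x ν k ^ (2 * τ - 1) *
      (qPoch q (q * t⁻¹ * (latPt q x ν l / latPt q x ν k)) /
        qPoch q (t * (latPt q x ν l / latPt q x ν k)))) =
      (x k ^ (2 * τ)) ^ (n - 1 - (k : ℕ)) * ∏ l ∈ Finset.Ioi k,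
        pairWt q t (x k) (x l) (ν k) (ν l) := fun k => by
    rw [← Fin.card_Ioi, ← Finset.prod_const, ← Finset.prod_mul_distrib]
    refine Finset.prod_congr rfl fun l _ => ?_
    rw [latPt, mul_pow_cpow hq0 (hx k), cpow_two_mul_sub_one hq ht,
      Complex.cpow_sub _ _ (hx k), Complex.cpow_one, pairWt, pairRatio,
      show latPt q x ν l = x l * (q : ℂ) ^ ν l from rfl]
    ring
  have h2 := Finset.prod_mul_distrib (s := Finset.univ) (f := x)
    (g := fun k => (x k ^ (2 * τ)) ^ (n - 1 - (k : ℕ)))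
  have h3 : ∏ k, latPt q x ν k * (qPoch q (q * a₁⁻¹ * latPt q x ν k) / qPoch q (b₁ * latPt q x ν k))
      * (qPoch q (q * a₂⁻¹ * latPt q x ν k) / qPoch q (b₂ * latPt q x ν k)) =
      (∏ k, x k) * ∏ k, (q : ℂ) ^ ν k * siteWt q a₁ a₂ b₁ b₂ (x k * (q : ℂ) ^ ν k) := by
    rw [← Finset.prod_mul_distrib]
    refine Finset.prod_congr rfl fun k _ => ?_
    rw [siteWt, latPt]
    ring
  unfold Phi rawWt
  rw [Finset.prod_congr rfl fun k _ => h1 k, h2, h3,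
    Finset.prod_mul_distrib (f := fun k => (x k ^ (2 * τ)) ^ (n - 1 - (k : ℕ)))]
  ring

/-- The power of a coordinate of the base point in the coefficient cancels the power in `Φ`. -/
theorem cpow_cancel {x : ℂ} (hx : x ≠ 0) (τ : ℂ) (e : ℕ) :
    x ^ (-1 - 2 * (e : ℂ) * τ) * (x * (x ^ (2 * τ)) ^ e) = 1 := by
  rw [← Complex.cpow_nat_mul]
  nth_rewrite 2 [← Complex.cpow_one x]
  rw [← Complex.cpow_add _ _ hx, ← Complex.cpow_add _ _ hx]
  convert Complex.cpow_zero x using 2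
  ring

theorem prod_Icc_one {M : Type*} [CommMonoid M] (f : ℕ → M) (i : ℕ) :
    ∏ j ∈ Finset.Icc 1 i, f j = ∏ j ∈ Finset.range i, f (j + 1) := by
  induction i with
  | zero => simp
  | succ i ih => rw [Finset.prod_Icc_succ_top (by omega), ih, Finset.prod_range_succ]

/-- The coefficients of the truncated integrals in terms of the theta normalization. -/
theorem coefficient_eq {τ : ℂ} {i : ℕ} (hi : i ≤ n) :
    (∏ j ∈ Finset.Icc 1 i, (a₁ * t ^ (j - 1)) ^ (-1 - 2 * ((n : ℂ) - j) * τ) /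
          theta q (a₂ * a₁⁻¹ * t ^ (-(j : ℤ) + 1))) *
        (∏ k ∈ Finset.Icc 1 (n - i),
          (a₂ * t ^ (k - 1)) ^ (-1 - 2 * ((n : ℂ) - i - k) * τ) /
          theta q (a₁ * a₂⁻¹ * t ^ ((i : ℤ) - k + 1))) =
      thetaCoef q t a₁ a₂ n i *
        ∏ k : Fin n, zeta t a₁ a₂ n i k ^ (-1 - 2 * ((n - 1 - (k : ℕ) : ℕ) : ℂ) * τ) := by
  obtain ⟨d, rfl⟩ := Nat.exists_eq_add_of_le hi
  have e1 : ∏ k : Fin i, zeta t a₁ a₂ (i + d) i (Fin.castAdd d k) ^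
      (-1 - 2 * ((i + d - 1 - (Fin.castAdd d k : ℕ) : ℕ) : ℂ) * τ) =
      ∏ j ∈ Finset.range i, (a₁ * t ^ j) ^ (-1 - 2 * (((i + d : ℕ) : ℂ) - (j + 1 : ℕ)) * τ) := by
    rw [Finset.prod_range]
    refine Finset.prod_congr rfl fun k _ => ?_
    have hk := k.2
    rw [zeta_of_lt (by simp), ← Nat.cast_sub (by omega), Fin.val_castAdd,
      show i + d - 1 - (k : ℕ) = i + d - (k + 1) by omega]
  have e2 : ∏ k : Fin d, zeta t a₁ a₂ (i + d) i (Fin.natAdd i k) ^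
      (-1 - 2 * ((i + d - 1 - (Fin.natAdd i k : ℕ) : ℕ) : ℂ) * τ) =
      ∏ j ∈ Finset.range d, (a₂ * t ^ j) ^
        (-1 - 2 * (((i + d : ℕ) : ℂ) - i - (j + 1 : ℕ)) * τ) := by
    rw [Finset.prod_range]
    refine Finset.prod_congr rfl fun k _ => ?_
    have hk := k.2
    rw [zeta_of_ge (by simp), ← Nat.cast_sub (by omega), ← Nat.cast_sub (by omega),
      Fin.val_natAdd, Nat.add_sub_cancel_left,
      show i + d - 1 - (i + (k : ℕ)) = i + d - i - (k + 1) by omega]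
  rw [Fin.prod_univ_add, e1, e2, Nat.add_sub_cancel_left, prod_Icc_one, prod_Icc_one, thetaCoef,
    Nat.add_sub_cancel_left, mul_mul_mul_comm, ← Finset.prod_mul_distrib,
    ← Finset.prod_mul_distrib]
  congr 1
  · refine Finset.prod_congr rfl fun j _ => ?_
    rw [Nat.add_sub_cancel, div_eq_inv_mul,
      show -((j + 1 : ℕ) : ℤ) + 1 = -(j : ℤ) by push_cast; ring]
  · refine Finset.prod_congr rfl fun j _ => ?_
    rw [Nat.add_sub_cancel, div_eq_inv_mul,
      show (i : ℤ) - ((j + 1 : ℕ) : ℤ) + 1 = i - j by push_cast; ring]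

theorem thetaCoef_ne_zero (h : Admissible n q t a₁ a₂ b₁ b₂) (i : ℕ) (hi : i ≤ n) :
    thetaCoef q t a₁ a₂ n i ≠ 0 := by
  have h1 := h.a₁_ne
  have h2 := h.a₂_ne
  refine mul_ne_zero (Finset.prod_ne_zero_iff.2 fun j hj => inv_ne_zero ?_)
    (Finset.prod_ne_zero_iff.2 fun k hk => inv_ne_zero ?_)
  · rw [Finset.mem_range] at hj
    exact theta_ne_zero h.q_pos h.q_lt_one
      (mul_ne_zero (by positivity) (zpow_ne_zero _ h.t_ne))
      (h.ratio_pole' _ (by rw [abs_lt]; omega))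
  · rw [Finset.mem_range] at hk
    exact theta_ne_zero h.q_pos h.q_lt_one
      (mul_ne_zero (by positivity) (zpow_ne_zero _ h.t_ne))
      (h.ratio_pole _ (by rw [abs_lt]; omega))

theorem natCast_mem_fan_iff (i : ℕ) (ν : Fin n → ℕ) :
    (fun k => (ν k : ℤ)) ∈ fan n i ↔ InFan i ν := by
  constructor
  · rintro ⟨-, h⟩
    have key : ∀ (d : ℕ) (k l : Fin n), (l : ℕ) = k + d → ((k : ℕ) < i ↔ (l : ℕ) < i) →
        ν k ≤ ν l := by
      intro d
      induction d with
      | zero => exact fun k l hl _ => (congrArg ν (Fin.ext hl.symm)).le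
      | succ d ih =>
        intro k l hl hb
        refine (ih k ⟨k + d, by omega⟩ rfl (by simp only; omega)).trans ?_
        exact Int.ofNat_le.1 (h ⟨k + d, by omega⟩ l (by simp only; omega) (by omega))
    intro k l hkl hb
    have : (k : ℕ) < l := hkl
    exact key (l - k) k l (by omega) hb
  · intro h
    refine ⟨fun k => Nat.cast_nonneg _, fun k l hkl hl => ?_⟩
    exact Int.ofNat_le.2 (h k l (Fin.lt_def.2 (by omega)) (by omega))

theorem injective_natCast_comp : Function.Injective fun (ν : Fin n → ℕ) (k : Fin n) => (ν k : ℤ) :=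
  fun _ _ h => funext fun k => Int.ofNat_inj.1 (congrFun h k)

theorem mem_range_of_mem_fan {i : ℕ} {ν : Fin n → ℤ} (hν : ν ∈ fan n i) :
    ν ∈ Set.range fun (ν : Fin n → ℕ) (k : Fin n) => (ν k : ℤ) :=
  ⟨fun k => (ν k).toNat, funext fun k => Int.toNat_of_nonneg (hν.1 k)⟩

/-- The coordinates of the points of the fan are non-negative, so that sums over the fan are sums
over vectors of natural numbers. -/
theorem tsum_fan {E : Type*} [AddCommMonoid E] [TopologicalSpace E] (i : ℕ)
    (F : (Fin n → ℤ) → E) : ∑' ν : fan n i, F ν =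
      ∑' ν : Fin n → ℕ, (fan n i).indicator F fun k => (ν k : ℤ) := by
  rw [tsum_subtype]
  refine (injective_natCast_comp.tsum_eq fun ν hν => ?_).symm
  exact mem_range_of_mem_fan (Set.mem_of_indicator_ne_zero hν)

theorem summable_fan_iff (i : ℕ) (F : (Fin n → ℤ) → ℝ) :
    (Summable fun ν : fan n i => F ν) ↔
      Summable fun ν : Fin n → ℕ => (fan n i).indicator F fun k => (ν k : ℤ) := by
  have h := injective_natCast_comp.summable_iff (f := (fan n i).indicator F)
    fun ν hν => Set.indicator_of_notMem (mt mem_range_of_mem_fan hν) _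
  exact summable_subtype_iff_indicator.trans h.symm

theorem coefficient_mul_integrand (h : Admissible n q t a₁ a₂ b₁ b₂) {τ : ℂ}
    (ht : t = (q : ℂ) ^ τ) (i : ℕ) (ν : Fin n → ℕ) :
    (thetaCoef q t a₁ a₂ n i *
        ∏ k : Fin n, zeta t a₁ a₂ n i k ^ (-1 - 2 * ((n - 1 - (k : ℕ) : ℕ) : ℂ) * τ)) *
      (fan n i).indicator
        (fun ν => integrand q τ t a₁ a₂ b₁ b₂ (qShift q (zeta t a₁ a₂ n i) ν))
        (fun k => (ν k : ℤ)) =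
      wt q t a₁ a₂ b₁ b₂ i ν * Delta (latPt q (zeta t a₁ a₂ n i) ν) * 1 := by
  by_cases hf : InFan i ν
  · have hx := zeta_ne_zero (n := n) h.t_ne h.a₁_ne h.a₂_ne i
    have e : qShift q (zeta t a₁ a₂ n i) (fun k => (ν k : ℤ)) = latPt q (zeta t a₁ a₂ n i) ν := by
      funext k; simp [qShift, latPt]
    have h1 : (∏ k : Fin n, zeta t a₁ a₂ n i k ^ (-1 - 2 * ((n - 1 - (k : ℕ) : ℕ) : ℂ) * τ)) *
        ∏ k : Fin n, (zeta t a₁ a₂ n i k *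
          (zeta t a₁ a₂ n i k ^ (2 * τ)) ^ (n - 1 - (k : ℕ))) = 1 := by
      rw [← Finset.prod_mul_distrib]
      exact Finset.prod_eq_one fun k _ => cpow_cancel (hx k) τ _
    rw [Set.indicator_of_mem ((natCast_mem_fan_iff i ν).2 hf), e, integrand,
      Phi_eq_rawWt h.q_pos ht hx, wt, if_pos hf]
    linear_combination thetaCoef q t a₁ a₂ n i * rawWt q t a₁ a₂ b₁ b₂ (zeta t a₁ a₂ n i) ν *
      Delta (latPt q (zeta t a₁ a₂ n i) ν) * h1
  · rw [Set.indicator_of_notMem (mt (natCast_mem_fan_iff i ν).1 hf), wt, if_neg hf]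
    simp

theorem summable_norm_integrand (h : Admissible n q t a₁ a₂ b₁ b₂) {τ : ℂ}
    (ht : t = (q : ℂ) ^ τ) {i : ℕ} (hi : i ≤ n) :
    Summable fun ν : fan n i =>
      ‖integrand q τ t a₁ a₂ b₁ b₂ (qShift q (zeta t a₁ a₂ n i) ν.1)‖ := by
  have hx := zeta_ne_zero (n := n) h.t_ne h.a₁_ne h.a₂_ne i
  have hc : thetaCoef q t a₁ a₂ n i *
      ∏ k : Fin n, zeta t a₁ a₂ n i k ^ (-1 - 2 * ((n - 1 - (k : ℕ) : ℕ) : ℂ) * τ) ≠ 0 := by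
    refine mul_ne_zero (thetaCoef_ne_zero h i hi) (Finset.prod_ne_zero_iff.2 fun k _ => ?_)
    rw [Complex.cpow_def_of_ne_zero (hx k)]
    exact Complex.exp_ne_zero _
  rw [summable_fan_iff i fun ν => ‖integrand q τ t a₁ a₂ b₁ b₂ (qShift q (zeta t a₁ a₂ n i) ν)‖]
  refine ((summable_norm_wt_mul h hi (fun _ => 1) continuous_const).mul_left
    ‖(thetaCoef q t a₁ a₂ n i *
      ∏ k : Fin n, zeta t a₁ a₂ n i k ^ (-1 - 2 * ((n - 1 - (k : ℕ) : ℕ) : ℂ) * τ))⁻¹‖).congr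
    fun ν => ?_
  rw [← norm_mul, ← coefficient_mul_integrand h ht, inv_mul_cancel_left₀ hc,
    norm_indicator_eq_indicator_norm]

theorem sum_truncJ (h : Admissible n q t a₁ a₂ b₁ b₂) {τ : ℂ} (ht : t = (q : ℂ) ^ τ) :
    ∑ i ∈ Finset.range (n + 1), truncJ q τ t a₁ a₂ b₁ b₂ n i *
        (∏ j ∈ Finset.Icc 1 i, (a₁ * t ^ (j - 1)) ^ (-1 - 2 * ((n : ℂ) - j) * τ) /
          theta q (a₂ * a₁⁻¹ * t ^ (-(j : ℤ) + 1))) *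
        (∏ k ∈ Finset.Icc 1 (n - i),
          (a₂ * t ^ (k - 1)) ^ (-1 - 2 * ((n : ℂ) - i - k) * τ) /
          theta q (a₁ * a₂⁻¹ * t ^ ((i : ℤ) - k + 1))) =
      (1 - (q : ℂ)) ^ n * total q t a₁ a₂ b₁ b₂ n fun _ => 1 := by
  rw [total, Finset.mul_sum]
  refine Finset.sum_congr rfl fun i hi => ?_
  rw [mul_assoc, coefficient_eq (Nat.lt_succ_iff.1 (Finset.mem_range.1 hi)), truncJ,
    tsum_fan i fun ν => integrand q τ t a₁ a₂ b₁ b₂ (qShift q (zeta t a₁ a₂ n i) ν), mul_assoc,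
    mul_comm (∑' _, _), ← tsum_mul_left]
  congr 1
  exact tsum_congr fun ν => coefficient_mul_integrand h ht i ν

end QSelberg

theorem mainTheorem4 (n : ℕ) (q : ℝ) (hq0 : 0 < q) (hq1 : q < 1)
    (τ t a₁ a₂ b₁ b₂ : ℂ) (ht : t = (q : ℂ) ^ τ)
    (hconv₁ : ∀ i ∈ Finset.Icc 1 n, ‖(q : ℂ) * t ^ (2 * i - 2)‖ < 1)
    (hconv₂ : ∀ i ∈ Finset.Icc 1 n, q < ‖a₁ * a₂ * b₁ * b₂ * t ^ (2 * i - 2)‖)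
    (ht_pole : ∀ k ∈ Finset.Icc 1 n, ∀ N : ℕ, t ^ k * (q : ℂ) ^ N ≠ 1)
    (hab_pole : ∀ k ∈ Finset.Icc 1 n, ∀ N : ℕ,
      a₁ * b₁ * t ^ (k - 1) * (q : ℂ) ^ N ≠ 1 ∧ a₁ * b₂ * t ^ (k - 1) * (q : ℂ) ^ N ≠ 1 ∧
      a₂ * b₁ * t ^ (k - 1) * (q : ℂ) ^ N ≠ 1 ∧ a₂ * b₂ * t ^ (k - 1) * (q : ℂ) ^ N ≠ 1)
    (hθ_pole : ∀ m : ℤ, |m| < (n : ℤ) → ∀ l : ℤ, a₁ * a₂⁻¹ * t ^ m ≠ (q : ℂ) ^ l) :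
    (∀ i ∈ Finset.range (n + 1), Summable fun ν : QSelberg.fan n i =>
      ‖QSelberg.integrand q τ t a₁ a₂ b₁ b₂
        (QSelberg.qShift q (QSelberg.zeta t a₁ a₂ n i) ν.1)‖) ∧
    ∑ i ∈ Finset.range (n + 1), QSelberg.truncJ q τ t a₁ a₂ b₁ b₂ n i *
        (∏ j ∈ Finset.Icc 1 i, (a₁ * t ^ (j - 1)) ^ (-1 - 2 * ((n : ℂ) - j) * τ) /
          QSelberg.theta q (a₂ * a₁⁻¹ * t ^ (-(j : ℤ) + 1))) *
        (∏ k ∈ Finset.Icc 1 (n - i),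
          (a₂ * t ^ (k - 1)) ^ (-1 - 2 * ((n : ℂ) - i - k) * τ) /
          QSelberg.theta q (a₁ * a₂⁻¹ * t ^ ((i : ℤ) - k + 1))) =
      (1 - (q : ℂ)) ^ n * ∏ k ∈ Finset.Icc 1 n,
        (QSelberg.qPoch q q * QSelberg.qPoch q t *
            QSelberg.qPoch q (a₁ * a₂ * b₁ * b₂ * t ^ (n + k - 2))) /
          (QSelberg.qPoch q (t ^ k) *
            (QSelberg.qPoch q (a₁ * b₁ * t ^ (k - 1)) *
             QSelberg.qPoch q (a₁ * b₂ * t ^ (k - 1)) *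
             QSelberg.qPoch q (a₂ * b₁ * t ^ (k - 1)) *
             QSelberg.qPoch q (a₂ * b₂ * t ^ (k - 1)))) := by
  rcases n with _ | m
  · -- The lattices are single points and the integrand is an empty product.
    have : Finite (QSelberg.fan 0 0) := inferInstance
    refine ⟨fun i hi => ?_, ?_⟩
    · have : Finite (QSelberg.fan 0 i) := inferInstance
      exact Summable.of_finite
    · have hfan : QSelberg.fan 0 0 = Set.univ :=
        Set.eq_univ_of_forall fun ν => ⟨fun k => k.elim0, fun k => k.elim0⟩
      simp [QSelberg.truncJ, QSelberg.integrand, QSelberg.Phi, QSelberg.Delta, hfan]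
  have hq : (q : ℂ) ≠ 0 := by exact_mod_cast hq0.ne'
  have hprod : a₁ * a₂ * b₁ * b₂ ≠ 0 := fun h => by
    have := hconv₂ 1 (by simp)
    rw [h, zero_mul, norm_zero] at this
    exact this.not_gt hq0
  have hpole : ∀ k < m + 1, ∀ N : ℕ, _ := fun k hk N =>
    hab_pole (k + 1) (Finset.mem_Icc.2 ⟨by omega, by omega⟩) N
  simp only [Nat.add_sub_cancel] at hpole
  have h : QSelberg.Admissible (m + 1) q t a₁ a₂ b₁ b₂ :=
    { q_pos := hq0
      q_lt_one := hq1
      t_ne := by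
        rw [ht, Complex.cpow_def_of_ne_zero hq]
        exact Complex.exp_ne_zero _
      a₁_ne := left_ne_zero_of_mul (left_ne_zero_of_mul (left_ne_zero_of_mul hprod))
      a₂_ne := right_ne_zero_of_mul (left_ne_zero_of_mul (left_ne_zero_of_mul hprod))
      t_pole := ht_pole
      a₁b₁_pole := fun k hk N => (hpole k hk N).1
      a₁b₂_pole := fun k hk N => (hpole k hk N).2.1
      a₂b₁_pole := fun k hk N => (hpole k hk N).2.2.1
      a₂b₂_pole := fun k hk N => (hpole k hk N).2.2.2
      ratio_pole := hθ_pole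
      conv := by
        -- The condition for the largest `i` and `q < 1` cover both values of the maximum.
        have h1 := hconv₁ (m + 1) (by simp)
        rw [norm_mul, QSelberg.norm_ofReal_pos hq0, norm_pow,
          show 2 * (m + 1) - 2 = 2 * m by omega, pow_mul] at h1
        rw [Nat.add_sub_cancel]
        rcases max_choice 1 (‖t‖ ^ 2) with h2 | h2
        · rwa [h2, one_pow, mul_one]
        · rwa [h2] }
  refine ⟨fun i hi => QSelberg.summable_norm_integrand h ht
    (Nat.lt_succ_iff.1 (Finset.mem_range.1 hi)), ?_⟩
  rw [QSelberg.sum_truncJ h ht, QSelberg.total_one h, QSelberg.prod_Icc_one]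
  congr 1
  refine Finset.prod_congr rfl fun k _ => ?_
  rw [show m + 1 + (k + 1) - 2 = m + k by omega, Nat.add_sub_cancel]
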